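/- Let $(\zeta_k)_{k\ge 0}$ be i.i.d. random vectors with values in $\mathbb{Z}^2$ on a probability space $(\Omega,\mathbb{P})$, centered ($\mathbb{E}\,\zeta_0=0$), with $\mathbb{E}\|\zeta_0\|^2<\infty$, and aperiodic: the set $\{\ell\in\mathbb{Z}^2:\mathbb{P}(\zeta_0=\ell)>0\}$ generates the group $\mathbb{Z}^2$. Let $\Sigma$ be the covariance matrix of $\zeta_0$, and let $Z_0=0$, $Z_n=\zeta_0+\dots+\zeta_{n-1}$ be the associated random walk. Let $X=(X_\ell)_{\ell\in\mathbb{Z}^2}$ be i.i.d. real random variables on a probability space $(E,\mathcal{B},\mu)$ with mean $0$ and $\int X_0^2\,d\mu=1$. For $\omega\in\Omega$ and $x\in E$ put $$S_n^{\omega,X}(x)=\sum_{k=0}^{n-1}X_{Z_k(\omega)}(x),\qquad Y_n(\omega,x,t)=\frac{S^{\omega,X}_{\lfloor nt\rfloor}(x)}{\sqrt{n\log n}},\quad t\in[0,1],\ n\ge 2 .$$ Then $\det\Sigma>0$ and, for $\mathbb{P}$-a.e. $\omega$, the processes $(Y_n(\omega,\cdot,t))_{t\in[0,1]}$, defined on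 $(E,\mu)$, satisfy a functional central limit theorem with asymptotic variance $\sigma^2=(\pi\sqrt{\det\Sigma})^{-1}$: as $n\to\infty$ they converge in distribution, in the space $D[0,1]$ of right continuous real functions on $[0,1]$ with left limits, endowed with the uniform norm, to $(\sigma W(t))_{t\in[0,1]}$, where $W$ is a standard Wiener process. -/

import Mathlib

open MeasureTheory ProbabilityTheory Filter Topology
open scoped NNReal ENNReal

noncomputable section

/-! ### The space `D[0,1]` with the uniform norm -/

/-- `f : [0,1] → ℝ` is right continuous with left limits (at `0` the left limit is no condition,
since `𝓝[<] 0` is the trivial filter). -/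
def IsCadlag (f : unitInterval → ℝ) : Prop :=
  ∀ t, ContinuousWithinAt f (Set.Ici t) t ∧ ∃ l, Tendsto f (𝓝[<] t) (𝓝 l)

theorem Continuous.isCadlag {f : unitInterval → ℝ} (hf : Continuous f) : IsCadlag f :=
  fun t => ⟨hf.continuousWithinAt, f t, (hf.tendsto t).mono_left nhdsWithin_le_nhds⟩

/-- A function on `[0,1]` that is right continuous with left limits is bounded. -/
theorem IsCadlag.memℓp {f : unitInterval → ℝ} (hf : IsCadlag f) :
    Memℓp (E := fun _ : unitInterval => ℝ) f ∞ := by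
  have key : ∃ C, ∀ t ∈ (Set.univ : Set unitInterval), ‖f t‖ ≤ C := by
    refine isCompact_univ.induction_on (p := fun s => ∃ C, ∀ t ∈ s, ‖f t‖ ≤ C) ?_ ?_ ?_ ?_
    · exact ⟨0, fun t ht => ht.elim⟩
    · rintro s u hsu ⟨C, hC⟩
      exact ⟨C, fun t ht => hC t (hsu ht)⟩
    · rintro s u ⟨C, hC⟩ ⟨C', hC'⟩
      refine ⟨max C C', fun t ht => ?_⟩
      rcases ht with ht | ht
      · exact (hC t ht).trans (le_max_left _ _)
      · exact (hC' t ht).trans (le_max_right _ _)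
    · intro t _
      obtain ⟨hr, l, hl⟩ := hf t
      have h1 : ∀ᶠ s in 𝓝[<] t, ‖f s‖ ≤ ‖l‖ + 1 :=
        (hl.norm.eventually_lt_const (lt_add_one ‖l‖)).mono fun _ h => h.le
      have h2 : ∀ᶠ s in 𝓝[≥] t, ‖f s‖ ≤ ‖f t‖ + 1 :=
        (hr.norm.tendsto.eventually_lt_const (lt_add_one ‖f t‖)).mono fun _ h => h.le
      refine ⟨{s | ‖f s‖ ≤ max (‖l‖ + 1) (‖f t‖ + 1)}, ?_, _, fun s hs => hs⟩
      rw [nhdsWithin_univ, ← nhdsLT_sup_nhdsGE t, mem_sup]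
      exact ⟨h1.mono fun _ h => h.trans (le_max_left _ _),
        h2.mono fun _ h => h.trans (le_max_right _ _)⟩
  obtain ⟨C, hC⟩ := key
  refine memℓp_infty ⟨C, ?_⟩
  rintro _ ⟨t, rfl⟩
  exact hC t (Set.mem_univ t)

/-- The functions that are right continuous with left limits, inside the space of all bounded
functions on `[0,1]` with the supremum norm. -/
def cadlagSubmodule : Submodule ℝ (lp (fun _ : unitInterval => ℝ) ∞) where
  carrier := {f | IsCadlag (fun t => f t)}
  add_mem' {f g} hf hg t := by
    obtain ⟨l, hl⟩ := (hf t).2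
    obtain ⟨m, hm⟩ := (hg t).2
    exact ⟨(hf t).1.add (hg t).1, l + m, hl.add hm⟩
  zero_mem' t := ⟨continuousWithinAt_const, 0, tendsto_const_nhds⟩
  smul_mem' c f hf t := by
    obtain ⟨l, hl⟩ := (hf t).2
    exact ⟨(hf t).1.const_mul c, c * l, hl.const_mul c⟩

/-- The space `D[0,1]`, with the uniform norm. -/
def SpaceD : Type := cadlagSubmodule

instance : NormedAddCommGroup SpaceD := inferInstanceAs (NormedAddCommGroup cadlagSubmodule)

instance : NormedSpace ℝ SpaceD := inferInstanceAs (NormedSpace ℝ cadlagSubmodule)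

instance : MeasurableSpace SpaceD := borel SpaceD

instance : BorelSpace SpaceD := ⟨rfl⟩

instance : CoeFun SpaceD (fun _ => unitInterval → ℝ) := ⟨fun f => f.1⟩

/-- A function that is right continuous with left limits, as a point of `D[0,1]`. -/
def IsCadlag.toD {f : unitInterval → ℝ} (hf : IsCadlag f) : SpaceD := ⟨⟨f, hf.memℓp⟩, hf⟩

@[simp]
theorem IsCadlag.toD_apply {f : unitInterval → ℝ} (hf : IsCadlag f) (t : unitInterval) :
    hf.toD t = f t := rfl

/-! ### The rescaled partial sum process -/

/-- `t ↦ s(⌊n t⌋) / √(n log n)` on `[0,1]`. -/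
def rescaledFun (s : ℕ → ℝ) (n : ℕ) (t : unitInterval) : ℝ :=
  s ⌊(n : ℝ) * (t : ℝ)⌋₊ / √((n : ℝ) * Real.log n)

theorem isCadlag_rescaledFun (s : ℕ → ℝ) (n : ℕ) : IsCadlag (rescaledFun s n) := by
  rcases Nat.eq_zero_or_pos n with rfl | hn
  · have h : rescaledFun s 0 = fun _ => 0 := by
      funext t
      simp [rescaledFun]
    rw [h]
    exact continuous_const.isCadlag
  have hn' : (0 : ℝ) < n := by exact_mod_cast hn
  have hc : Continuous fun t : unitInterval => (n : ℝ) * (t : ℝ) := by fun_prop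
  have hfun : rescaledFun s n = (fun m : ℤ => s m.toNat / √((n : ℝ) * Real.log n)) ∘
      (fun y : ℝ => ⌊y⌋) ∘ fun t : unitInterval => (n : ℝ) * (t : ℝ) := rfl
  intro t
  constructor
  · have h1 : Tendsto (fun t : unitInterval => (n : ℝ) * (t : ℝ)) (𝓝[≥] t)
        (𝓝[≥] ((n : ℝ) * (t : ℝ))) := by
      refine tendsto_nhdsWithin_iff.2 ⟨(hc.tendsto t).mono_left nhdsWithin_le_nhds, ?_⟩
      filter_upwards [self_mem_nhdsWithin] with u hu
      exact mul_le_mul_of_nonneg_left hu hn'.le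
    have h2 := (tendsto_floor_right_pure_floor ((n : ℝ) * (t : ℝ))).comp h1
    have h3 := (tendsto_pure_pure
      (fun m : ℤ => s m.toNat / √((n : ℝ) * Real.log n)) _).comp h2
    exact h3.mono_right (pure_le_nhds _)
  · have h1 : Tendsto (fun t : unitInterval => (n : ℝ) * (t : ℝ)) (𝓝[<] t)
        (𝓝[<] ((n : ℝ) * (t : ℝ))) := by
      refine tendsto_nhdsWithin_iff.2 ⟨(hc.tendsto t).mono_left nhdsWithin_le_nhds, ?_⟩
      filter_upwards [self_mem_nhdsWithin] with u hu
      exact mul_lt_mul_of_pos_left hu hn'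
    have h2 := (tendsto_floor_left_pure_ceil_sub_one ((n : ℝ) * (t : ℝ))).comp h1
    have h3 := (tendsto_pure_pure
      (fun m : ℤ => s m.toNat / √((n : ℝ) * Real.log n)) _).comp h2
    exact ⟨_, h3.mono_right (pure_le_nhds _)⟩

/-- `t ↦ s(⌊n t⌋) / √(n log n)` as a point of `D[0,1]`. -/
def rescaledPath (s : ℕ → ℝ) (n : ℕ) : SpaceD := (isCadlag_rescaledFun s n).toD

/-! ### Random walk in random scenery -/

/-- The random walk `Z_n = ζ_0 + ⋯ + ζ_{n-1}` on `ℤ²`, with `Z_0 = 0`. -/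
def walk {Ω : Type*} (ζ : ℕ → Ω → (Fin 2 → ℤ)) (n : ℕ) (ω : Ω) : Fin 2 → ℤ :=
  ∑ k ∈ Finset.range n, ζ k ω

/-- The sum `S_n(ω, x) = ∑_{k < n} X_{Z_k(ω)}(x)` of the scenery `X` along the walk. -/
def scenerySum {Ω E : Type*} (ζ : ℕ → Ω → (Fin 2 → ℤ)) (X : (Fin 2 → ℤ) → E → ℝ)
    (ω : Ω) (n : ℕ) (x : E) : ℝ :=
  ∑ k ∈ Finset.range n, X (walk ζ k ω) x

/-- The covariance matrix `Σ` of a random vector with values in `ℤ²`. -/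
def covMat {Ω : Type*} [MeasurableSpace Ω] (P : Measure Ω) (ξ : Ω → (Fin 2 → ℤ)) :
    Matrix (Fin 2) (Fin 2) ℝ :=
  Matrix.of fun i j => cov[fun ω => (ξ ω i : ℝ), fun ω => (ξ ω j : ℝ); P]

/-- The walk with step `ξ` is aperiodic: the points of `ℤ²` that `ξ` takes with positive
probability generate the group `ℤ²`. -/
def IsAperiodicStep {Ω : Type*} [MeasurableSpace Ω] (P : Measure Ω) (ξ : Ω → (Fin 2 → ℤ)) : Prop :=
  AddSubgroup.closure {l : Fin 2 → ℤ | 0 < P {ω | ξ ω = l}} = ⊤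

/-! ### The Wiener process -/

/-- `W` is a standard Wiener process under `Q`: its finite-dimensional laws are the centered
Gaussian laws with covariance `min s t`, and its paths are continuous. -/
structure IsWiener {Ω : Type*} [MeasurableSpace Ω] (W : ℝ≥0 → Ω → ℝ) (Q : Measure Ω) : Prop where
  isPreBrownian : IsPreBrownianReal W Q
  continuous_path : ∀ x, Continuous fun t => W t x

/-- The path `t ↦ W_t(x)`, `t ∈ [0,1]`, as a point of `D[0,1]`. -/
def IsWiener.path {Ω : Type*} [MeasurableSpace Ω] {W : ℝ≥0 → Ω → ℝ} {Q : Measure Ω}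
    (hW : IsWiener W Q) (x : Ω) : SpaceD :=
  IsCadlag.toD (f := fun t : unitInterval => W ⟨(t : ℝ), t.2.1⟩ x) <| Continuous.isCadlag <|
    (hW.continuous_path x).comp (by fun_prop)

end

/-! Once ω is fixed, the sum along the walk is a weighted sum Σ_l N_n(l) X_l of independent
variables, where N_n(l) counts the visits to l before time n. Its variance Σ_l N_n(l)² is the number
of pairs of times at which the walk is at the same point. All that is needed of the path is
`HasUniformCoincidences`: [0, n) carries about v n log n such pairs, and each of m equal blocks
about v n log n / m. The blocks then exhaust the total, so distinct blocks share only o(n log n)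
pairs. Hence increments over distinct blocks are asymptotically uncorrelated
(`HasUniformCoincidences.tendsto_sum_sq`), and no site carries a positive fraction of √(n log n)
(`HasUniformCoincidences.eventually_occupation_le`). A characteristic function argument
(`tendsto_prod_charFun`) then gives the Gaussian limit of the block increments.

The passage to the uniform norm needs control inside a block. Sums along a path that revisits sites
are not a martingale, but they are increasing functions of independent variables, and positive
correlation still yields a Doob inequality (`IsScenery.mul_integral_reachIndicator_le`). Fed with
the Gaussian limit, it shows that a given block fluctuates by a fixed amount with probability
O(m⁻²), although the scenery has only two moments. The sum over m blocks vanishes as m grows, and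
`tendstoInDistribution_of_approx` concludes without separability.

That almost every path qualifies is a law of large numbers for self-intersections. For the mean, the
return probabilities up to time n must sum to about log n / (2π√det Σ). The walk may be periodic, so
the local limit theorem is proved at a Poisson time, where only 1 - Re φ has to be bounded below
(`tendsto_mul_integral_exp_neg`), and an elementary Tauberian comparison recovers the partial sums
(`tendsto_sum_range_div_log`). For the variance, a block is cut in two halves whose mutual
intersections have second moment O(n²) (`integral_crossMeet_sq_le`); induction gives variance O(n²)
(`exists_variance_selfMeet_le`), which is log² n below the square of the mean. This is summable
along the times exp(k^(2/3)), and monotonicity fills the gaps (`ae_tendsto_selfMeet`). -/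

noncomputable section

section
/-! ### Characteristic functions of measures on `ℤ²` -/

namespace PlanarWalk

/-- The pairing of `θ ∈ ℝ²` with a lattice point. -/
def pairing (θ : ℝ × ℝ) (l : Fin 2 → ℤ) : ℝ := θ.1 * l 0 + θ.2 * l 1

theorem pairing_add (θ : ℝ × ℝ) (l m : Fin 2 → ℤ) :
    pairing θ (l + m) = pairing θ l + pairing θ m := by
  simp [pairing]; ring

theorem pairing_neg (θ : ℝ × ℝ) (l : Fin 2 → ℤ) : pairing θ (-l) = -pairing θ l := by
  simp [pairing]; ring

theorem pairing_sub (θ : ℝ × ℝ) (l m : Fin 2 → ℤ) :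
    pairing θ (l - m) = pairing θ l - pairing θ m := by
  simp [pairing]; ring

theorem continuous_pairing (l : Fin 2 → ℤ) : Continuous fun θ => pairing θ l := by
  unfold pairing; fun_prop

theorem measurable_pairing : Measurable fun q : (ℝ × ℝ) × (Fin 2 → ℤ) => pairing q.1 q.2 := by
  unfold pairing
  have h (i : Fin 2) : Measurable fun q : (ℝ × ℝ) × (Fin 2 → ℤ) => ((q.2 i : ℤ) : ℝ) :=
    (measurable_of_countable (fun n : ℤ => (n : ℝ))).comp
      ((measurable_pi_apply i).comp measurable_snd)
  exact (measurable_fst.fst.mul (h 0)).add (measurable_fst.snd.mul (h 1))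

/-- The characteristic function of a measure on `ℤ²`. -/
def latticeCharFun (ν : Measure (Fin 2 → ℤ)) (θ : ℝ × ℝ) : ℂ :=
  ∫ l, Complex.exp (pairing θ l * Complex.I) ∂ν

/-- Lebesgue measure on `(-π, π]²`. -/
def boxMeasure : Measure (ℝ × ℝ) :=
  (volume.restrict (Set.Ioc (-Real.pi) Real.pi)).prod
    (volume.restrict (Set.Ioc (-Real.pi) Real.pi))

instance : IsFiniteMeasure boxMeasure := by unfold boxMeasure; infer_instance

theorem boxMeasure_eq_restrict : boxMeasure = volume.restrict
    (Set.Ioc (-Real.pi) Real.pi ×ˢ Set.Ioc (-Real.pi) Real.pi) := by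
  rw [boxMeasure, Measure.prod_restrict]; rfl

theorem integral_exp_int_mul (k : ℤ) :
    ∫ t in Set.Ioc (-Real.pi) Real.pi, Complex.exp ((t * k : ℝ) * Complex.I) =
      if k = 0 then (2 * Real.pi : ℂ) else 0 := by
  rw [← intervalIntegral.integral_of_le (by linarith [Real.pi_pos])]
  split_ifs with h
  · subst h
    simp
    ring
  · have hk : (k : ℂ) * Complex.I ≠ 0 := by
      simp [h, Complex.I_ne_zero]
    have := integral_exp_mul_complex (a := -Real.pi) (b := Real.pi) hk
    have h2 : (fun t : ℝ => Complex.exp ((t * k : ℝ) * Complex.I)) =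
        fun t : ℝ => Complex.exp (k * Complex.I * t) := by
      funext t; congr 1; push_cast; ring
    rw [h2, this, div_eq_zero_iff]
    left
    have h3 : (k : ℂ) * Complex.I * (Real.pi : ℝ) =
        k * Complex.I * ((-Real.pi : ℝ) : ℂ) + k * (2 * Real.pi * Complex.I) := by
      push_cast; ring
    rw [h3, Complex.exp_add, Complex.exp_int_mul_two_pi_mul_I]
    ring

theorem integral_exp_pairing (l : Fin 2 → ℤ) :
    ∫ θ, Complex.exp (pairing θ l * Complex.I) ∂boxMeasure =
      if l = 0 then ((2 * Real.pi) ^ 2 : ℂ) else 0 := by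
  have h : (fun θ : ℝ × ℝ => Complex.exp (pairing θ l * Complex.I)) = fun θ =>
      Complex.exp ((θ.1 * l 0 : ℝ) * Complex.I) * Complex.exp ((θ.2 * l 1 : ℝ) * Complex.I) := by
    funext θ
    rw [← Complex.exp_add, pairing]
    congr 1; push_cast; ring
  rw [h, boxMeasure, integral_prod_mul (fun t : ℝ => Complex.exp ((t * l 0 : ℝ) * Complex.I))
    (fun t : ℝ => Complex.exp ((t * l 1 : ℝ) * Complex.I)), integral_exp_int_mul,
    integral_exp_int_mul]
  have h0 : l = 0 ↔ l 0 = 0 ∧ l 1 = 0 := by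
    constructor
    · rintro rfl; simp
    · rintro ⟨h, h'⟩; funext i; fin_cases i <;> assumption
  by_cases h1 : l 0 = 0 <;> by_cases h2 : l 1 = 0 <;> simp [h0, h1, h2]
  ring

theorem measurable_latticeCharFun (ν : Measure (Fin 2 → ℤ)) [SFinite ν] :
    StronglyMeasurable (latticeCharFun ν) := by
  unfold latticeCharFun
  refine StronglyMeasurable.integral_prod_right
    (f := fun (θ : ℝ × ℝ) (l : Fin 2 → ℤ) => Complex.exp (pairing θ l * Complex.I)) ?_
  refine Measurable.stronglyMeasurable ?_
  simp only [Function.uncurry_def]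
  have := measurable_pairing
  fun_prop

theorem norm_latticeCharFun_le (ν : Measure (Fin 2 → ℤ)) [IsProbabilityMeasure ν] (θ : ℝ × ℝ) :
    ‖latticeCharFun ν θ‖ ≤ 1 := by
  refine (norm_integral_le_integral_norm _).trans ?_
  simp [Complex.norm_exp_ofReal_mul_I]

/-- Fourier inversion on `ℤ²`. -/
theorem integral_latticeCharFun_mul (ν : Measure (Fin 2 → ℤ)) [IsProbabilityMeasure ν]
    (x : Fin 2 → ℤ) :
    ∫ θ, latticeCharFun ν θ * Complex.exp (-(pairing θ x * Complex.I)) ∂boxMeasure =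
      (2 * Real.pi) ^ 2 * ν.real {x} := by
  have h1 : ∀ θ, latticeCharFun ν θ * Complex.exp (-(pairing θ x * Complex.I)) =
      ∫ l, Complex.exp (pairing θ (l - x) * Complex.I) ∂ν := by
    intro θ
    rw [latticeCharFun, ← integral_mul_const]
    congr 1; funext l
    rw [← Complex.exp_add, pairing_sub]
    congr 1; push_cast; ring
  simp_rw [h1]
  rw [integral_integral_swap]
  · simp_rw [integral_exp_pairing, sub_eq_zero]
    have : (fun l : Fin 2 → ℤ => if l = x then ((2 * Real.pi) ^ 2 : ℂ) else 0) =
        Set.indicator {x} fun _ => ((2 * Real.pi) ^ 2 : ℂ) := by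
      funext l; simp [Set.indicator_apply]
    rw [this, integral_indicator (measurableSet_singleton x), setIntegral_const]
    rw [Complex.real_smul]; ring
  · refine Integrable.of_bound (C := 1) ?_ (Eventually.of_forall fun q => ?_)
    · have h : Measurable fun q : (ℝ × ℝ) × (Fin 2 → ℤ) => pairing q.1 (q.2 - x) := by
        simp_rw [pairing_sub]
        exact measurable_pairing.sub ((continuous_pairing x).measurable.comp measurable_fst)
      refine Measurable.aestronglyMeasurable ?_
      simp only [Function.uncurry_def]
      fun_prop
    · simp [Function.uncurry_def, Complex.norm_exp_ofReal_mul_I]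

/-- In Fourier inversion the character at x has modulus one, so the bound is uniform in x. This
uniformity later allows the target of an increment to be random. -/
theorem measureReal_singleton_le_integral (ν : Measure (Fin 2 → ℤ)) [IsProbabilityMeasure ν]
    (x : Fin 2 → ℤ) :
    ν.real {x} ≤ ((2 * Real.pi) ^ 2)⁻¹ * ∫ θ, ‖latticeCharFun ν θ‖ ∂boxMeasure := by
  have hpi : 0 < (2 * Real.pi) ^ 2 := by positivity
  have h := norm_integral_le_integral_norm (μ := boxMeasure)
    (f := fun θ => latticeCharFun ν θ * Complex.exp (-(pairing θ x * Complex.I)))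
  rw [integral_latticeCharFun_mul] at h
  have h2 : ∀ θ, ‖latticeCharFun ν θ * Complex.exp (-(pairing θ x * Complex.I))‖ =
      ‖latticeCharFun ν θ‖ := by
    intro θ
    rw [norm_mul, ← neg_mul, ← Complex.ofReal_neg, Complex.norm_exp_ofReal_mul_I, mul_one]
  simp_rw [h2] at h
  rw [le_inv_mul_iff₀ hpi]
  refine le_of_eq_of_le ?_ h
  rw [norm_mul, norm_pow, norm_mul, Complex.norm_real, Complex.norm_real]
  simp [abs_of_pos Real.pi_pos, abs_of_nonneg (measureReal_nonneg (μ := ν) (s := {x}))]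

/-- Since 1 - cos a = |1 - e^{ia}|² / 2, this is the triangle inequality for |1 - e^{ia}| followed
by (x + y)² ≤ 2x² + 2y². It is what makes `controlledPoints` closed under addition. -/
theorem one_sub_cos_add_le (a b : ℝ) :
    1 - Real.cos (a + b) ≤ 2 * (1 - Real.cos a) + 2 * (1 - Real.cos b) := by
  rw [Real.cos_add]
  have h1 := Real.sin_sq_add_cos_sq a
  have h2 := Real.sin_sq_add_cos_sq b
  nlinarith [sq_nonneg (Real.sin a - Real.sin b), sq_nonneg (Real.cos a + Real.cos b - 2),
    sq_nonneg (Real.cos a - Real.cos b)]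

/-- The lattice points `l` for which `1 - cos (θ·l)` is controlled by `c θ` form a group. -/
def controlledPoints (c : ℝ × ℝ → ℝ) : AddSubgroup (Fin 2 → ℤ) where
  carrier := {l | ∃ C, 0 ≤ C ∧ ∀ θ, 1 - Real.cos (pairing θ l) ≤ C * c θ}
  zero_mem' := ⟨0, le_rfl, fun θ => by simp [pairing]⟩
  neg_mem' := by
    rintro l ⟨C, hC, h⟩
    exact ⟨C, hC, fun θ => by rw [pairing_neg, Real.cos_neg]; exact h θ⟩
  add_mem' := by
    rintro l m ⟨C, hC, h⟩ ⟨C', hC', h'⟩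
    refine ⟨2 * C + 2 * C', by positivity, fun θ => ?_⟩
    rw [pairing_add]
    have := one_sub_cos_add_le (pairing θ l) (pairing θ m)
    nlinarith [h θ, h' θ]

/-- The phase α serves two purposes: α = 0 gives 1 - Re φ, and α = arg φ(θ) gives 1 - |φ|. -/
theorem re_latticeCharFun_mul_exp (ν : Measure (Fin 2 → ℤ)) [IsProbabilityMeasure ν] (θ : ℝ × ℝ)
    (α : ℝ) : 1 - (latticeCharFun ν θ * Complex.exp ((-α : ℝ) * Complex.I)).re =
      ∫ l, (1 - Real.cos (pairing θ l - α)) ∂ν := by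
  have h : latticeCharFun ν θ * Complex.exp ((-α : ℝ) * Complex.I) =
      ∫ l, Complex.exp ((pairing θ l - α : ℝ) * Complex.I) ∂ν := by
    rw [latticeCharFun, ← integral_mul_const]
    congr 1; funext l
    rw [← Complex.exp_add]; congr 1; push_cast; ring
  have hint : Integrable (fun l => Complex.exp ((pairing θ l - α : ℝ) * Complex.I)) ν :=
    Integrable.of_bound (measurable_of_countable _).aestronglyMeasurable 1
      (Eventually.of_forall fun l => by rw [Complex.norm_exp_ofReal_mul_I])
  have h3 := integral_re hint
  simp only [RCLike.re_to_complex, Complex.exp_ofReal_mul_I_re] at h3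
  have hint2 : Integrable (fun l => Real.cos (pairing θ l - α)) ν := by
    simpa only [RCLike.re_to_complex, Complex.exp_ofReal_mul_I_re] using hint.re
  rw [h, integral_sub (integrable_const _) hint2, h3]
  simp

theorem le_integral_one_sub_cos (ν : Measure (Fin 2 → ℤ)) [IsProbabilityMeasure ν] (θ : ℝ × ℝ)
    (α : ℝ) (m : Fin 2 → ℤ) : ν.real {m} * (1 - Real.cos (pairing θ m - α)) ≤
      ∫ l, (1 - Real.cos (pairing θ l - α)) ∂ν := by
  have hint : Integrable (fun l => 1 - Real.cos (pairing θ l - α)) ν :=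
    Integrable.of_bound (measurable_of_countable _).aestronglyMeasurable 2
      (Eventually.of_forall fun l => by
        rw [Real.norm_eq_abs, abs_le]
        constructor <;> linarith [Real.cos_le_one (pairing θ l - α),
          Real.neg_one_le_cos (pairing θ l - α)])
  have h := setIntegral_le_integral (s := {m}) hint
    (Eventually.of_forall fun l => by simpa using Real.cos_le_one (pairing θ l - α))
  rwa [integral_singleton, smul_eq_mul] at h

/-- If the support generates `ℤ²`, then `1 - Re φ` dominates a quadratic form on `[-π, π]²`. -/
theorem exists_quadratic_le_one_sub_re (ν : Measure (Fin 2 → ℤ)) [IsProbabilityMeasure ν]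
    (h : AddSubgroup.closure {l | 0 < ν {l}} = ⊤) :
    ∃ c > 0, ∀ θ : ℝ × ℝ, |θ.1| ≤ Real.pi → |θ.2| ≤ Real.pi →
      c * (θ.1 ^ 2 + θ.2 ^ 2) ≤ 1 - (latticeCharFun ν θ).re := by
  have hre : ∀ θ, 1 - (latticeCharFun ν θ).re = ∫ l, (1 - Real.cos (pairing θ l - 0)) ∂ν := by
    intro θ
    rw [← re_latticeCharFun_mul_exp]; simp
  have hc : ∀ θ, 0 ≤ 1 - (latticeCharFun ν θ).re := fun θ => by
    rw [hre]
    exact integral_nonneg fun l => by simpa using Real.cos_le_one _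
  -- Every atom is a controlled point, and controlled points form a group; aperiodicity therefore
  -- makes the two basis vectors controlled.
  have htop : controlledPoints (fun θ => 1 - (latticeCharFun ν θ).re) = ⊤ := by
    rw [eq_top_iff, ← h, AddSubgroup.closure_le]
    intro m hm
    have hm' : 0 < ν.real {m} := ENNReal.toReal_pos (ne_of_gt hm) (measure_ne_top _ _)
    refine ⟨(ν.real {m})⁻¹, by positivity, fun θ => ?_⟩
    rw [le_inv_mul_iff₀ hm']
    refine le_of_le_of_eq ?_ (hre θ).symm
    simpa using le_integral_one_sub_cos ν θ 0 m
  have hmem : ∀ l, l ∈ controlledPoints (fun θ => 1 - (latticeCharFun ν θ).re) := fun l => by rw [htop]; trivial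
  obtain ⟨C, hC, h1⟩ := hmem ![1, 0]
  obtain ⟨C', hC', h2⟩ := hmem ![0, 1]
  simp only [pairing, Matrix.cons_val_zero, Matrix.cons_val_one, Int.cast_one, Int.cast_zero,
    mul_one, mul_zero, add_zero, zero_add] at h1 h2
  have hpi := Real.pi_pos
  refine ⟨2 / Real.pi ^ 2 / (C + C' + 1), by positivity, fun θ hθ1 hθ2 => ?_⟩
  have k1 := Real.cos_le_one_sub_mul_cos_sq hθ1
  have k2 := Real.cos_le_one_sub_mul_cos_sq hθ2
  have h1 := h1 θ
  have h2 := h2 θ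
  have h3 := hc θ
  rw [div_mul_eq_mul_div, div_le_iff₀ (by positivity)]
  nlinarith

end PlanarWalk

end

/-! ### Non-degeneracy of a step law and decay of the powers of its characteristic function -/

section
namespace PlanarWalk

/-- A step distribution on `ℤ²`: centered, square integrable, with support generating `ℤ²`. -/
structure IsStepLaw (ν : Measure (Fin 2 → ℤ)) : Prop where
  isProb : IsProbabilityMeasure ν
  closure_eq : AddSubgroup.closure {l | 0 < ν {l}} = ⊤
  memLp : ∀ i, MemLp (fun l : Fin 2 → ℤ => (l i : ℝ)) 2 ν
  mean : ∀ i, ∫ l, (l i : ℝ) ∂ν = 0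

theorem ae_measure_singleton_pos (ν : Measure (Fin 2 → ℤ)) : ∀ᵐ l ∂ν, 0 < ν {l} := by
  rw [ae_iff]
  have : {l : Fin 2 → ℤ | ¬ 0 < ν {l}} = ⋃ l ∈ {l : Fin 2 → ℤ | ¬ 0 < ν {l}}, {l} := by
    ext l; simp
  rw [this, measure_biUnion_null_iff (Set.to_countable _)]
  intro l hl
  simpa using hl

theorem memLp_pairing {ν : Measure (Fin 2 → ℤ)} (hν : IsStepLaw ν) (u : ℝ × ℝ) :
    MemLp (pairing u) 2 ν := by
  have := ((hν.memLp 0).const_mul u.1).add ((hν.memLp 1).const_mul u.2)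
  exact this

theorem integral_pairing {ν : Measure (Fin 2 → ℤ)} (hν : IsStepLaw ν) (u : ℝ × ℝ) :
    ∫ l, pairing u l ∂ν = 0 := by
  have := hν.isProb
  have h (i) : Integrable (fun l : Fin 2 → ℤ => (l i : ℝ)) ν :=
    (hν.memLp i).integrable (by norm_num)
  unfold pairing
  rw [integral_add ((h 0).const_mul _) ((h 1).const_mul _), integral_const_mul,
    integral_const_mul, hν.mean, hν.mean]
  simp

/-- No nonzero linear form is almost surely constant. -/
theorem eq_zero_of_ae_pairing_eq {ν : Measure (Fin 2 → ℤ)} (hν : IsStepLaw ν) {u : ℝ × ℝ} {k : ℝ}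
    (h : ∀ᵐ l ∂ν, pairing u l = k) : u = 0 := by
  have := hν.isProb
  have hk : k = 0 := by
    have h1 := integral_pairing hν u
    rw [integral_congr_ae h] at h1
    simpa using h1
  subst hk
  let K : AddSubgroup (Fin 2 → ℤ) :=
    { carrier := {l | pairing u l = 0}
      zero_mem' := by simp [pairing]
      add_mem' := fun {a b} ha hb => by
        simp only [Set.mem_ofPred_eq] at *
        rw [pairing_add, ha, hb, add_zero]
      neg_mem' := fun {a} ha => by
        simp only [Set.mem_ofPred_eq] at *
        rw [pairing_neg, ha, neg_zero] }
  have hK : K = ⊤ := by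
    rw [eq_top_iff, ← hν.closure_eq, AddSubgroup.closure_le]
    intro l hl
    by_contra hne
    have : ν {l} = 0 := measure_mono_null (by
      rintro _ rfl
      exact hne) (ae_iff.1 h)
    exact (ne_of_gt hl) this
  have h1 : ![1, 0] ∈ K := by rw [hK]; trivial
  have h2 : ![0, 1] ∈ K := by rw [hK]; trivial
  have h1' : pairing u ![1, 0] = 0 := h1
  have h2' : pairing u ![0, 1] = 0 := h2
  simp [pairing] at h1' h2'
  exact Prod.ext h1' h2'

/-- The second moments of a measure on `ℤ²`. -/
def secondMoment (ν : Measure (Fin 2 → ℤ)) (i j : Fin 2) : ℝ := ∫ l, (l i : ℝ) * (l j : ℝ) ∂ν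

theorem integral_pairing_sq {ν : Measure (Fin 2 → ℤ)} (hν : IsStepLaw ν) (u : ℝ × ℝ) :
    ∫ l, pairing u l ^ 2 ∂ν = secondMoment ν 0 0 * u.1 ^ 2 + 2 * secondMoment ν 0 1 * u.1 * u.2 +
      secondMoment ν 1 1 * u.2 ^ 2 := by
  have h (i j) : Integrable (fun l : Fin 2 → ℤ => (l i : ℝ) * (l j : ℝ)) ν :=
    (hν.memLp i).integrable_mul (hν.memLp j)
  have h1 : (fun l => pairing u l ^ 2) = fun l : Fin 2 → ℤ => u.1 ^ 2 * ((l 0 : ℝ) * (l 0 : ℝ)) +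
      2 * u.1 * u.2 * ((l 0 : ℝ) * (l 1 : ℝ)) + u.2 ^ 2 * ((l 1 : ℝ) * (l 1 : ℝ)) := by
    funext l; simp only [pairing]; ring
  have h2 : Integrable (fun l : Fin 2 → ℤ => u.1 ^ 2 * ((l 0 : ℝ) * (l 0 : ℝ)) +
      2 * u.1 * u.2 * ((l 0 : ℝ) * (l 1 : ℝ))) ν :=
    ((h 0 0).const_mul _).add ((h 0 1).const_mul _)
  rw [h1, integral_add h2 ((h 1 1).const_mul _),
    integral_add ((h 0 0).const_mul _) ((h 0 1).const_mul _), integral_const_mul,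
    integral_const_mul, integral_const_mul]
  simp only [secondMoment]; ring

theorem integral_pairing_sq_pos {ν : Measure (Fin 2 → ℤ)} (hν : IsStepLaw ν) {u : ℝ × ℝ}
    (hu : u ≠ 0) : 0 < ∫ l, pairing u l ^ 2 ∂ν := by
  refine lt_of_le_of_ne (integral_nonneg fun l => sq_nonneg _) fun h => hu ?_
  have h2 := (integral_eq_zero_iff_of_nonneg (fun l => sq_nonneg (pairing u l))
    (memLp_pairing hν u).integrable_sq).1 h.symm
  refine eq_zero_of_ae_pairing_eq hν (k := 0) ?_
  filter_upwards [h2] with l hl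
  simpa using hl

theorem secondMoment_zero_zero_pos {ν : Measure (Fin 2 → ℤ)} (hν : IsStepLaw ν) :
    0 < secondMoment ν 0 0 := by
  have h := integral_pairing_sq_pos hν (u := (1, 0)) (by simp)
  rw [integral_pairing_sq hν] at h
  simpa using h

/-- The form au₁² + 2bu₁u₂ + cu₂² is positive definite and takes the value a(ac - b²) at u = (-b,
a). -/
theorem secondMoment_det_pos {ν : Measure (Fin 2 → ℤ)} (hν : IsStepLaw ν) :
    0 < secondMoment ν 0 0 * secondMoment ν 1 1 - secondMoment ν 0 1 ^ 2 := by
  have ha := secondMoment_zero_zero_pos hν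
  have h := integral_pairing_sq_pos hν (u := (-secondMoment ν 0 1, secondMoment ν 0 0))
    (by simp [ha.ne'])
  rw [integral_pairing_sq hν] at h
  have : 0 < secondMoment ν 0 0 *
      (secondMoment ν 0 0 * secondMoment ν 1 1 - secondMoment ν 0 1 ^ 2) := by
    simp only at h
    nlinarith
  exact (mul_pos_iff_of_pos_left ha).1 this

/-- The support is not contained in a line. -/
theorem exists_noncollinear {ν : Measure (Fin 2 → ℤ)} (hν : IsStepLaw ν) :
    ∃ l₁ l₂ l₃ : Fin 2 → ℤ, 0 < ν {l₁} ∧ 0 < ν {l₂} ∧ 0 < ν {l₃} ∧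
      (l₂ - l₁) 0 * (l₃ - l₁) 1 - (l₂ - l₁) 1 * (l₃ - l₁) 0 ≠ 0 := by
  have := hν.isProb
  by_contra! hcon
  have hae := ae_measure_singleton_pos ν
  obtain ⟨l₁, h₁⟩ := hae.exists
  by_cases h : ∃ l₂, 0 < ν {l₂} ∧ l₂ ≠ l₁
  · obtain ⟨l₂, h₂, hne⟩ := h
    have := eq_zero_of_ae_pairing_eq hν
      (u := (-((l₂ - l₁) 1 : ℝ), ((l₂ - l₁) 0 : ℝ)))
      (k := pairing (-((l₂ - l₁) 1 : ℝ), ((l₂ - l₁) 0 : ℝ)) l₁) (by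
        filter_upwards [hae] with l₃ h₃
        have h4 := hcon l₁ l₂ l₃ h₁ h₂ h₃
        have h5 : (((l₂ - l₁) 0 * (l₃ - l₁) 1 - (l₂ - l₁) 1 * (l₃ - l₁) 0 : ℤ) : ℝ) = 0 := by
          exact_mod_cast h4
        simp only [pairing, Pi.sub_apply] at *
        push_cast at *
        linarith)
    refine hne ?_
    simp only [Prod.mk_eq_zero, neg_eq_zero, Int.cast_eq_zero, Pi.sub_apply, sub_eq_zero] at this
    funext i
    fin_cases i
    · exact this.2
    · exact this.1
  · push Not at h
    have := eq_zero_of_ae_pairing_eq hν (u := (1, 0)) (k := pairing (1, 0) l₁) (by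
      filter_upwards [hae] with l hl
      rw [h l hl])
    simp at this

/-- For a periodic walk |φ| = 1 also occurs away from the origin, so no quadratic lower bound for 1
- |φ| can hold on the whole box. Only differences of atoms are controlled by 1 - |φ|; since the
atoms are not collinear, these differences generate a subgroup that contains (D, 0) and (0, D) for
some D ≠ 0. -/
theorem exists_one_sub_cos_le_one_sub_norm {ν : Measure (Fin 2 → ℤ)} (hν : IsStepLaw ν) :
    ∃ D : ℤ, D ≠ 0 ∧ ∃ c > 0, ∀ θ : ℝ × ℝ,
      c * ((1 - Real.cos (D * θ.1)) + (1 - Real.cos (D * θ.2))) ≤ 1 - ‖latticeCharFun ν θ‖ := by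
  have := hν.isProb
  obtain ⟨l₁, l₂, l₃, h₁, h₂, h₃, hD⟩ := exists_noncollinear hν
  have hc : ∀ θ, 0 ≤ 1 - ‖latticeCharFun ν θ‖ := fun θ => by
    linarith [norm_latticeCharFun_le ν θ]
  set K := controlledPoints (fun θ => 1 - ‖latticeCharFun ν θ‖) with hK
  have hdiff : ∀ l m, 0 < ν {l} → 0 < ν {m} → l - m ∈ K := by
    intro l m hl hm
    have hl' : 0 < ν.real {l} := ENNReal.toReal_pos (ne_of_gt hl) (measure_ne_top _ _)
    have hm' : 0 < ν.real {m} := ENNReal.toReal_pos (ne_of_gt hm) (measure_ne_top _ _)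
    refine ⟨2 * (ν.real {l})⁻¹ + 2 * (ν.real {m})⁻¹, by positivity, fun θ => ?_⟩
    -- Rotating by the argument makes the characteristic function real at θ, so both atoms have
    -- their phase close to α when |φ| is close to 1, and α cancels in the difference.
    set α := Complex.arg (latticeCharFun ν θ)
    have hα : latticeCharFun ν θ * Complex.exp ((-α : ℝ) * Complex.I) =
        (‖latticeCharFun ν θ‖ : ℂ) := by
      conv_lhs => rw [← Complex.norm_mul_exp_arg_mul_I (latticeCharFun ν θ)]
      rw [mul_assoc, ← Complex.exp_add]
      simp [α]
    have h1 := re_latticeCharFun_mul_exp ν θ α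
    rw [hα, Complex.ofReal_re] at h1
    have hl2 := le_integral_one_sub_cos ν θ α l
    have hm2 := le_integral_one_sub_cos ν θ α m
    rw [← h1, ← le_inv_mul_iff₀ (by assumption)] at hl2 hm2
    have h3 := one_sub_cos_add_le (pairing θ l - α) (-(pairing θ m - α))
    rw [Real.cos_neg] at h3
    have h4 : pairing θ l - α + -(pairing θ m - α) = pairing θ (l - m) := by
      rw [pairing_sub]; ring
    rw [h4] at h3
    change _ ≤ (2 * (ν.real {l})⁻¹ + 2 * (ν.real {m})⁻¹) * (1 - ‖latticeCharFun ν θ‖)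
    linarith
  set D : ℤ := (l₂ - l₁) 0 * (l₃ - l₁) 1 - (l₂ - l₁) 1 * (l₃ - l₁) 0 with hDdef
  -- Cramer's rule for the vectors l₂ - l₁ and l₃ - l₁, whose determinant is D.
  have m1 : ![D, 0] ∈ K := by
    have : ![D, 0] = (l₃ - l₁) 1 • (l₂ - l₁) - (l₂ - l₁) 1 • (l₃ - l₁) := by
      funext i; fin_cases i <;> simp [hDdef] <;> ring
    rw [this]
    exact K.sub_mem (K.zsmul_mem (hdiff _ _ h₂ h₁) _) (K.zsmul_mem (hdiff _ _ h₃ h₁) _)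
  have m2 : ![0, D] ∈ K := by
    have : ![0, D] = (l₂ - l₁) 0 • (l₃ - l₁) - (l₃ - l₁) 0 • (l₂ - l₁) := by
      funext i; fin_cases i <;> simp [hDdef] <;> ring
    rw [this]
    exact K.sub_mem (K.zsmul_mem (hdiff _ _ h₃ h₁) _) (K.zsmul_mem (hdiff _ _ h₂ h₁) _)
  obtain ⟨C, hC, e1⟩ := m1
  obtain ⟨C', hC', e2⟩ := m2
  refine ⟨D, hD, (C + C' + 1)⁻¹, by positivity, fun θ => ?_⟩
  rw [inv_mul_le_iff₀ (by positivity)]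
  have e1 := e1 θ
  have e2 := e2 θ
  have h3 := hc θ
  simp only [pairing, Matrix.cons_val_zero, Matrix.cons_val_one, Int.cast_zero,
    mul_zero, add_zero, zero_add] at e1 e2
  rw [mul_comm (D : ℝ), mul_comm (D : ℝ)]
  nlinarith

/-- The dilation by D wraps the period D times around itself, so the integral is the one for D = 1.
There cos t ≤ 1 - 2t²/π² on [-π, π] gives comparison with a Gaussian integral. -/
theorem integral_exp_neg_one_sub_cos_le {a : ℝ} (ha : 0 < a) {D : ℤ} (hD : D ≠ 0) :
    ∫ t in Set.Ioc (-Real.pi) Real.pi, Real.exp (-(a * (1 - Real.cos (D * t)))) ≤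
      √(Real.pi ^ 3 / (2 * a)) := by
  have hpi := Real.pi_pos
  have hDr : (D : ℝ) ≠ 0 := by exact_mod_cast hD
  set f : ℝ → ℝ := fun t => Real.exp (-(a * (1 - Real.cos t))) with hf
  have hper : Function.Periodic f (2 * Real.pi) := fun t => by simp [hf]
  have hfc : Continuous f := by rw [hf]; fun_prop
  rw [← intervalIntegral.integral_of_le (by linarith)]
  have h1 : ∫ t in (-Real.pi)..Real.pi, Real.exp (-(a * (1 - Real.cos (D * t)))) =
      ∫ t in (-Real.pi)..Real.pi, f t := by
    have e1 : ∫ t in (-Real.pi)..Real.pi, Real.exp (-(a * (1 - Real.cos (D * t)))) =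
      ∫ t in (-Real.pi)..Real.pi, f (D * t) := rfl
    rw [e1, intervalIntegral.integral_comp_mul_left f hDr]
    have e2 : (D : ℝ) * Real.pi = D * (-Real.pi) + D • (2 * Real.pi) := by
      rw [zsmul_eq_mul]; ring
    rw [e2, hper.intervalIntegral_add_zsmul_eq D _ (fun _ _ => hfc.intervalIntegrable _ _),
      zsmul_eq_mul, smul_eq_mul, ← mul_assoc, inv_mul_cancel₀ hDr, one_mul,
      hper.intervalIntegral_add_eq _ (-Real.pi)]
    congr 1; ring
  rw [h1, intervalIntegral.integral_of_le (by linarith)]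
  have hb : 0 < a * (2 / Real.pi ^ 2) := by positivity
  calc ∫ t in Set.Ioc (-Real.pi) Real.pi, f t
      ≤ ∫ t in Set.Ioc (-Real.pi) Real.pi, Real.exp (-(a * (2 / Real.pi ^ 2)) * t ^ 2) := by
        refine setIntegral_mono_on (hfc.integrableOn_Ioc) ((integrable_exp_neg_mul_sq hb).integrableOn)
          measurableSet_Ioc fun t ht => ?_
        rw [hf]
        refine Real.exp_le_exp.2 ?_
        have := Real.cos_le_one_sub_mul_cos_sq (abs_le.2 ⟨ht.1.le, ht.2⟩)
        nlinarith
    _ ≤ ∫ t, Real.exp (-(a * (2 / Real.pi ^ 2)) * t ^ 2) :=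
        setIntegral_le_integral (integrable_exp_neg_mul_sq hb)
          (Eventually.of_forall fun t => (Real.exp_pos _).le)
    _ = √(Real.pi ^ 3 / (2 * a)) := by
        rw [integral_gaussian]
        congr 1
        field_simp

/-- From x ≤ exp(-(1 - x)), the power |φ|^d is at most exp(-d(1 - |φ|)). The lower bound for 1 - |φ|
splits this into a product over the two coordinates, and each factor integrates to O(d^(-1/2)). -/
theorem exists_integral_norm_pow_le {ν : Measure (Fin 2 → ℤ)} (hν : IsStepLaw ν) :
    ∃ C > 0, ∀ d : ℕ, 0 < d → ∫ θ, ‖latticeCharFun ν θ‖ ^ d ∂boxMeasure ≤ C / d := by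
  have := hν.isProb
  have hpi := Real.pi_pos
  obtain ⟨D, hD, c, hc, h⟩ := exists_one_sub_cos_le_one_sub_norm hν
  refine ⟨Real.pi ^ 3 / (2 * c), by positivity, fun d hd => ?_⟩
  have hd' : (0 : ℝ) < d := by exact_mod_cast hd
  set g : ℝ → ℝ := fun t => Real.exp (-((d * c) * (1 - Real.cos (D * t)))) with hg
  have hgc : Continuous g := by rw [hg]; fun_prop
  have hint : Integrable (fun θ : ℝ × ℝ => g θ.1 * g θ.2) boxMeasure :=
    Integrable.mul_prod hgc.integrableOn_Ioc hgc.integrableOn_Ioc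
  have hle : ∀ θ : ℝ × ℝ, ‖latticeCharFun ν θ‖ ^ d ≤ g θ.1 * g θ.2 := by
    intro θ
    have h1 : ‖latticeCharFun ν θ‖ ≤ Real.exp (-(1 - ‖latticeCharFun ν θ‖)) := by
      have := Real.add_one_le_exp (-(1 - ‖latticeCharFun ν θ‖))
      linarith
    calc ‖latticeCharFun ν θ‖ ^ d ≤ Real.exp (-(1 - ‖latticeCharFun ν θ‖)) ^ d :=
          pow_le_pow_left₀ (norm_nonneg _) h1 d
      _ = Real.exp (-(d * (1 - ‖latticeCharFun ν θ‖))) := by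
          rw [← Real.exp_nat_mul]; congr 1; ring
      _ ≤ g θ.1 * g θ.2 := by
          rw [hg, ← Real.exp_add]
          refine Real.exp_le_exp.2 ?_
          nlinarith [h θ]
  calc ∫ θ, ‖latticeCharFun ν θ‖ ^ d ∂boxMeasure ≤ ∫ θ, g θ.1 * g θ.2 ∂boxMeasure :=
        integral_mono_of_nonneg (Eventually.of_forall fun θ => by positivity) hint
          (Eventually.of_forall hle)
    _ = (∫ t in Set.Ioc (-Real.pi) Real.pi, g t) * ∫ t in Set.Ioc (-Real.pi) Real.pi, g t := by
        rw [boxMeasure, integral_prod_mul g g]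
    _ ≤ √(Real.pi ^ 3 / (2 * (d * c))) * √(Real.pi ^ 3 / (2 * (d * c))) := by
        have h1 := integral_exp_neg_one_sub_cos_le (a := d * c) (by positivity) hD
        exact mul_le_mul h1 h1 (integral_nonneg fun t => (Real.exp_pos _).le) (Real.sqrt_nonneg _)
    _ = Real.pi ^ 3 / (2 * c) / d := by
        rw [Real.mul_self_sqrt (by positivity)]
        field_simp

end PlanarWalk

end

/-! ### Expansion at the origin and the local limit theorem at a Poisson time -/

section
namespace PlanarWalk

theorem charFun_map_pairing (ν : Measure (Fin 2 → ℤ)) (u : ℝ × ℝ) (t : ℝ) :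
    charFun (ν.map (pairing u)) t = latticeCharFun ν (t • u) := by
  rw [charFun_apply_real, integral_map (measurable_of_countable _).aemeasurable
    (by fun_prop), latticeCharFun]
  congr 1; funext l
  congr 2
  simp [pairing]; ring

/-- The expansion is taken along each ray only, where it is the one-dimensional one for the law of
the pairing. Pointwise convergence is all that dominated convergence will ask for. -/
theorem latticeCharFun_taylor {ν : Measure (Fin 2 → ℤ)} (hν : IsStepLaw ν) (u : ℝ × ℝ) :
    (fun t : ℝ => latticeCharFun ν (t • u) - (1 - (∫ l, pairing u l ^ 2 ∂ν : ℝ) * t ^ 2 / 2)) =o[𝓝 0]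
      fun t : ℝ => t ^ 2 := by
  have := hν.isProb
  have hm : AEMeasurable (pairing u) ν := (measurable_of_countable _).aemeasurable
  have : IsProbabilityMeasure (ν.map (pairing u)) := Measure.isProbabilityMeasure_map hm
  have hid : MemLp id 2 (ν.map (pairing u)) := by
    rw [memLp_map_measure_iff (by fun_prop) hm]
    exact memLp_pairing hν u
  have h := taylor_isLittleO_univ (f := charFun (ν.map (pairing u))) (x₀ := 0) (n := 2)
    (contDiff_charFun (n := 2) hid)
  simp_rw [taylorWithinEval_charFun_two_zero hm hid, charFun_map_pairing] at h
  simpa [integral_pairing hν] using h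

theorem tendsto_mul_one_sub_latticeCharFun {ν : Measure (Fin 2 → ℤ)} (hν : IsStepLaw ν)
    (u : ℝ × ℝ) :
    Tendsto (fun s : ℝ => (s : ℂ) * (1 - latticeCharFun ν ((√s)⁻¹ • u))) atTop
      (𝓝 (((∫ l, pairing u l ^ 2 ∂ν) / 2 : ℝ) : ℂ)) := by
  have h0 : Tendsto (fun s : ℝ => (√s)⁻¹) atTop (𝓝 0) :=
    tendsto_inv_atTop_zero.comp Real.tendsto_sqrt_atTop
  have h1 := ((latticeCharFun_taylor hν u).comp_tendsto h0).tendsto_inv_smul_nhds_zero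
  have h2 := h1.const_sub (((∫ l, pairing u l ^ 2 ∂ν) / 2 : ℝ) : ℂ)
  rw [sub_zero] at h2
  refine h2.congr' ?_
  filter_upwards [eventually_gt_atTop 0] with s hs
  have e1 : ((√s)⁻¹ ^ 2)⁻¹ = s := by
    rw [inv_pow, inv_inv, Real.sq_sqrt hs.le]
  have e2 : (((√s)⁻¹ : ℝ) : ℂ) ^ 2 = (s : ℂ)⁻¹ := by
    rw [← Complex.ofReal_pow, inv_pow, Real.sq_sqrt hs.le]; push_cast; rfl
  have hs' : (s : ℂ) ≠ 0 := by exact_mod_cast hs.ne'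
  simp only [Function.comp, e1, e2, Complex.real_smul]
  push_cast
  field_simp
  ring

/-- Completing the square in the first variable leaves a Gaussian in the second with coefficient (ac
- b²)/(2a). -/
theorem integral_exp_neg_quadratic {a b c : ℝ} (ha : 0 < a) (hd : 0 < a * c - b ^ 2)
    (hint : Integrable fun u : ℝ × ℝ =>
      Real.exp (-((a * u.1 ^ 2 + 2 * b * u.1 * u.2 + c * u.2 ^ 2) / 2))) :
    ∫ u : ℝ × ℝ, Real.exp (-((a * u.1 ^ 2 + 2 * b * u.1 * u.2 + c * u.2 ^ 2) / 2)) =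
      2 * Real.pi / √(a * c - b ^ 2) := by
  have hpi := Real.pi_pos
  have h1 : ∀ y : ℝ, ∫ x : ℝ, Real.exp (-((a * x ^ 2 + 2 * b * x * y + c * y ^ 2) / 2)) =
      √(Real.pi / (a / 2)) * Real.exp (-((a * c - b ^ 2) / (2 * a)) * y ^ 2) := by
    intro y
    have e : ∀ x : ℝ, Real.exp (-((a * x ^ 2 + 2 * b * x * y + c * y ^ 2) / 2)) =
        Real.exp (-(a / 2) * (x + b * y / a) ^ 2) *
          Real.exp (-((a * c - b ^ 2) / (2 * a)) * y ^ 2) := by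
      intro x
      rw [← Real.exp_add]
      congr 1
      field_simp
      ring
    simp_rw [e]
    rw [integral_mul_const, integral_add_right_eq_self (fun x => Real.exp (-(a / 2) * x ^ 2)),
      integral_gaussian]
  have h2 : (volume : Measure (ℝ × ℝ)) = (volume : Measure ℝ).prod volume := rfl
  rw [h2] at hint ⊢
  rw [integral_prod_symm _ hint]
  simp_rw [h1]
  rw [integral_const_mul, integral_gaussian, ← Real.sqrt_mul (by positivity)]
  have : Real.pi / (a / 2) * (Real.pi / ((a * c - b ^ 2) / (2 * a))) =
      (2 * Real.pi) ^ 2 / (a * c - b ^ 2) := by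
    field_simp
  rw [this, Real.sqrt_div (by positivity), Real.sqrt_sq (by positivity)]

/-- The local limit theorem for the walk observed at a Poisson time. -/
theorem tendsto_mul_integral_exp_neg {ν : Measure (Fin 2 → ℤ)} (hν : IsStepLaw ν) :
    Tendsto (fun s : ℝ => (s : ℂ) * ∫ θ, Complex.exp (-(s * (1 - latticeCharFun ν θ))) ∂boxMeasure)
      atTop (𝓝 ((2 * Real.pi / √(secondMoment ν 0 0 * secondMoment ν 1 1 -
        secondMoment ν 0 1 ^ 2) : ℝ) : ℂ)) := by
  have := hν.isProb
  have hpi := Real.pi_pos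
  obtain ⟨c, hc, hquad⟩ := exists_quadratic_le_one_sub_re ν hν.closure_eq
  set B : Set (ℝ × ℝ) := Set.Ioc (-Real.pi) Real.pi ×ˢ Set.Ioc (-Real.pi) Real.pi with hB
  have hBm : MeasurableSet B := measurableSet_Ioc.prod measurableSet_Ioc
  set F : ℝ → ℝ × ℝ → ℂ := fun s =>
    B.indicator fun θ => Complex.exp (-(s * (1 - latticeCharFun ν θ))) with hF
  have hFm : ∀ s, Measurable (F s) := fun s => by
    have := (measurable_latticeCharFun ν).measurable
    refine Measurable.indicator ?_ hBm
    fun_prop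
  -- Substitution θ = u/√s; in dimension two its Jacobian 1/s absorbs the prefactor.
  have e1 : ∀ s : ℝ, 0 < s →
      (s : ℂ) * ∫ θ, Complex.exp (-(s * (1 - latticeCharFun ν θ))) ∂boxMeasure =
      ∫ u, F s ((√s)⁻¹ • u) := by
    intro s hs
    rw [Measure.integral_comp_smul, boxMeasure_eq_restrict, hF, integral_indicator hBm]
    have : |((√s)⁻¹ ^ Module.finrank ℝ (ℝ × ℝ))⁻¹| = s := by
      rw [Module.finrank_prod, Module.finrank_self, inv_pow, inv_inv, Real.sq_sqrt hs.le,
        abs_of_pos hs]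
    rw [this, Complex.real_smul]
  set g : ℝ × ℝ → ℝ := fun u => Real.exp (-c * u.1 ^ 2) * Real.exp (-c * u.2 ^ 2) with hg
  have hgint : Integrable g :=
    Integrable.mul_prod (integrable_exp_neg_mul_sq hc) (integrable_exp_neg_mul_sq hc)
  -- The modulus of the integrand is exp(-s(1 - Re φ)). This is why Poissonization removes all
  -- trouble with periods: 1 - Re φ dominates c|θ|² on the whole box.
  have hbound : ∀ s : ℝ, 0 < s → ∀ u, ‖F s ((√s)⁻¹ • u)‖ ≤ g u := by
    intro s hs u
    simp only [hF, Set.indicator_apply]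
    split_ifs with hmem
    · obtain ⟨m1, m2⟩ := hmem
      rw [Complex.norm_exp]
      simp only [hg]
      rw [← Real.exp_add]
      refine Real.exp_le_exp.2 ?_
      have h := hquad ((√s)⁻¹ • u) (abs_le.2 ⟨m1.1.le, m1.2⟩) (abs_le.2 ⟨m2.1.le, m2.2⟩)
      simp only [Prod.smul_fst, Prod.smul_snd, smul_eq_mul, mul_pow, inv_pow,
        Real.sq_sqrt hs.le] at h
      have h' := mul_le_mul_of_nonneg_left h hs.le
      have e : s * (c * (s⁻¹ * u.1 ^ 2 + s⁻¹ * u.2 ^ 2)) = c * u.1 ^ 2 + c * u.2 ^ 2 := by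
        field_simp
      rw [e] at h'
      rw [Complex.neg_re, Complex.re_ofReal_mul, Complex.sub_re, Complex.one_re]
      linarith
    · rw [norm_zero]; positivity
  set q : ℝ × ℝ → ℝ := fun u => ∫ l, pairing u l ^ 2 ∂ν with hq
  have hlim : ∀ u, Tendsto (fun s : ℝ => F s ((√s)⁻¹ • u)) atTop
      (𝓝 ((Real.exp (-(q u / 2)) : ℝ) : ℂ)) := by
    intro u
    have h0 : Tendsto (fun s : ℝ => (√s)⁻¹ • u) atTop (𝓝 0) := by
      have := (tendsto_inv_atTop_zero.comp Real.tendsto_sqrt_atTop).smul_const u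
      rwa [zero_smul] at this
    have hmem : ∀ᶠ s : ℝ in atTop, (√s)⁻¹ • u ∈ B := by
      refine h0.eventually (prod_mem_nhds ?_ ?_) <;>
        exact Ioc_mem_nhds (by simpa using hpi) (by simpa using hpi)
    have h1 := (Complex.continuous_exp.tendsto _).comp
      (tendsto_mul_one_sub_latticeCharFun hν u).neg
    push_cast
    push_cast at h1
    refine h1.congr' ?_
    filter_upwards [hmem] with s hs
    simp [hF, Set.indicator_of_mem hs]
  have hmain := tendsto_integral_filter_of_dominated_convergence (l := atTop)
    (F := fun (s : ℝ) u => F s ((√s)⁻¹ • u)) (f := fun u => ((Real.exp (-(q u / 2)) : ℝ) : ℂ)) g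
    (Eventually.of_forall fun s =>
      ((hFm s).comp (measurable_const_smul (√s)⁻¹)).aestronglyMeasurable)
    ((eventually_gt_atTop 0).mono fun s hs => Eventually.of_forall (hbound s hs)) hgint
    (Eventually.of_forall hlim)
  -- The domination passes to the limit and supplies the integrability of the limiting Gaussian.
  have hqle : ∀ u, Real.exp (-(q u / 2)) ≤ g u := by
    intro u
    have h1 := le_of_tendsto (hlim u).norm
      ((eventually_gt_atTop 0).mono fun s hs => hbound s hs u)
    rwa [Complex.norm_real, Real.norm_eq_abs, abs_of_pos (Real.exp_pos _)] at h1
  have hqe : q = fun u => secondMoment ν 0 0 * u.1 ^ 2 + 2 * secondMoment ν 0 1 * u.1 * u.2 +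
      secondMoment ν 1 1 * u.2 ^ 2 := funext (integral_pairing_sq hν)
  have hval : ∫ u, ((Real.exp (-(q u / 2)) : ℝ) : ℂ) = ((2 * Real.pi / √(secondMoment ν 0 0 *
      secondMoment ν 1 1 - secondMoment ν 0 1 ^ 2) : ℝ) : ℂ) := by
    rw [integral_complex_ofReal]
    congr 1
    have hint : Integrable fun u => Real.exp (-(q u / 2)) := by
      refine hgint.mono' ?_ (Eventually.of_forall fun u => ?_)
      · rw [hqe]
        exact Continuous.aestronglyMeasurable (by fun_prop)
      · rw [Real.norm_eq_abs, abs_of_pos (Real.exp_pos _)]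
        exact hqle u
    rw [hqe] at hint ⊢
    exact integral_exp_neg_quadratic (secondMoment_zero_zero_pos hν) (secondMoment_det_pos hν) hint
  rw [hval] at hmain
  exact hmain.congr' ((eventually_gt_atTop 0).mono fun s hs => (e1 s hs).symm)

/-- The expansion of the Poissonized return probability. -/
theorem hasSum_integral_pow_poisson {ν : Measure (Fin 2 → ℤ)} [IsProbabilityMeasure ν] (s : ℝ) :
    HasSum (fun k : ℕ => (s ^ k / k.factorial * Real.exp (-s) : ℝ) *
      ∫ θ, latticeCharFun ν θ ^ k ∂boxMeasure)
      (∫ θ, Complex.exp (-(s * (1 - latticeCharFun ν θ))) ∂boxMeasure) := by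
  have hm := measurable_latticeCharFun ν
  set F : ℕ → ℝ × ℝ → ℂ := fun k θ =>
    (s ^ k / k.factorial * Real.exp (-s) : ℝ) * latticeCharFun ν θ ^ k with hF
  have hb : ∀ k θ, ‖F k θ‖ ≤ |s| ^ k / k.factorial * Real.exp (-s) := by
    intro k θ
    simp only [hF]
    rw [norm_mul, Complex.norm_real, norm_pow, Real.norm_eq_abs, abs_mul, abs_div, abs_pow,
      abs_of_pos (Real.exp_pos _), Nat.abs_cast]
    exact mul_le_of_le_one_right (by positivity)
      (pow_le_one₀ (norm_nonneg _) (norm_latticeCharFun_le ν θ))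
  have hFm : ∀ k, AEStronglyMeasurable (F k) boxMeasure := fun k =>
    ((hm.pow k).const_mul _).aestronglyMeasurable
  have hint : ∀ k, Integrable (F k) boxMeasure := fun k =>
    Integrable.of_bound (hFm k) _ (Eventually.of_forall (hb k))
  have hsum : Summable fun k => ∫ θ, ‖F k θ‖ ∂boxMeasure := by
    refine Summable.of_nonneg_of_le (fun k => integral_nonneg fun θ => norm_nonneg _)
      (fun k => (integral_mono (hint k).norm (integrable_const _) (hb k)).trans_eq
        (by rw [integral_const, smul_eq_mul])) ?_
    exact ((Real.summable_pow_div_factorial |s|).mul_right _).mul_left _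
  have h := hasSum_integral_of_summable_integral_norm hint hsum
  convert! h using 1
  · funext k
    simp only [hF]
    rw [integral_const_mul]
  · congr 1; funext θ
    have h1 : HasSum (fun k : ℕ => (s * latticeCharFun ν θ) ^ k / k.factorial)
        (Complex.exp (s * latticeCharFun ν θ)) := by
      rw [Complex.exp_eq_exp_ℂ]
      exact NormedSpace.expSeries_div_hasSum_exp _
    have h2 := (h1.mul_left (Complex.exp (-s))).tsum_eq
    rw [← Complex.exp_add] at h2
    have e : -(s * (1 - latticeCharFun ν θ)) = -(s : ℂ) + s * latticeCharFun ν θ := by ring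
    rw [e, ← h2]
    congr 1; funext k
    simp only [hF]
    push_cast
    rw [mul_pow]
    ring

end PlanarWalk

end

section
/-! ### An Abelian-Tauberian estimate -/

namespace PlanarWalk

theorem integral_pow_mul_exp_neg_mul {a : ℝ} (ha : 0 < a) (k : ℕ) :
    ∫ s in Set.Ioi (0 : ℝ), s ^ k / k.factorial * Real.exp (-(a * s)) = (a⁻¹) ^ (k + 1) := by
  have h := Real.integral_rpow_mul_exp_neg_mul_Ioi (a := (k : ℝ) + 1) (r := a) (by positivity) ha
  rw [Real.Gamma_nat_eq_factorial] at h
  have e : ∀ s : ℝ, s ^ k / k.factorial * Real.exp (-(a * s)) =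
      (k.factorial : ℝ)⁻¹ * (s ^ ((k : ℝ) + 1 - 1) * Real.exp (-(a * s))) := by
    intro s
    rw [add_sub_cancel_right, Real.rpow_natCast]; ring
  simp_rw [e]
  have hk : (k.factorial : ℝ) ≠ 0 := by positivity
  rw [integral_const_mul, h, one_div]
  have : (a⁻¹) ^ ((k : ℝ) + 1) = a⁻¹ ^ (k + 1) := by
    rw [← Real.rpow_natCast]; push_cast; rfl
  rw [this]
  field_simp

theorem integrableOn_pow_mul_exp_neg_mul {a : ℝ} (ha : 0 < a) (k : ℕ) :
    IntegrableOn (fun s : ℝ => s ^ k / k.factorial * Real.exp (-(a * s))) (Set.Ioi 0) := by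
  refine Integrable.of_integral_ne_zero ?_
  rw [integral_pow_mul_exp_neg_mul ha]
  positivity

/-- The Laplace transform of a Poisson mixture is a generating function. -/
theorem integral_exp_neg_mul_poisson {p : ℕ → ℝ} {C : ℝ} (hp0 : ∀ k, 0 ≤ p k) (hpC : ∀ k, p k ≤ C)
    {f : ℝ → ℝ}
    (hf : ∀ s, HasSum (fun k : ℕ => p k * (s ^ k / k.factorial * Real.exp (-s))) (f s))
    {b : ℝ} (hb : 0 < b) :
    IntegrableOn (fun s => Real.exp (-(b * s)) * f s) (Set.Ioi 0) ∧
    HasSum (fun k : ℕ => p k * ((1 + b)⁻¹) ^ (k + 1))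
      (∫ s in Set.Ioi (0 : ℝ), Real.exp (-(b * s)) * f s) := by
  have h1b : 0 < 1 + b := by linarith
  set F : ℕ → ℝ → ℝ := fun k s => p k * (s ^ k / k.factorial * Real.exp (-((1 + b) * s))) with hF
  have hint : ∀ k, Integrable (F k) (volume.restrict (Set.Ioi 0)) := fun k =>
    (integrableOn_pow_mul_exp_neg_mul h1b k).const_mul _
  have hFi : ∀ k, ∫ s in Set.Ioi (0 : ℝ), F k s = p k * ((1 + b)⁻¹) ^ (k + 1) := fun k => by
    rw [hF, integral_const_mul, integral_pow_mul_exp_neg_mul h1b]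
  have hnorm : ∀ k, ∫ s in Set.Ioi (0 : ℝ), ‖F k s‖ = p k * ((1 + b)⁻¹) ^ (k + 1) := fun k => by
    rw [← hFi]
    refine setIntegral_congr_fun measurableSet_Ioi fun s hs => ?_
    have hs' : (0 : ℝ) < s := hs
    exact Real.norm_of_nonneg (mul_nonneg (hp0 k) (by positivity))
  have hr1 : (1 + b)⁻¹ < 1 := inv_lt_one_of_one_lt₀ (by linarith)
  have hsum : Summable fun k => ∫ s in Set.Ioi (0 : ℝ), ‖F k s‖ := by
    simp_rw [hnorm]
    refine Summable.of_nonneg_of_le (fun k => mul_nonneg (hp0 k) (by positivity))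
      (fun k => mul_le_mul_of_nonneg_right (hpC k) (by positivity)) ?_
    exact ((summable_nat_add_iff 1).2 (summable_geometric_of_lt_one (by positivity) hr1)).mul_left C
  have h := hasSum_integral_of_summable_integral_norm hint hsum
  have hFs : ∀ s, HasSum (fun k => F k s) (Real.exp (-(b * s)) * f s) := by
    intro s
    have := (hf s).mul_left (Real.exp (-(b * s)))
    refine this.congr_fun fun k => ?_
    simp only [hF]
    have e : -((1 + b) * s) = -(b * s) + -s := by ring
    rw [e, Real.exp_add]; ring
  have e2 : (fun s => ∑' k, F k s) = fun s => Real.exp (-(b * s)) * f s :=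
    funext fun s => (hFs s).tsum_eq
  rw [e2] at h
  simp only [hFi] at h
  refine ⟨?_, h⟩
  -- A nonzero Bochner integral certifies integrability, so only the identically zero sequence has
  -- to be treated apart.
  by_cases hz : ∀ k, p k = 0
  · have hz' : ∀ s, f s = 0 := fun s => (hf s).unique (by simp [hz])
    simp [hz']
  · push Not at hz
    obtain ⟨k, hk⟩ := hz
    have hk' : 0 < p k := lt_of_le_of_ne (hp0 k) hk.symm
    refine Integrable.of_integral_ne_zero (ne_of_gt (lt_of_lt_of_le ?_
      (le_hasSum h k fun j _ => mul_nonneg (hp0 j) (by positivity))))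
    positivity

/-- The integral is cut at 1/b. Below, 1 - bs ≤ e^{-bs} ≤ 1 gives the logarithm up to an error of at
most 1; above, 1/s < b leaves an exponential integral of at most 1. -/
theorem integral_Ioi_exp_neg_mul_div_bounds {b S : ℝ} (hb : 0 < b) (hS : 0 < S) (hbS : b * S ≤ 1) :
    IntegrableOn (fun s => Real.exp (-(b * s)) / s) (Set.Ioi S) ∧
    Real.log (1 / (b * S)) - 1 ≤ ∫ s in Set.Ioi S, Real.exp (-(b * s)) / s ∧
    ∫ s in Set.Ioi S, Real.exp (-(b * s)) / s ≤ Real.log (1 / (b * S)) + 1 := by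
  have hle : S ≤ 1 / b := by rw [le_div_iff₀ hb]; linarith
  have hTpos : 0 < 1 / b := by positivity
  have hexp : ∀ T, IntegrableOn (fun s : ℝ => Real.exp (-(b * s))) (Set.Ioi T) := fun T => by
    simpa only [neg_mul] using integrableOn_exp_mul_Ioi (a := -b) (by linarith) T
  have hcont : ContinuousOn (fun s => Real.exp (-(b * s)) / s) (Set.Ioi (0 : ℝ)) := by
    refine ContinuousOn.div (by fun_prop) (by fun_prop) fun s hs => (ne_of_gt hs)
  have hi : IntegrableOn (fun s => Real.exp (-(b * s)) / s) (Set.Ioi S) := by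
    refine ((hexp S).const_mul S⁻¹).mono' ?_ ?_
    · exact (hcont.mono (Set.Ioi_subset_Ioi hS.le)).aestronglyMeasurable measurableSet_Ioi
    · refine (ae_restrict_iff' measurableSet_Ioi).2 (Eventually.of_forall fun s hs => ?_)
      have hs' : S < s := hs
      have hs0 : 0 < s := hS.trans hs'
      rw [Real.norm_of_nonneg (by positivity), div_eq_inv_mul]
      gcongr
  have hI1 : ∫ s in Set.Ioc S (1 / b), s⁻¹ = Real.log (1 / (b * S)) := by
    rw [← intervalIntegral.integral_of_le hle, integral_inv_of_pos hS hTpos]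
    congr 1; field_simp
  have hinv : IntegrableOn (fun s : ℝ => s⁻¹) (Set.Ioc S (1 / b)) := by
    refine (ContinuousOn.integrableOn_Icc ?_).mono_set Set.Ioc_subset_Icc_self
    exact ContinuousOn.inv₀ continuousOn_id fun s hs => ne_of_gt (hS.trans_le hs.1)
  have hsplit : ∫ s in Set.Ioi S, Real.exp (-(b * s)) / s =
      (∫ s in Set.Ioc S (1 / b), Real.exp (-(b * s)) / s) +
        ∫ s in Set.Ioi (1 / b), Real.exp (-(b * s)) / s := by
    rw [← setIntegral_union Set.Ioc_disjoint_Ioi_same measurableSet_Ioi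
      (hi.mono_set Set.Ioc_subset_Ioi_self) (hi.mono_set (Set.Ioi_subset_Ioi hle)),
      Set.Ioc_union_Ioi_eq_Ioi hle]
  refine ⟨hi, ?_, ?_⟩
  · have h1 : ∫ s in Set.Ioc S (1 / b), (s⁻¹ - b) ≤
        ∫ s in Set.Ioc S (1 / b), Real.exp (-(b * s)) / s := by
      refine setIntegral_mono_on (hinv.sub (integrable_const _))
        (hi.mono_set Set.Ioc_subset_Ioi_self) measurableSet_Ioc fun s hs => ?_
      have hs0 : 0 < s := hS.trans hs.1
      rw [le_div_iff₀ hs0, sub_mul, inv_mul_cancel₀ hs0.ne']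
      have := Real.add_one_le_exp (-(b * s))
      linarith
    have h2 : ∫ s in Set.Ioc S (1 / b), (s⁻¹ - b) = Real.log (1 / (b * S)) - (1 / b - S) * b := by
      rw [integral_sub hinv (integrable_const _), hI1, setIntegral_const]
      rw [smul_eq_mul, Real.volume_real_Ioc_of_le hle]
    have h3 : 0 ≤ ∫ s in Set.Ioi (1 / b), Real.exp (-(b * s)) / s :=
      setIntegral_nonneg measurableSet_Ioi fun s hs => by
        have : 0 < s := hTpos.trans hs
        positivity
    have h4 : (1 / b - S) * b ≤ 1 := by
      rw [sub_mul, one_div, inv_mul_cancel₀ hb.ne']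
      nlinarith
    rw [hsplit]; linarith
  · have h1 : ∫ s in Set.Ioc S (1 / b), Real.exp (-(b * s)) / s ≤
        ∫ s in Set.Ioc S (1 / b), s⁻¹ := by
      refine setIntegral_mono_on (hi.mono_set Set.Ioc_subset_Ioi_self) hinv measurableSet_Ioc
        fun s hs => ?_
      have hs0 : 0 < s := hS.trans hs.1
      rw [div_eq_mul_inv]
      exact mul_le_of_le_one_left (by positivity)
        (Real.exp_le_one_iff.2 (by nlinarith [mul_pos hb hs0]))
    have h2 : ∫ s in Set.Ioi (1 / b), Real.exp (-(b * s)) / s ≤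
        ∫ s in Set.Ioi (1 / b), b * Real.exp (-(b * s)) := by
      refine setIntegral_mono_on (hi.mono_set (Set.Ioi_subset_Ioi hle)) ((hexp _).const_mul b)
        measurableSet_Ioi fun s hs => ?_
      have hs0 : 0 < s := hTpos.trans hs
      have hs1 : 1 / b < s := hs
      rw [div_le_iff₀ hs0]
      rw [div_lt_iff₀ hb] at hs1
      nlinarith [Real.exp_pos (-(b * s))]
    have h3 : ∫ s in Set.Ioi (1 / b), b * Real.exp (-(b * s)) ≤ 1 := by
      have h := integral_exp_mul_Ioi (a := -b) (by linarith) (1 / b)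
      simp only [neg_mul] at h
      rw [integral_const_mul, h]
      have e : b * (1 / b) = 1 := by field_simp
      rw [e, neg_div_neg_eq, mul_div_cancel₀ _ hb.ne']
      exact Real.exp_le_one_iff.2 (by norm_num)
    rw [hsplit]; linarith

/-- A sharp cutoff at n is compared with the geometric one of ratio r = 1/(1 + 1/n). For k < n the
defect 1 - r^(k+1) ≤ (k + 1)/n compensates p k ≤ C/(k + 1), so each term costs at most C/n; for k ≥
n, p k ≤ C/n and the powers of r sum to at most n. Each side thus costs at most C. -/
theorem abs_sum_range_sub_tsum_le {p : ℕ → ℝ} {C : ℝ} (hp0 : ∀ k, 0 ≤ p k)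
    (hpC : ∀ k : ℕ, p k ≤ C / (k + 1)) {n : ℕ} (hn : 0 < n) {G : ℝ}
    (hG : HasSum (fun k : ℕ => p k * ((1 + (n : ℝ)⁻¹)⁻¹) ^ (k + 1)) G) :
    |∑ k ∈ Finset.range n, p k - G| ≤ 2 * C := by
  have hn' : (0 : ℝ) < n := by exact_mod_cast hn
  set r : ℝ := (1 + (n : ℝ)⁻¹)⁻¹ with hr
  have hr0 : 0 < r := by positivity
  have hr1 : r < 1 := inv_lt_one_of_one_lt₀ (by linarith [inv_pos.2 hn'])
  have hC : 0 ≤ C := by simpa using (hp0 0).trans (hpC 0)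
  have hrn : 1 - r = r * (n : ℝ)⁻¹ := by
    rw [hr]; field_simp; ring
  have hr2 : 1 - r ≤ (n : ℝ)⁻¹ := by
    rw [hrn]; exact mul_le_of_le_one_left (by positivity) hr1.le
  rw [← hG.tsum_eq, ← hG.summable.sum_add_tsum_nat_add n]
  have hhead : ∀ k ∈ Finset.range n, 0 ≤ p k - p k * r ^ (k + 1) ∧
      p k - p k * r ^ (k + 1) ≤ C * (n : ℝ)⁻¹ := by
    intro k _
    have h1 : r ^ (k + 1) ≤ 1 := pow_le_one₀ hr0.le hr1.le
    have h2 : 1 - r ^ (k + 1) ≤ (k + 1) * (n : ℝ)⁻¹ := by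
      have h := one_add_mul_le_pow (a := r - 1) (by linarith) (k + 1)
      push_cast at h
      rw [add_sub_cancel] at h
      have hk : (0 : ℝ) ≤ (k : ℝ) + 1 := by positivity
      nlinarith
    have h3 := hpC k
    have hk : (0 : ℝ) < (k : ℝ) + 1 := by positivity
    rw [le_div_iff₀ hk] at h3
    constructor
    · nlinarith [hp0 k]
    · calc p k - p k * r ^ (k + 1) = p k * (1 - r ^ (k + 1)) := by ring
        _ ≤ p k * ((k + 1) * (n : ℝ)⁻¹) := mul_le_mul_of_nonneg_left h2 (hp0 k)
        _ = (p k * (k + 1)) * (n : ℝ)⁻¹ := by ring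
        _ ≤ C * (n : ℝ)⁻¹ := mul_le_mul_of_nonneg_right h3 (by positivity)
  have hs1 : 0 ≤ ∑ k ∈ Finset.range n, (p k - p k * r ^ (k + 1)) :=
    Finset.sum_nonneg fun k hk => (hhead k hk).1
  have hs2 : ∑ k ∈ Finset.range n, (p k - p k * r ^ (k + 1)) ≤ C := by
    refine (Finset.sum_le_sum fun k hk => (hhead k hk).2).trans_eq ?_
    rw [Finset.sum_const, Finset.card_range, nsmul_eq_mul]
    field_simp
  rw [Finset.sum_sub_distrib] at hs1 hs2
  have hgeo : HasSum (fun k : ℕ => C * (n : ℝ)⁻¹ * (r * r ^ k)) (C * (n : ℝ)⁻¹ * (r * (1 - r)⁻¹)) :=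
    ((hasSum_geometric_of_lt_one hr0.le hr1).mul_left r).mul_left _
  have hval : C * (n : ℝ)⁻¹ * (r * (1 - r)⁻¹) = C := by
    rw [hrn]; field_simp
  have htail : ∀ k : ℕ, p (k + n) * r ^ (k + n + 1) ≤ C * (n : ℝ)⁻¹ * (r * r ^ k) := by
    intro k
    have h1 : p (k + n) ≤ C * (n : ℝ)⁻¹ := by
      refine (hpC _).trans ?_
      rw [div_eq_mul_inv]
      refine mul_le_mul_of_nonneg_left (inv_anti₀ hn' ?_) hC
      push_cast; linarith [(Nat.cast_nonneg k : (0 : ℝ) ≤ k)]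
    have h2 : r ^ (k + n + 1) ≤ r * r ^ k := by
      rw [← pow_succ']
      exact pow_le_pow_of_le_one hr0.le hr1.le (by omega)
    exact mul_le_mul h1 h2 (by positivity) (by positivity)
  have ht0 : 0 ≤ ∑' k, p (k + n) * r ^ (k + n + 1) :=
    tsum_nonneg fun k => mul_nonneg (hp0 _) (by positivity)
  have ht1 : ∑' k, p (k + n) * r ^ (k + n + 1) ≤ C := by
    rw [← hval, ← hgeo.tsum_eq]
    exact Summable.tsum_le_tsum htail ((summable_nat_add_iff n).2 hG.summable) hgeo.summable
  rw [abs_le]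
  constructor <;> linarith

/-- The sequence is O(1/k), so replacing the partial sum by the generating function costs O(1),
which is negligible against log n. The generating function is the Laplace transform of f at 1/n, and
f(s) ~ κ/s contributes κ log n. No deeper Tauberian theorem is needed. -/
theorem tendsto_sum_range_div_log {p : ℕ → ℝ} {C κ : ℝ} (hp0 : ∀ k, 0 ≤ p k)
    (hpC : ∀ k : ℕ, p k ≤ C / (k + 1)) {f : ℝ → ℝ}
    (hf : ∀ s, HasSum (fun k : ℕ => p k * (s ^ k / k.factorial * Real.exp (-s))) (f s))
    (hlim : Tendsto (fun s => s * f s) atTop (𝓝 κ)) :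
    Tendsto (fun n : ℕ => (∑ k ∈ Finset.range n, p k) / Real.log n) atTop (𝓝 κ) := by
  have hC : 0 ≤ C := by simpa using (hp0 0).trans (hpC 0)
  have hpC' : ∀ k, p k ≤ C := fun k => (hpC k).trans
    (div_le_self hC (by linarith [(Nat.cast_nonneg k : (0 : ℝ) ≤ k)]))
  have hf0 : ∀ s, 0 ≤ s → 0 ≤ f s := fun s hs =>
    (hf s).nonneg fun k => mul_nonneg (hp0 k) (by positivity)
  have hfC : ∀ s, 0 ≤ s → f s ≤ C := by
    intro s hs
    have h1 : HasSum (fun k : ℕ => C * (s ^ k / k.factorial * Real.exp (-s))) C := by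
      have h := (NormedSpace.expSeries_div_hasSum_exp (𝔸 := ℝ) s)
      rw [← Real.exp_eq_exp_ℝ] at h
      have h2 := (h.mul_right (Real.exp (-s))).mul_left C
      rwa [← Real.exp_add, add_neg_cancel, Real.exp_zero, mul_one] at h2
    exact hasSum_le (fun k => mul_le_mul_of_nonneg_right (hpC' k) (by positivity)) (hf s) h1
  have hlog : Tendsto (fun n : ℕ => Real.log n) atTop atTop :=
    Real.tendsto_log_atTop.comp tendsto_natCast_atTop_atTop
  rw [Metric.tendsto_atTop]
  intro ε hε
  obtain ⟨S₀, hS₀⟩ := (Metric.tendsto_atTop.1 hlim) (ε / 4) (by positivity)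
  set S := max S₀ 1 with hS
  have hS1 : 1 ≤ S := le_max_right _ _
  -- All errors that do not grow with n: C S from the range s ≤ S, the term in log S + 1 from
  -- replacing the integral J by log n, and 2C from the change of cutoff.
  set K : ℝ := C * S + (|κ| + ε / 4) * (Real.log S + 1) + 2 * C with hK
  have hev : ∀ᶠ n : ℕ in atTop, K / (ε / 4) ≤ Real.log n ∧ 1 ≤ Real.log n ∧ S ≤ n :=
    (hlog.eventually_ge_atTop _).and ((hlog.eventually_ge_atTop _).and
      (tendsto_natCast_atTop_atTop.eventually_ge_atTop S))
  obtain ⟨N, hN⟩ := eventually_atTop.1 hev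
  refine ⟨N, fun n hn => ?_⟩
  obtain ⟨hn1, hn2, hn3⟩ := hN n hn
  have hn0 : (0 : ℝ) < n := by linarith
  have hlogpos : 0 < Real.log n := by linarith
  set b : ℝ := (n : ℝ)⁻¹ with hb
  have hb0 : 0 < b := by positivity
  have hbS : b * S ≤ 1 := by rw [hb, inv_mul_le_iff₀ hn0]; linarith
  obtain ⟨hI, hsum⟩ := integral_exp_neg_mul_poisson hp0 hpC' hf hb0
  have h1 := abs_sum_range_sub_tsum_le hp0 hpC (by exact_mod_cast hn0) hsum
  obtain ⟨hJi, hJ1, hJ2⟩ := integral_Ioi_exp_neg_mul_div_bounds hb0 (by linarith) hbS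
  set J := ∫ s in Set.Ioi S, Real.exp (-(b * s)) / s with hJ
  have hlogS : 0 ≤ Real.log S := Real.log_nonneg hS1
  have hlogeq : Real.log (1 / (b * S)) = Real.log n - Real.log S := by
    rw [hb, one_div, mul_inv, inv_inv, Real.log_mul hn0.ne' (by positivity), Real.log_inv]; ring
  rw [hlogeq] at hJ1 hJ2
  have hsplit : ∫ s in Set.Ioi (0 : ℝ), Real.exp (-(b * s)) * f s =
      (∫ s in Set.Ioc 0 S, Real.exp (-(b * s)) * f s) +
        ∫ s in Set.Ioi S, Real.exp (-(b * s)) * f s := by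
    rw [← setIntegral_union Set.Ioc_disjoint_Ioi_same measurableSet_Ioi
      (hI.mono_set Set.Ioc_subset_Ioi_self) (hI.mono_set (Set.Ioi_subset_Ioi (by linarith))),
      Set.Ioc_union_Ioi_eq_Ioi (by linarith)]
  have hhead0 : 0 ≤ ∫ s in Set.Ioc 0 S, Real.exp (-(b * s)) * f s :=
    setIntegral_nonneg measurableSet_Ioc fun s hs => mul_nonneg (Real.exp_pos _).le (hf0 s hs.1.le)
  have hhead1 : ∫ s in Set.Ioc 0 S, Real.exp (-(b * s)) * f s ≤ C * S := by
    calc ∫ s in Set.Ioc 0 S, Real.exp (-(b * s)) * f s ≤ ∫ s in Set.Ioc 0 S, C := by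
          refine setIntegral_mono_on (hI.mono_set Set.Ioc_subset_Ioi_self) (integrable_const _)
            measurableSet_Ioc fun s hs => ?_
          refine (mul_le_of_le_one_left (hf0 s hs.1.le) (Real.exp_le_one_iff.2 ?_)).trans
            (hfC s hs.1.le)
          nlinarith [hs.1]
      _ = C * S := by
          rw [setIntegral_const]
          rw [smul_eq_mul, Real.volume_real_Ioc_of_le (zero_le_one.trans hS1), sub_zero, mul_comm]
  have htail : |(∫ s in Set.Ioi S, Real.exp (-(b * s)) * f s) - κ * J| ≤ ε / 4 * J := by
    rw [hJ, ← integral_const_mul, ← integral_sub (hI.mono_set (Set.Ioi_subset_Ioi (by linarith)))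
      (hJi.const_mul κ), ← integral_const_mul, ← Real.norm_eq_abs]
    refine norm_integral_le_of_norm_le (hJi.const_mul _) ?_
    refine (ae_restrict_iff' measurableSet_Ioi).2 (Eventually.of_forall fun s hs => ?_)
    have hs' : S < s := hs
    have hs0 : 0 < s := by linarith
    have h2 := hS₀ s ((le_max_left _ _).trans hs'.le)
    rw [Real.dist_eq] at h2
    have e : Real.exp (-(b * s)) * f s - κ * (Real.exp (-(b * s)) / s) =
        (s * f s - κ) * (Real.exp (-(b * s)) / s) := by
      field_simp
    rw [e, norm_mul, Real.norm_eq_abs, Real.norm_of_nonneg (by positivity)]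
    exact mul_le_mul_of_nonneg_right h2.le (by positivity)
  have hJabs : |J - Real.log n| ≤ Real.log S + 1 := by
    rw [abs_le]; constructor <;> linarith
  rw [Real.dist_eq]
  have hfin : |(∑ k ∈ Finset.range n, p k) - κ * Real.log n| ≤ K + ε / 4 * Real.log n := by
    have h3 : (∑ k ∈ Finset.range n, p k) - κ * Real.log n =
        ((∑ k ∈ Finset.range n, p k) - ∫ s in Set.Ioi (0 : ℝ), Real.exp (-(b * s)) * f s) +
        (∫ s in Set.Ioc 0 S, Real.exp (-(b * s)) * f s) +
        ((∫ s in Set.Ioi S, Real.exp (-(b * s)) * f s) - κ * J) + κ * (J - Real.log n) := by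
      rw [hsplit]; ring
    rw [h3]
    refine (abs_add_le _ _).trans ?_
    refine (add_le_add_left ((abs_add_le _ _).trans (add_le_add_left (abs_add_le _ _) _)) _).trans ?_
    rw [abs_of_nonneg hhead0, abs_mul]
    have h4 : |κ| * |J - Real.log n| ≤ |κ| * (Real.log S + 1) :=
      mul_le_mul_of_nonneg_left hJabs (abs_nonneg _)
    have h5 : ε / 4 * J ≤ ε / 4 * (Real.log n + (Real.log S + 1)) :=
      mul_le_mul_of_nonneg_left (by linarith) (by positivity)
    rw [hK]
    nlinarith
  have e : (∑ k ∈ Finset.range n, p k) / Real.log n - κ =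
      ((∑ k ∈ Finset.range n, p k) - κ * Real.log n) / Real.log n := by
    field_simp
  rw [e, abs_div, abs_of_pos hlogpos, div_lt_iff₀ hlogpos]
  rw [div_le_iff₀ (by positivity)] at hn1
  nlinarith

end PlanarWalk

end

section
/-! ### Increments of the walk -/

namespace PlanarWalk

variable {Ω : Type*}

/-- `ζ` is a sequence of i.i.d. steps whose law is a step law. -/
structure IsStepSequence [MeasurableSpace Ω] (P : Measure Ω) (ζ : ℕ → Ω → (Fin 2 → ℤ)) : Prop where
  measurable : ∀ k, Measurable (ζ k)
  indep : iIndepFun ζ P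
  map_eq : ∀ k, P.map (ζ k) = P.map (ζ 0)
  law : IsStepLaw (P.map (ζ 0))

/-- The increment of the walk between the times `a` and `b`. -/
def increment (ζ : ℕ → Ω → (Fin 2 → ℤ)) (a b : ℕ) (ω : Ω) : Fin 2 → ℤ :=
  ∑ k ∈ Finset.Ico a b, ζ k ω

theorem increment_add (ζ : ℕ → Ω → (Fin 2 → ℤ)) {a b c : ℕ} (hab : a ≤ b) (hbc : b ≤ c) (ω : Ω) :
    increment ζ a b ω + increment ζ b c ω = increment ζ a c ω :=
  Finset.sum_Ico_consecutive _ hab hbc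

theorem walk_eq_walk_iff (ζ : ℕ → Ω → (Fin 2 → ℤ)) {i j : ℕ} (hij : i ≤ j) (ω : Ω) :
    walk ζ i ω = walk ζ j ω ↔ increment ζ i j ω = 0 := by
  unfold walk increment
  rw [Finset.sum_Ico_eq_sub _ hij, sub_eq_zero, eq_comm]

variable [MeasurableSpace Ω]

theorem measurable_increment {ζ : ℕ → Ω → (Fin 2 → ℤ)} (hζ : ∀ k, Measurable (ζ k)) (a b : ℕ) :
    Measurable (increment ζ a b) := by
  unfold increment
  exact Finset.measurable_fun_sum _ fun k _ => hζ k

variable {P : Measure Ω} {ζ : ℕ → Ω → (Fin 2 → ℤ)}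

theorem latticeCharFun_map_increment (h : IsStepSequence P ζ) (a b : ℕ) (θ : ℝ × ℝ) :
    latticeCharFun (P.map (increment ζ a b)) θ = latticeCharFun (P.map (ζ 0)) θ ^ (b - a) := by
  have e : ∀ k, ∫ ω, Complex.exp (pairing θ (ζ k ω) * Complex.I) ∂P =
      latticeCharFun (P.map (ζ 0)) θ := by
    intro k
    rw [← h.map_eq k, latticeCharFun, integral_map (h.measurable k).aemeasurable
      (measurable_of_countable _).aestronglyMeasurable]
  have hp : ∀ (s : Finset ℕ) (ω : Ω), Complex.exp (pairing θ (∑ k ∈ s, ζ k ω) * Complex.I) =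
      ∏ k : s, Complex.exp (pairing θ (ζ k ω) * Complex.I) := by
    intro s ω
    rw [Finset.prod_coe_sort s (fun k => Complex.exp (pairing θ (ζ k ω) * Complex.I)),
      ← Complex.exp_sum, ← Finset.sum_mul, ← Complex.ofReal_sum]
    congr 3
    induction s using Finset.induction_on with
    | empty => simp [pairing]
    | insert a s ha ih => rw [Finset.sum_insert ha, Finset.sum_insert ha, pairing_add, ih]
  rw [latticeCharFun, integral_map (measurable_increment h.measurable a b).aemeasurable
      (measurable_of_countable _).aestronglyMeasurable]
  simp only [increment, hp]
  have hind : iIndepFun (fun k : Finset.Ico a b => ζ k) P :=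
    h.indep.precomp Subtype.val_injective
  have := hind.integral_fun_prod_comp (𝕜 := ℂ) (f := fun _ l => Complex.exp (pairing θ l * Complex.I))
    (fun i => (h.measurable i).aemeasurable)
    (fun i => (measurable_of_countable _).aestronglyMeasurable)
  rw [this]
  simp_rw [e]
  simp

/-- The return probabilities of the walk. -/
def returnProb (P : Measure Ω) (ζ : ℕ → Ω → (Fin 2 → ℤ)) (d : ℕ) : ℝ :=
  P.real {ω | increment ζ 0 d ω = 0}

theorem integral_latticeCharFun_pow_mul [IsProbabilityMeasure P] (h : IsStepSequence P ζ) (a b : ℕ)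
    (x : Fin 2 → ℤ) :
    ∫ θ, latticeCharFun (P.map (ζ 0)) θ ^ (b - a) * Complex.exp (-(pairing θ x * Complex.I))
      ∂boxMeasure = (2 * Real.pi) ^ 2 * P.real {ω | increment ζ a b ω = x} := by
  have hm := measurable_increment h.measurable a b
  have : IsProbabilityMeasure (P.map (increment ζ a b)) :=
    Measure.isProbabilityMeasure_map hm.aemeasurable
  have h1 := integral_latticeCharFun_mul (P.map (increment ζ a b)) x
  simp_rw [latticeCharFun_map_increment h] at h1
  rw [h1, map_measureReal_apply hm (measurableSet_singleton x)]
  rfl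

/-- Stationarity of the increments is read off from Fourier inversion: both increments have the same
power of φ as transform. -/
theorem measureReal_increment_eq_zero [IsProbabilityMeasure P] (h : IsStepSequence P ζ) (a b : ℕ) :
    P.real {ω | increment ζ a b ω = 0} = returnProb P ζ (b - a) := by
  have h1 := integral_latticeCharFun_pow_mul h a b 0
  have h2 := integral_latticeCharFun_pow_mul h 0 (b - a) 0
  rw [Nat.sub_zero, h1] at h2
  have hpi : ((2 * Real.pi) ^ 2 : ℂ) ≠ 0 := by
    simp [Real.pi_ne_zero]
  exact Complex.ofReal_injective (mul_left_cancel₀ hpi h2)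

/-- The uniform bound `P(Z_b - Z_a = x) ≤ C / (b - a + 1)`. -/
theorem exists_measureReal_increment_le [IsProbabilityMeasure P] (h : IsStepSequence P ζ) :
    ∃ C : ℝ, 0 < C ∧ ∀ (a b : ℕ) (x : Fin 2 → ℤ),
      P.real {ω | increment ζ a b ω = x} ≤ C / ((b - a : ℕ) + 1) := by
  have hpi := Real.pi_pos
  obtain ⟨C, hC, hle⟩ := exists_integral_norm_pow_le h.law
  -- The 1 covers an empty interval, and 2C turns C/d into a bound with denominator d + 1 for d ≥ 1.
  refine ⟨max 1 (2 * C), by positivity, fun a b x => ?_⟩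
  set d := b - a with hd
  rcases Nat.eq_zero_or_pos d with h0 | hpos
  · rw [h0, Nat.cast_zero, zero_add, div_one]
    exact measureReal_le_one.trans (le_max_left _ _)
  have hm := measurable_increment h.measurable a b
  have : IsProbabilityMeasure (P.map (increment ζ a b)) :=
    Measure.isProbabilityMeasure_map hm.aemeasurable
  have h1 := measureReal_singleton_le_integral (P.map (increment ζ a b)) x
  simp_rw [latticeCharFun_map_increment h, norm_pow] at h1
  rw [map_measureReal_apply hm (measurableSet_singleton x)] at h1
  have hd' : (1 : ℝ) ≤ d := by exact_mod_cast hpos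
  have h4 : ((2 * Real.pi) ^ 2)⁻¹ ≤ 1 := inv_le_one_of_one_le₀ (by nlinarith [Real.pi_gt_three])
  calc P.real {ω | increment ζ a b ω = x} ≤ _ := h1
    _ ≤ 1 * (C / d) := mul_le_mul h4 (hle d hpos) (integral_nonneg fun θ => by positivity) zero_le_one
    _ ≤ max 1 (2 * C) / (d + 1) := by
      rw [one_mul, div_le_div_iff₀ (by linarith) (by linarith)]
      nlinarith [le_max_right 1 (2 * C)]

/-- `1 / (2π √(det Σ))`. -/
def greenConst (ν : Measure (Fin 2 → ℤ)) : ℝ :=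
  (2 * Real.pi * √(secondMoment ν 0 0 * secondMoment ν 1 1 - secondMoment ν 0 1 ^ 2))⁻¹

/-- The truncated Green function at `0` grows like `log n / (2π √(det Σ))`. -/
theorem tendsto_sum_returnProb_div_log [IsProbabilityMeasure P] (h : IsStepSequence P ζ) :
    Tendsto (fun n : ℕ => (∑ k ∈ Finset.range n, returnProb P ζ k) / Real.log n) atTop
      (𝓝 (greenConst (P.map (ζ 0)))) := by
  have hpi := Real.pi_pos
  have hprob := h.law.isProb
  obtain ⟨C, hC, hle⟩ := exists_measureReal_increment_le h
  have hpow : ∀ k : ℕ, ∫ θ, latticeCharFun (P.map (ζ 0)) θ ^ k ∂boxMeasure =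
      (((2 * Real.pi) ^ 2 * returnProb P ζ k : ℝ) : ℂ) := by
    intro k
    have h1 := integral_latticeCharFun_pow_mul h 0 k 0
    simp only [Nat.sub_zero] at h1
    rw [returnProb]
    push_cast
    rw [← h1]
    simp [pairing]
  set f : ℝ → ℝ := fun s => ((2 * Real.pi) ^ 2)⁻¹ *
    (∫ θ, Complex.exp (-(s * (1 - latticeCharFun (P.map (ζ 0)) θ))) ∂boxMeasure).re with hf
  refine tendsto_sum_range_div_log (p := returnProb P ζ) (C := C) (f := f)
    (fun k => measureReal_nonneg) (fun k => by simpa [returnProb] using hle 0 k 0) (fun s => ?_) ?_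
  · have h1 := Complex.hasSum_re (hasSum_integral_pow_poisson (ν := P.map (ζ 0)) s)
    simp_rw [hpow] at h1
    have h2 := h1.mul_left ((2 * Real.pi) ^ 2)⁻¹
    refine h2.congr_fun fun k => ?_
    rw [← Complex.ofReal_mul, Complex.ofReal_re]
    field_simp
  · have h1 := (Complex.continuous_re.tendsto _).comp (tendsto_mul_integral_exp_neg h.law)
    have h2 := h1.const_mul ((2 * Real.pi) ^ 2)⁻¹
    rw [Complex.ofReal_re] at h2
    have e : ((2 * Real.pi) ^ 2)⁻¹ * (2 * Real.pi / √(secondMoment (P.map (ζ 0)) 0 0 *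
        secondMoment (P.map (ζ 0)) 1 1 - secondMoment (P.map (ζ 0)) 0 1 ^ 2)) =
        greenConst (P.map (ζ 0)) := by
      rw [greenConst]
      have := Real.sqrt_pos.2 (secondMoment_det_pos h.law)
      field_simp
    rw [e] at h2
    refine h2.congr fun s => ?_
    simp only [Function.comp, hf, Complex.re_ofReal_mul]
    ring

end PlanarWalk

end

section
/-! ### Self-intersections of the walk -/

namespace PlanarWalk

variable {Ω : Type*}

/-- The indicator that the walk is at the same point at the times `i` and `j`. -/
def meet (ζ : ℕ → Ω → (Fin 2 → ℤ)) (i j : ℕ) (ω : Ω) : ℝ :=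
  if walk ζ i ω = walk ζ j ω then 1 else 0

/-- The number of pairs of times in `[p, q)` at which the walk is at the same point. -/
def selfMeet (ζ : ℕ → Ω → (Fin 2 → ℤ)) (p q : ℕ) (ω : Ω) : ℝ :=
  ∑ i ∈ Finset.Ico p q, ∑ j ∈ Finset.Ico p q, meet ζ i j ω

/-- The number of pairs of times in `[p, h) × [h, q)` at which the walk is at the same point. -/
def crossMeet (ζ : ℕ → Ω → (Fin 2 → ℤ)) (p h q : ℕ) (ω : Ω) : ℝ :=
  ∑ i ∈ Finset.Ico p h, ∑ j ∈ Finset.Ico h q, meet ζ i j ω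

theorem meet_comm (ζ : ℕ → Ω → (Fin 2 → ℤ)) (i j : ℕ) (ω : Ω) : meet ζ i j ω = meet ζ j i ω := by
  simp only [meet, eq_comm]

theorem meet_nonneg (ζ : ℕ → Ω → (Fin 2 → ℤ)) (i j : ℕ) (ω : Ω) : 0 ≤ meet ζ i j ω := by
  unfold meet; split_ifs <;> norm_num

theorem meet_le_one (ζ : ℕ → Ω → (Fin 2 → ℤ)) (i j : ℕ) (ω : Ω) : meet ζ i j ω ≤ 1 := by
  unfold meet; split_ifs <;> norm_num

theorem selfMeet_eq_add (ζ : ℕ → Ω → (Fin 2 → ℤ)) {p h q : ℕ} (hp : p ≤ h) (hq : h ≤ q) (ω : Ω) :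
    selfMeet ζ p q ω = selfMeet ζ p h ω + selfMeet ζ h q ω + 2 * crossMeet ζ p h q ω := by
  have hc : crossMeet ζ p h q ω = ∑ i ∈ Finset.Ico h q, ∑ j ∈ Finset.Ico p h, meet ζ i j ω := by
    rw [crossMeet, Finset.sum_comm]
    simp_rw [meet_comm ζ]
  rw [two_mul]
  conv_rhs => rw [hc]
  conv_rhs => enter [2, 1]; rw [← hc]
  simp only [selfMeet, crossMeet]
  rw [← Finset.sum_Ico_consecutive _ hp hq]
  simp_rw [← Finset.sum_Ico_consecutive _ hp hq, Finset.sum_add_distrib]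
  ring

theorem selfMeet_mono (ζ : ℕ → Ω → (Fin 2 → ℤ)) {p q p' q' : ℕ} (hp : p' ≤ p) (hq : q ≤ q')
    (ω : Ω) : selfMeet ζ p q ω ≤ selfMeet ζ p' q' ω := by
  have hs := Finset.Ico_subset_Ico hp hq
  unfold selfMeet
  refine (Finset.sum_le_sum fun i _ => Finset.sum_le_sum_of_subset_of_nonneg hs
    fun j _ _ => meet_nonneg ζ i j ω).trans ?_
  exact Finset.sum_le_sum_of_subset_of_nonneg hs
    fun i _ _ => Finset.sum_nonneg fun j _ => meet_nonneg ζ i j ω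

theorem sum_coe_Ico_eq_increment {ζ : ℕ → Ω → (Fin 2 → ℤ)} {a b : ℕ} {T : Finset ℕ} (hT : Finset.Ico a b ⊆ T) (ω : Ω) :
    ∑ k : T, (if (k : ℕ) ∈ Finset.Ico a b then ζ k ω else 0) = increment ζ a b ω := by
  rw [Finset.sum_coe_sort T (fun k => if k ∈ Finset.Ico a b then ζ k ω else 0),
    Finset.sum_ite_mem, Finset.inter_eq_right.2 hT, increment]

variable [MeasurableSpace Ω] {P : Measure Ω} {ζ : ℕ → Ω → (Fin 2 → ℤ)}

theorem measurable_walk (hζ : ∀ k, Measurable (ζ k)) (n : ℕ) : Measurable (walk ζ n) := by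
  unfold walk
  exact Finset.measurable_fun_sum _ fun k _ => hζ k

theorem measurableSet_walk_eq (hζ : ∀ k, Measurable (ζ k)) (i j : ℕ) :
    MeasurableSet {ω | walk ζ i ω = walk ζ j ω} :=
  measurableSet_eq_fun (measurable_walk hζ i) (measurable_walk hζ j)

theorem measurable_meet (hζ : ∀ k, Measurable (ζ k)) (i j : ℕ) : Measurable (meet ζ i j) :=
  Measurable.ite (measurableSet_walk_eq hζ i j) measurable_const measurable_const

theorem memLp_meet [IsProbabilityMeasure P] (hζ : ∀ k, Measurable (ζ k)) (i j : ℕ) (r : ℝ≥0∞) :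
    MemLp (meet ζ i j) r P :=
  MemLp.of_bound (measurable_meet hζ i j).aestronglyMeasurable 1
    (Eventually.of_forall fun ω => by
      rw [Real.norm_of_nonneg (meet_nonneg ζ i j ω)]; exact meet_le_one ζ i j ω)

theorem memLp_selfMeet [IsProbabilityMeasure P] (hζ : ∀ k, Measurable (ζ k)) (p q : ℕ)
    (r : ℝ≥0∞) : MemLp (selfMeet ζ p q) r P := by
  unfold selfMeet
  exact memLp_finsetSum _ fun i _ => memLp_finsetSum _ fun j _ => memLp_meet hζ i j r

theorem memLp_crossMeet [IsProbabilityMeasure P] (hζ : ∀ k, Measurable (ζ k)) (p h q : ℕ)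
    (r : ℝ≥0∞) : MemLp (crossMeet ζ p h q) r P := by
  unfold crossMeet
  exact memLp_finsetSum _ fun i _ => memLp_finsetSum _ fun j _ => memLp_meet hζ i j r

/-- Functions of the steps in disjoint time intervals are independent. -/
theorem indepFun_of_disjoint_times (h : IsStepSequence P ζ) {S T : Finset ℕ} (hST : Disjoint S T)
    {α β : Type*} [MeasurableSpace α] [MeasurableSpace β] {F : (S → Fin 2 → ℤ) → α}
    {G : (T → Fin 2 → ℤ) → β} (hF : Measurable F) (hG : Measurable G) :
    IndepFun (fun ω => F fun i : S => ζ i ω) (fun ω => G fun i : T => ζ i ω) P :=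
  (h.indep.indepFun_finset S T hST h.measurable).comp hF hG

/-- Given Z, the target F(Z) is a fixed point, which Y hits with probability at most g whatever that
point is. -/
theorem measureReal_eq_and_mem_le [IsProbabilityMeasure P] {β : Type*} [MeasurableSpace β]
    {Y : Ω → (Fin 2 → ℤ)} {Z : Ω → β} (hY : Measurable Y) (hZ : Measurable Z) (hYZ : IndepFun Y Z P)
    {g : ℝ} (hg : ∀ x, P.real {ω | Y ω = x} ≤ g) {F : β → Fin 2 → ℤ} (hF : Measurable F)
    {S : Set β} (hS : MeasurableSet S) :
    P.real {ω | Y ω = F (Z ω) ∧ Z ω ∈ S} ≤ g * P.real {ω | Z ω ∈ S} := by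
  have hg0 : 0 ≤ g := measureReal_nonneg.trans (hg 0)
  have hmap := hYZ.map_prod_eq_prod_map_map hY.aemeasurable hZ.aemeasurable
  set A : Set ((Fin 2 → ℤ) × β) := {q | q.1 = F q.2 ∧ q.2 ∈ S} with hA
  have hAm : MeasurableSet A :=
    (measurableSet_eq_fun measurable_fst (hF.comp measurable_snd)).inter (measurable_snd hS)
  have : IsProbabilityMeasure (P.map Y) := Measure.isProbabilityMeasure_map hY.aemeasurable
  have : IsProbabilityMeasure (P.map Z) := Measure.isProbabilityMeasure_map hZ.aemeasurable
  have key : P {ω | Y ω = F (Z ω) ∧ Z ω ∈ S} ≤ ENNReal.ofReal g * P {ω | Z ω ∈ S} := by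
    have e1 : P {ω | Y ω = F (Z ω) ∧ Z ω ∈ S} = (P.map fun ω => (Y ω, Z ω)) A := by
      rw [Measure.map_apply (hY.prodMk hZ) hAm]; rfl
    rw [e1, hmap, Measure.prod_apply_symm hAm]
    have e2 : P {ω | Z ω ∈ S} = (P.map Z) S := by rw [Measure.map_apply hZ hS]; rfl
    rw [e2, ← lintegral_indicator_one hS, ← lintegral_const_mul _ (measurable_one.indicator hS)]
    refine lintegral_mono fun z => ?_
    by_cases hz : z ∈ S
    · rw [Set.indicator_of_mem hz, Pi.one_apply, mul_one]
      have e3 : (fun x => (x, z)) ⁻¹' A = {F z} := by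
        ext x; simp [hA, hz]
      rw [e3, Measure.map_apply hY (measurableSet_singleton _)]
      rw [← ENNReal.ofReal_toReal (measure_ne_top P (Y ⁻¹' {F z}))]
      exact ENNReal.ofReal_le_ofReal (hg (F z))
    · have e3 : (fun x => (x, z)) ⁻¹' A = ∅ := by
        ext x; simp [hA, hz]
      rw [e3]; simp
  have h2 := ENNReal.toReal_mono
    (ENNReal.mul_ne_top ENNReal.ofReal_ne_top (measure_ne_top P _)) key
  rwa [ENNReal.toReal_mul, ENNReal.toReal_ofReal hg0] at h2

/-- An increment is independent of increments over disjoint intervals. -/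
theorem indepFun_increment (h : IsStepSequence P ζ) {a b c d e f : ℕ} {T : Finset ℕ}
    (hdisj : Disjoint (Finset.Ico a b) T) (hcd : Finset.Ico c d ⊆ T) (hef : Finset.Ico e f ⊆ T) :
    IndepFun (increment ζ a b) (fun ω => (increment ζ c d ω, increment ζ e f ω)) P := by
  have h1 := indepFun_of_disjoint_times h hdisj
    (F := fun x : (Finset.Ico a b) → Fin 2 → ℤ => ∑ k, x k)
    (G := fun x : T → Fin 2 → ℤ => (∑ k : T, (if (k : ℕ) ∈ Finset.Ico c d then x k else 0),
      ∑ k : T, (if (k : ℕ) ∈ Finset.Ico e f then x k else 0)))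
    (measurable_of_countable _) (measurable_of_countable _)
  simp only [sum_coe_Ico_eq_increment hcd, sum_coe_Ico_eq_increment hef] at h1
  have h2 : (fun ω => ∑ k : Finset.Ico a b, ζ k ω) = increment ζ a b := by
    funext ω
    rw [Finset.sum_coe_sort (Finset.Ico a b) (fun k => ζ k ω), increment]
  rwa [h2] at h1

/-- The second meeting depends only on steps after i₂. Given those steps, the first meeting
prescribes the value of the independent increment over [i₁, i₂). -/
theorem measureReal_double_meet_le_left [IsProbabilityMeasure P] (h : IsStepSequence P ζ) {C : ℝ}
    (hC : ∀ (a b : ℕ) (x : Fin 2 → ℤ),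
      P.real {ω | increment ζ a b ω = x} ≤ C / ((b - a : ℕ) + 1))
    {i₁ i₂ j₁ j₂ : ℕ} (hi : i₁ ≤ i₂) (h1 : i₂ ≤ j₁) (h2 : i₂ ≤ j₂) :
    P.real {ω | walk ζ i₁ ω = walk ζ j₁ ω ∧ walk ζ i₂ ω = walk ζ j₂ ω} ≤
      C / ((i₂ - i₁ : ℕ) + 1) * (C / ((j₂ - i₂ : ℕ) + 1)) := by
  have hdisj : Disjoint (Finset.Ico i₁ i₂) (Finset.Ico i₂ (max j₁ j₂)) :=
    Finset.Ico_disjoint_Ico_consecutive _ _ _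
  have hind := indepFun_increment h hdisj
    (Finset.Ico_subset_Ico le_rfl (le_max_left j₁ j₂))
    (Finset.Ico_subset_Ico le_rfl (le_max_right j₁ j₂))
  have hm := measurable_increment h.measurable
  have hset : {ω | walk ζ i₁ ω = walk ζ j₁ ω ∧ walk ζ i₂ ω = walk ζ j₂ ω} =
      {ω | increment ζ i₁ i₂ ω = -increment ζ i₂ j₁ ω ∧ increment ζ i₂ j₂ ω = 0} := by
    ext ω
    simp only [Set.mem_ofPred_eq]
    rw [walk_eq_walk_iff ζ (hi.trans h1), walk_eq_walk_iff ζ h2, ← increment_add ζ hi h1,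
      add_eq_zero_iff_eq_neg]
  rw [hset]
  have h3 := measureReal_eq_and_mem_le (hm i₁ i₂) ((hm i₂ j₁).prodMk (hm i₂ j₂)) hind
    (g := C / ((i₂ - i₁ : ℕ) + 1)) (hC i₁ i₂) (F := fun q => -q.1) (measurable_of_countable _)
    (S := {q | q.2 = 0}) (measurableSet_eq_fun measurable_snd measurable_const)
  refine h3.trans (mul_le_mul_of_nonneg_left (hC i₂ j₂ 0) ?_)
  exact measureReal_nonneg.trans (hC i₁ i₂ 0)

/-- The mirror image: given the steps before j₁, the second meeting prescribes the increment over
[j₁, j₂). -/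
theorem measureReal_double_meet_le_right [IsProbabilityMeasure P] (h : IsStepSequence P ζ) {C : ℝ}
    (hC : ∀ (a b : ℕ) (x : Fin 2 → ℤ),
      P.real {ω | increment ζ a b ω = x} ≤ C / ((b - a : ℕ) + 1))
    {i₁ i₂ j₁ j₂ : ℕ} (hj : j₁ ≤ j₂) (h1 : i₁ ≤ j₁) (h2 : i₂ ≤ j₁) :
    P.real {ω | walk ζ i₁ ω = walk ζ j₁ ω ∧ walk ζ i₂ ω = walk ζ j₂ ω} ≤
      C / ((j₂ - j₁ : ℕ) + 1) * (C / ((j₁ - i₁ : ℕ) + 1)) := by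
  have hdisj : Disjoint (Finset.Ico j₁ j₂) (Finset.Ico (min i₁ i₂) j₁) :=
    (Finset.Ico_disjoint_Ico_consecutive _ _ _).symm
  have hind := indepFun_increment h hdisj
    (Finset.Ico_subset_Ico (min_le_right i₁ i₂) le_rfl)
    (Finset.Ico_subset_Ico (min_le_left i₁ i₂) le_rfl)
  have hm := measurable_increment h.measurable
  have hset : {ω | walk ζ i₁ ω = walk ζ j₁ ω ∧ walk ζ i₂ ω = walk ζ j₂ ω} =
      {ω | increment ζ j₁ j₂ ω = -increment ζ i₂ j₁ ω ∧ increment ζ i₁ j₁ ω = 0} := by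
    ext ω
    simp only [Set.mem_ofPred_eq]
    rw [walk_eq_walk_iff ζ h1, walk_eq_walk_iff ζ (h2.trans hj), ← increment_add ζ h2 hj,
      add_comm (increment ζ i₂ j₁ ω), add_eq_zero_iff_eq_neg, and_comm]
  rw [hset]
  have h3 := measureReal_eq_and_mem_le (hm j₁ j₂) ((hm i₂ j₁).prodMk (hm i₁ j₁)) hind
    (g := C / ((j₂ - j₁ : ℕ) + 1)) (hC j₁ j₂) (F := fun q => -q.1) (measurable_of_countable _)
    (S := {q | q.2 = 0}) (measurableSet_eq_fun measurable_snd measurable_const)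
  refine h3.trans (mul_le_mul_of_nonneg_left (hC i₁ j₁ 0) ?_)
  exact measureReal_nonneg.trans (hC j₁ j₂ 0)

end PlanarWalk

end

/-! ### Second moment of the mutual intersections of two adjacent blocks -/

section
namespace PlanarWalk

/-- The weight `1 / √(d + 1)`. -/
def sqrtWeight (d : ℕ) : ℝ := (√((d : ℝ) + 1))⁻¹

theorem sqrtWeight_pos (d : ℕ) : 0 < sqrtWeight d := by unfold sqrtWeight; positivity

theorem sqrtWeight_sq (d : ℕ) : sqrtWeight d ^ 2 = 1 / ((d : ℝ) + 1) := by
  rw [sqrtWeight, inv_pow, Real.sq_sqrt (by positivity), one_div]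

/-- The geometric mean of x + 1 and y + 1 is below their sum. This splits the decay in the gap
across a cut into a factor for each side of the cut. -/
theorem sqrtWeight_sq_le_mul {b x y : ℕ} (h : x + y ≤ b) :
    sqrtWeight (b + 1) ^ 2 ≤ sqrtWeight x * sqrtWeight y := by
  have hb : (x : ℝ) + y ≤ b := by exact_mod_cast h
  rw [sqrtWeight_sq, sqrtWeight, sqrtWeight, ← mul_inv, ← Real.sqrt_mul (by positivity), one_div]
  refine inv_anti₀ (by positivity) ?_
  rw [Real.sqrt_le_left (by positivity)]
  push_cast
  have hx : (0 : ℝ) ≤ x := by positivity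
  have hy : (0 : ℝ) ≤ y := by positivity
  nlinarith

theorem sum_range_sqrtWeight_le (n : ℕ) : ∑ d ∈ Finset.range n, sqrtWeight d ≤ 2 * √n := by
  induction n with
  | zero => simp
  | succ n ih =>
    rw [Finset.sum_range_succ]
    have h1 : sqrtWeight n ≤ 2 * √((n : ℝ) + 1) - 2 * √n := by
      have hs : 0 < √((n : ℝ) + 1) := by positivity
      rw [sqrtWeight, inv_le_iff_one_le_mul₀ hs]
      have e1 := Real.sq_sqrt (by positivity : (0 : ℝ) ≤ (n : ℝ) + 1)
      have e2 := Real.sq_sqrt (by positivity : (0 : ℝ) ≤ (n : ℝ))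
      nlinarith [sq_nonneg (√((n : ℝ) + 1) - √n)]
    push_cast
    linarith

theorem sum_sqrtWeight_comp_le {s : Finset ℕ} {φ : ℕ → ℕ} (hφ : Set.InjOn φ s) {n : ℕ}
    (hn : ∀ i ∈ s, φ i < n) : ∑ i ∈ s, sqrtWeight (φ i) ≤ 2 * √n := by
  rw [← Finset.sum_image (f := sqrtWeight) hφ]
  refine le_trans (Finset.sum_le_sum_of_subset_of_nonneg ?_ fun d _ _ => (sqrtWeight_pos d).le)
    (sum_range_sqrtWeight_le n)
  intro d hd
  obtain ⟨i, hi, rfl⟩ := Finset.mem_image.1 hd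
  exact Finset.mem_range.2 (hn i hi)

/-- The two summands B i j and B j i account for the two orders of the indices. One factor D comes
from the inner sum, the other from the outer one. -/
theorem double_sum_le {s : Finset ℕ} {A : ℕ → ℝ} {B c : ℕ → ℕ → ℝ} {D : ℝ} (hD : 0 ≤ D)
    (hc : ∀ i ∈ s, ∀ j ∈ s, c i j ≤ B i j + B j i) (hB : ∀ j ∈ s, ∑ i ∈ s, B i j ≤ A j * D)
    (hA : ∑ j ∈ s, A j ≤ D) : ∑ i ∈ s, ∑ j ∈ s, c i j ≤ 2 * D ^ 2 := by
  have h1 : ∑ j ∈ s, ∑ i ∈ s, B i j ≤ D ^ 2 :=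
    (Finset.sum_le_sum hB).trans (by
      rw [← Finset.sum_mul, pow_two]; exact mul_le_mul_of_nonneg_right hA hD)
  calc ∑ i ∈ s, ∑ j ∈ s, c i j ≤ ∑ i ∈ s, ∑ j ∈ s, (B i j + B j i) :=
        Finset.sum_le_sum fun i hi => Finset.sum_le_sum fun j hj => hc i hi j hj
    _ = ∑ j ∈ s, ∑ i ∈ s, B i j + ∑ i ∈ s, ∑ j ∈ s, B j i := by
        simp_rw [Finset.sum_add_distrib]
        rw [Finset.sum_comm]
    _ ≤ 2 * D ^ 2 := by linarith

theorem sum_left_weights_le (p h : ℕ) :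
    ∑ i ∈ Finset.Ico p h, ∑ j ∈ Finset.Ico p h,
      sqrtWeight (h - 1 - max i j) * sqrtWeight (max i j - min i j) ≤ 8 * (h - p : ℕ) := by
  have hd := double_sum_le (s := Finset.Ico p h) (A := fun j => sqrtWeight (h - 1 - j))
    (B := fun i j => if i ≤ j then sqrtWeight (h - 1 - j) * sqrtWeight (j - i) else 0)
    (c := fun i j => sqrtWeight (h - 1 - max i j) * sqrtWeight (max i j - min i j))
    (D := 2 * √((h - p : ℕ) : ℝ)) (by positivity) ?_ ?_ ?_
  · refine hd.trans_eq ?_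
    rw [mul_pow, Real.sq_sqrt (by positivity)]; ring
  · intro i _ j _
    have h1 := mul_pos (sqrtWeight_pos (h - 1 - i)) (sqrtWeight_pos (i - j))
    have h2 := mul_pos (sqrtWeight_pos (h - 1 - j)) (sqrtWeight_pos (j - i))
    rcases le_total i j with hij | hij
    · rw [max_eq_right hij, min_eq_left hij, if_pos hij]
      split_ifs <;> linarith
    · rw [max_eq_left hij, min_eq_right hij, if_pos hij]
      split_ifs <;> linarith
  · intro j hj
    rw [← Finset.sum_filter, ← Finset.mul_sum]
    refine mul_le_mul_of_nonneg_left (sum_sqrtWeight_comp_le ?_ ?_) (sqrtWeight_pos _).le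
    · intro a ha b hb hab
      simp at ha hb hab
      omega
    · intro i hi
      simp at hi hj
      omega
  · refine sum_sqrtWeight_comp_le ?_ ?_
    · intro a ha b hb hab
      simp at ha hb hab
      omega
    · intro i hi
      simp at hi
      omega

theorem sum_right_weights_le (h q : ℕ) :
    ∑ i ∈ Finset.Ico h q, ∑ j ∈ Finset.Ico h q,
      sqrtWeight (min i j - h) * sqrtWeight (max i j - min i j) ≤ 8 * (q - h : ℕ) := by
  have hd := double_sum_le (s := Finset.Ico h q) (A := fun j => sqrtWeight (j - h))
    (B := fun i j => if j ≤ i then sqrtWeight (j - h) * sqrtWeight (i - j) else 0)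
    (c := fun i j => sqrtWeight (min i j - h) * sqrtWeight (max i j - min i j))
    (D := 2 * √((q - h : ℕ) : ℝ)) (by positivity) ?_ ?_ ?_
  · refine hd.trans_eq ?_
    rw [mul_pow, Real.sq_sqrt (by positivity)]; ring
  · intro i _ j _
    have h1 := mul_pos (sqrtWeight_pos (i - h)) (sqrtWeight_pos (j - i))
    have h2 := mul_pos (sqrtWeight_pos (j - h)) (sqrtWeight_pos (i - j))
    rcases le_total i j with hij | hij
    · rw [max_eq_right hij, min_eq_left hij, if_pos hij]
      split_ifs <;> linarith
    · rw [max_eq_left hij, min_eq_right hij, if_pos hij]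
      split_ifs <;> linarith
  · intro j hj
    rw [← Finset.sum_filter, ← Finset.mul_sum]
    refine mul_le_mul_of_nonneg_left (sum_sqrtWeight_comp_le ?_ ?_) (sqrtWeight_pos _).le
    · intro a ha b hb hab
      simp at ha hb hab
      omega
    · intro i hi
      simp at hi hj
      omega
  · refine sum_sqrtWeight_comp_le ?_ ?_
    · intro a ha b hb hab
      simp at ha hb hab
      omega
    · intro i hi
      simp at hi
      omega

variable {Ω : Type*} [MeasurableSpace Ω] {P : Measure Ω} {ζ : ℕ → Ω → (Fin 2 → ℤ)}

theorem integral_meet_mul_meet (hζ : ∀ k, Measurable (ζ k)) (i₁ i₂ j₁ j₂ : ℕ) :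
    ∫ ω, meet ζ i₁ j₁ ω * meet ζ i₂ j₂ ω ∂P =
      P.real {ω | walk ζ i₁ ω = walk ζ j₁ ω ∧ walk ζ i₂ ω = walk ζ j₂ ω} := by
  have hm : MeasurableSet {ω | walk ζ i₁ ω = walk ζ j₁ ω ∧ walk ζ i₂ ω = walk ζ j₂ ω} :=
    (measurableSet_walk_eq hζ i₁ j₁).inter (measurableSet_walk_eq hζ i₂ j₂)
  rw [← integral_indicator_one hm]
  congr 1; funext ω
  simp only [meet, Set.indicator_apply, Set.mem_ofPred_eq, Pi.one_apply]
  by_cases h1 : walk ζ i₁ ω = walk ζ j₁ ω <;> by_cases h2 : walk ζ i₂ ω = walk ζ j₂ ω <;>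
    simp [h1, h2]

/-- Two bounds are available: one decays in the spread of the left times, the other in the spread of
the right times, both with the gap between the pairs. Their geometric mean treats both sides alike,
and splitting the gap at m then turns it into a product of a left and a right weight. -/
theorem integral_meet_mul_meet_le [IsProbabilityMeasure P] (h : IsStepSequence P ζ) {C : ℝ}
    (hC : ∀ (a b : ℕ) (x : Fin 2 → ℤ),
      P.real {ω | increment ζ a b ω = x} ≤ C / ((b - a : ℕ) + 1))
    {p m q i₁ i₂ j₁ j₂ : ℕ} (hi₁ : i₁ ∈ Finset.Ico p m) (hi₂ : i₂ ∈ Finset.Ico p m)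
    (hj₁ : j₁ ∈ Finset.Ico m q) (hj₂ : j₂ ∈ Finset.Ico m q) :
    ∫ ω, meet ζ i₁ j₁ ω * meet ζ i₂ j₂ ω ∂P ≤ C ^ 2 *
      ((sqrtWeight (m - 1 - max i₁ i₂) * sqrtWeight (max i₁ i₂ - min i₁ i₂)) *
      (sqrtWeight (min j₁ j₂ - m) * sqrtWeight (max j₁ j₂ - min j₁ j₂))) := by
  rw [Finset.mem_Ico] at hi₁ hi₂ hj₁ hj₂
  rw [integral_meet_mul_meet h.measurable]
  have hswap : {ω | walk ζ i₁ ω = walk ζ j₁ ω ∧ walk ζ i₂ ω = walk ζ j₂ ω} =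
      {ω | walk ζ i₂ ω = walk ζ j₂ ω ∧ walk ζ i₁ ω = walk ζ j₁ ω} := by
    ext ω; simp [and_comm]
  set π := P.real {ω | walk ζ i₁ ω = walk ζ j₁ ω ∧ walk ζ i₂ ω = walk ζ j₂ ω} with hπ
  set b := min j₁ j₂ - max i₁ i₂ with hb
  have hC0 : 0 ≤ C := by
    have := measureReal_nonneg.trans (hC 0 0 0)
    simpa using this
  have hmono : ∀ {d : ℕ}, b ≤ d → ∀ a : ℕ, C / ((a : ℝ) + 1) * (C / ((d : ℝ) + 1)) ≤
      C ^ 2 * sqrtWeight b ^ 2 * sqrtWeight a ^ 2 := by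
    intro d hd a
    rw [sqrtWeight_sq, sqrtWeight_sq]
    have : C / ((d : ℝ) + 1) ≤ C / ((b : ℝ) + 1) := by gcongr
    calc C / ((a : ℝ) + 1) * (C / ((d : ℝ) + 1)) ≤ C / ((a : ℝ) + 1) * (C / ((b : ℝ) + 1)) := by
          gcongr
      _ = _ := by ring
  have h1 : π ≤ C ^ 2 * sqrtWeight b ^ 2 * sqrtWeight (max i₁ i₂ - min i₁ i₂) ^ 2 := by
    rcases le_total i₁ i₂ with hle | hle
    · have := measureReal_double_meet_le_left h hC hle (by omega : i₂ ≤ j₁) (by omega : i₂ ≤ j₂)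
      rw [max_eq_right hle, min_eq_left hle]
      exact this.trans (hmono (by omega) _)
    · have := measureReal_double_meet_le_left h hC hle (by omega : i₁ ≤ j₂) (by omega : i₁ ≤ j₁)
      rw [max_eq_left hle, min_eq_right hle, hπ, hswap]
      exact this.trans (hmono (by omega) _)
  have h2 : π ≤ C ^ 2 * sqrtWeight b ^ 2 * sqrtWeight (max j₁ j₂ - min j₁ j₂) ^ 2 := by
    rcases le_total j₁ j₂ with hle | hle
    · have := measureReal_double_meet_le_right h hC hle (by omega : i₁ ≤ j₁) (by omega : i₂ ≤ j₁)
      rw [max_eq_right hle, min_eq_left hle]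
      exact this.trans (hmono (by omega) _)
    · have := measureReal_double_meet_le_right h hC hle (by omega : i₂ ≤ j₂) (by omega : i₁ ≤ j₂)
      rw [max_eq_left hle, min_eq_right hle, hπ, hswap]
      exact this.trans (hmono (by omega) _)
  set u := sqrtWeight (max i₁ i₂ - min i₁ i₂) with hu
  set v := sqrtWeight (max j₁ j₂ - min j₁ j₂) with hv
  have hu0 : 0 < u := sqrtWeight_pos _
  have hv0 : 0 < v := sqrtWeight_pos _
  -- The smaller of u² and v² is at most uv.
  have h3 : π ≤ C ^ 2 * sqrtWeight b ^ 2 * (u * v) := by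
    have hA : 0 ≤ C ^ 2 * sqrtWeight b ^ 2 := by positivity
    rcases le_total u v with huv | huv
    · exact h1.trans (mul_le_mul_of_nonneg_left (by nlinarith) hA)
    · exact h2.trans (mul_le_mul_of_nonneg_left (by nlinarith) hA)
  -- The last time on the left is m - 1, hence the distance to it on the left side and one unit lost
  -- at the cut.
  have h4 : sqrtWeight b ^ 2 ≤ sqrtWeight (m - 1 - max i₁ i₂) * sqrtWeight (min j₁ j₂ - m) := by
    have hb' : b = (m - 1 - max i₁ i₂ + (min j₁ j₂ - m)) + 1 := by omega
    rw [hb']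
    exact sqrtWeight_sq_le_mul le_rfl
  calc π ≤ C ^ 2 * sqrtWeight b ^ 2 * (u * v) := h3
    _ ≤ C ^ 2 * (sqrtWeight (m - 1 - max i₁ i₂) * sqrtWeight (min j₁ j₂ - m)) * (u * v) := by
        gcongr
    _ = _ := by ring

/-- The number of mutual intersections of two adjacent blocks has second moment `O(n²)`. -/
theorem integral_crossMeet_sq_le [IsProbabilityMeasure P] (h : IsStepSequence P ζ) {C : ℝ}
    (hC : ∀ (a b : ℕ) (x : Fin 2 → ℤ),
      P.real {ω | increment ζ a b ω = x} ≤ C / ((b - a : ℕ) + 1)) (p m q : ℕ) :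
    ∫ ω, crossMeet ζ p m q ω ^ 2 ∂P ≤ 64 * C ^ 2 * ((m - p : ℕ) * (q - m : ℕ)) := by
  set I := Finset.Ico p m
  set J := Finset.Ico m q
  have e1 : ∀ ω, crossMeet ζ p m q ω ^ 2 =
      ∑ x ∈ I ×ˢ J, ∑ y ∈ I ×ˢ J, meet ζ x.1 x.2 ω * meet ζ y.1 y.2 ω := by
    intro ω
    rw [← Finset.sum_mul_sum, ← pow_two, Finset.sum_product]
    rfl
  have hint : ∀ x y : ℕ × ℕ, Integrable (fun ω => meet ζ x.1 x.2 ω * meet ζ y.1 y.2 ω) P :=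
    fun x y => (memLp_meet h.measurable x.1 x.2 2).integrable_mul (memLp_meet h.measurable _ _ 2)
  simp_rw [e1]
  rw [integral_finsetSum _ fun x _ => integrable_finsetSum _ fun y _ => hint x y]
  simp_rw [integral_finsetSum _ fun y _ => hint _ y]
  set a : ℕ → ℕ → ℝ := fun i j =>
    sqrtWeight (m - 1 - max i j) * sqrtWeight (max i j - min i j) with ha
  set b : ℕ → ℕ → ℝ := fun i j => sqrtWeight (min i j - m) * sqrtWeight (max i j - min i j) with hb
  calc ∑ x ∈ I ×ˢ J, ∑ y ∈ I ×ˢ J, ∫ ω, meet ζ x.1 x.2 ω * meet ζ y.1 y.2 ω ∂P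
      ≤ ∑ x ∈ I ×ˢ J, ∑ y ∈ I ×ˢ J, C ^ 2 * (a x.1 y.1 * b x.2 y.2) := by
        refine Finset.sum_le_sum fun x hx => Finset.sum_le_sum fun y hy => ?_
        rw [Finset.mem_product] at hx hy
        exact integral_meet_mul_meet_le h hC hx.1 hy.1 hx.2 hy.2
    -- The bound on a pair of meetings separates, so the fourfold sum is a product of two double
    -- sums, each linear in the length of its block.
    _ = C ^ 2 * ((∑ i ∈ I, ∑ j ∈ I, a i j) * ∑ i ∈ J, ∑ j ∈ J, b i j) := by
        simp_rw [← Finset.mul_sum, Finset.sum_product, Finset.sum_mul_sum]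
    _ ≤ C ^ 2 * ((8 * (m - p : ℕ)) * (8 * (q - m : ℕ))) := by
        refine mul_le_mul_of_nonneg_left ?_ (by positivity)
        refine mul_le_mul (sum_left_weights_le p m) (sum_right_weights_le m q) ?_ (by positivity)
        exact Finset.sum_nonneg fun i _ => Finset.sum_nonneg fun j _ =>
          (mul_pos (sqrtWeight_pos _) (sqrtWeight_pos _)).le
    _ = _ := by ring

end PlanarWalk

end

/-! ### Mean and variance of the number of self-intersections -/

section
namespace PlanarWalk

variable {Ω : Type*}

theorem meet_eq_ite_increment (ζ : ℕ → Ω → (Fin 2 → ℤ)) (i j : ℕ) (ω : Ω) :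
    meet ζ i j ω = if increment ζ (min i j) (max i j) ω = 0 then 1 else 0 := by
  rcases le_total i j with h | h
  · rw [min_eq_left h, max_eq_right h, meet]
    simp only [walk_eq_walk_iff ζ h]
  · rw [min_eq_right h, max_eq_left h, meet_comm, meet]
    simp only [walk_eq_walk_iff ζ h]

theorem selfMeet_of_le_succ (ζ : ℕ → Ω → (Fin 2 → ℤ)) {p q : ℕ} (h : q ≤ p + 1) (ω : Ω) :
    selfMeet ζ p q ω = (q - p : ℕ) := by
  rcases Nat.lt_or_ge p q with hlt | hle
  · have : q = p + 1 := by omega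
    subst this
    simp only [selfMeet, Nat.Ico_succ_singleton, Finset.sum_singleton, meet]
    simp
  · simp [selfMeet, Finset.Ico_eq_empty_of_le hle, Nat.sub_eq_zero_of_le hle]

variable [MeasurableSpace Ω] {P : Measure Ω} {ζ : ℕ → Ω → (Fin 2 → ℤ)}

/-- Written through increments, the self-intersections of a block depend only on its own steps and
not on the position of the walk at its start. -/
theorem indepFun_selfMeet (h : IsStepSequence P ζ) (p m q : ℕ) :
    IndepFun (selfMeet ζ p m) (selfMeet ζ m q) P := by
  let G (a b : ℕ) (x : Finset.Ico a b → Fin 2 → ℤ) : ℝ :=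
    ∑ i ∈ Finset.Ico a b, ∑ j ∈ Finset.Ico a b,
      if ∑ k : Finset.Ico a b, (if (k : ℕ) ∈ Finset.Ico (min i j) (max i j) then x k else 0) = 0
        then 1 else 0
  have key : ∀ a b : ℕ, selfMeet ζ a b = fun ω => G a b fun k => ζ k ω := by
    intro a b
    funext ω
    refine Finset.sum_congr rfl fun i hi => Finset.sum_congr rfl fun j hj => ?_
    rw [Finset.mem_Ico] at hi hj
    rw [sum_coe_Ico_eq_increment (Finset.Ico_subset_Ico (by omega) (by omega)),
      meet_eq_ite_increment]
  rw [key p m, key m q]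
  exact indepFun_of_disjoint_times h (Finset.Ico_disjoint_Ico_consecutive p m q)
    (measurable_of_countable (G p m)) (measurable_of_countable (G m q))

/-- This is (x + y)² ≤ (3/2) x² + 3 y² for the centered variables. The weight 3/2 on the main term
is small enough for the recursion on block lengths to contract. -/
theorem variance_add_le [IsProbabilityMeasure P] {X Y : Ω → ℝ} (hX : MemLp X 2 P)
    (hY : MemLp Y 2 P) :
    variance (fun ω => X ω + Y ω) P ≤ 3 / 2 * variance X P + 3 * variance Y P := by
  have hXi := hX.integrable (by norm_num)
  have hYi := hY.integrable (by norm_num)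
  have hXY : MemLp (fun ω => X ω + Y ω) 2 P := hX.add hY
  rw [variance_eq_integral hXY.aestronglyMeasurable.aemeasurable,
    variance_eq_integral hX.aestronglyMeasurable.aemeasurable,
    variance_eq_integral hY.aestronglyMeasurable.aemeasurable, integral_add hXi hYi,
    ← integral_const_mul, ← integral_const_mul]
  have h1 : Integrable (fun ω => (X ω - ∫ ω, X ω ∂P) ^ 2) P :=
    (hX.sub (memLp_const (∫ ω, X ω ∂P))).integrable_sq
  have h2 : Integrable (fun ω => (Y ω - ∫ ω, Y ω ∂P) ^ 2) P :=
    (hY.sub (memLp_const (∫ ω, Y ω ∂P))).integrable_sq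
  rw [← integral_add (h1.const_mul _) (h2.const_mul _)]
  refine integral_mono ?_ ((h1.const_mul _).add (h2.const_mul _)) fun ω => ?_
  · have h3 := ((hX.add hY).sub (memLp_const (∫ ω, X ω ∂P + ∫ ω, Y ω ∂P))).integrable_sq
    exact h3
  · simp only
    nlinarith [sq_nonneg ((X ω - ∫ ω, X ω ∂P) - 2 * (Y ω - ∫ ω, Y ω ∂P))]

/-- The variance of the number of self-intersections up to time `n` is `O(n²)`. -/
theorem exists_variance_selfMeet_le [IsProbabilityMeasure P] (h : IsStepSequence P ζ) :
    ∃ K : ℝ, 0 ≤ K ∧ ∀ p q : ℕ, variance (selfMeet ζ p q) P ≤ K * ((q - p : ℕ) : ℝ) ^ 2 := by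
  obtain ⟨C, hC0, hC⟩ := exists_measureReal_increment_le h
  -- With B = 256 C² bounding the variance of twice the cross term by B n², the recursion requires
  -- (3/2)(5/9) K + 3B ≤ K, with equality at K = 18B.
  refine ⟨18 * (256 * C ^ 2), by positivity, ?_⟩
  suffices hmain : ∀ n p q : ℕ, q - p = n →
      variance (selfMeet ζ p q) P ≤ 18 * (256 * C ^ 2) * (n : ℝ) ^ 2 from
    fun p q => hmain (q - p) p q rfl
  intro n
  induction n using Nat.strong_induction_on with
  | _ n ih =>
  intro p q hn
  rcases Nat.lt_or_ge n 2 with hlt | hge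
  · have : selfMeet ζ p q = fun _ => ((q - p : ℕ) : ℝ) :=
      funext fun ω => selfMeet_of_le_succ ζ (by omega) ω
    rw [this]
    simp only [variance, evariance, integral_const, probReal_univ, one_smul, sub_self]
    simp
    positivity
  set m := p + n / 2 with hm
  have hpm : p ≤ m := by omega
  have hmq : m ≤ q := by omega
  have e : selfMeet ζ p q = fun ω => (selfMeet ζ p m ω + selfMeet ζ m q ω) +
      2 * crossMeet ζ p m q ω := funext fun ω => selfMeet_eq_add ζ hpm hmq ω
  have hL := memLp_selfMeet (P := P) h.measurable
  have hX := memLp_crossMeet (P := P) h.measurable p m q 2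
  have h1 := variance_add_le ((hL p m 2).add (hL m q 2)) (hX.const_mul 2)
  have h2 := (indepFun_selfMeet h p m q).variance_add (hL p m 2) (hL m q 2)
  have i1 := ih (n / 2) (by omega) p m (by omega)
  have i2 := ih (n - n / 2) (by omega) m q (by omega)
  have h3 : variance (fun ω => 2 * crossMeet ζ p m q ω) P ≤ 256 * C ^ 2 * (n : ℝ) ^ 2 := by
    rw [variance_const_mul]
    have h4 := variance_le_expectation_sq (μ := P) hX.aestronglyMeasurable
    have h5 := integral_crossMeet_sq_le h hC p m q
    have h6 : (((m - p : ℕ) : ℝ) * (q - m : ℕ)) ≤ (n : ℝ) ^ 2 := by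
      rw [pow_two]
      have a1 : m - p ≤ n := by omega
      have a2 : q - m ≤ n := by omega
      gcongr
    have h7 : ∫ ω, (crossMeet ζ p m q ^ 2) ω ∂P = ∫ ω, crossMeet ζ p m q ω ^ 2 ∂P := rfl
    have h8 := mul_le_mul_of_nonneg_left h6 (by positivity : (0 : ℝ) ≤ 64 * C ^ 2)
    rw [h7] at h4
    linarith
  -- The worst case is n = 3, split as 1 + 2.
  have h9 : ((n / 2 : ℕ) : ℝ) ^ 2 + ((n - n / 2 : ℕ) : ℝ) ^ 2 ≤ 5 / 9 * (n : ℝ) ^ 2 := by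
    have hge' : (2 : ℝ) ≤ n := by exact_mod_cast hge
    rcases Nat.even_or_odd' n with ⟨k, hk | hk⟩
    · have a1 : n / 2 = k := by omega
      have a2 : n - n / 2 = k := by omega
      rw [a2, a1, hk]; push_cast; nlinarith [sq_nonneg (k : ℝ)]
    · have a1 : n / 2 = k := by omega
      have a2 : n - n / 2 = k + 1 := by omega
      have a3 : (1 : ℝ) ≤ k := by exact_mod_cast (by omega : 1 ≤ k)
      rw [a2, a1, hk]; push_cast; nlinarith
  rw [e]
  refine h1.trans ?_
  have h10 : variance (selfMeet ζ p m + selfMeet ζ m q) P ≤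
      18 * (256 * C ^ 2) * (5 / 9 * (n : ℝ) ^ 2) := by
    rw [h2]
    calc _ ≤ 18 * (256 * C ^ 2) * ((n / 2 : ℕ) : ℝ) ^ 2 +
          18 * (256 * C ^ 2) * ((n - n / 2 : ℕ) : ℝ) ^ 2 := add_le_add i1 i2
      _ = 18 * (256 * C ^ 2) * (((n / 2 : ℕ) : ℝ) ^ 2 + ((n - n / 2 : ℕ) : ℝ) ^ 2) := by ring
      _ ≤ _ := mul_le_mul_of_nonneg_left h9 (by positivity)
  calc _ ≤ 3 / 2 * (18 * (256 * C ^ 2) * (5 / 9 * (n : ℝ) ^ 2)) +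
        3 * (256 * C ^ 2 * (n : ℝ) ^ 2) := by
        refine add_le_add (mul_le_mul_of_nonneg_left h10 (by norm_num))
          (mul_le_mul_of_nonneg_left h3 (by norm_num))
    _ = 18 * (256 * C ^ 2) * (n : ℝ) ^ 2 := by ring

/-- The expected number of self-intersections in `n` steps when the return probabilities are `r`. -/
def meanSelfMeet (r : ℕ → ℝ) (n : ℕ) : ℝ :=
  ∑ i ∈ Finset.range n, ∑ j ∈ Finset.range n, r (max i j - min i j)

theorem integral_meet [IsProbabilityMeasure P] (h : IsStepSequence P ζ) (i j : ℕ) :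
    ∫ ω, meet ζ i j ω ∂P = returnProb P ζ (max i j - min i j) := by
  rw [← measureReal_increment_eq_zero h, ← integral_indicator_one
    (measurableSet_eq_fun (measurable_increment h.measurable _ _) measurable_const)]
  congr 1; funext ω
  rw [meet_eq_ite_increment]
  simp [Set.indicator_apply]

theorem integral_selfMeet [IsProbabilityMeasure P] (h : IsStepSequence P ζ) (p q : ℕ) :
    ∫ ω, selfMeet ζ p q ω ∂P = meanSelfMeet (returnProb P ζ) (q - p) := by
  have hint : ∀ i j, Integrable (fun ω => meet ζ i j ω) P := fun i j =>
    memLp_one_iff_integrable.1 (memLp_meet h.measurable i j 1)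
  unfold selfMeet
  rw [integral_finsetSum _ fun i _ => integrable_finsetSum _ fun j _ => hint i j]
  simp_rw [integral_finsetSum _ fun j _ => hint _ j, integral_meet h]
  rw [Finset.sum_Ico_eq_sum_range, meanSelfMeet]
  refine Finset.sum_congr rfl fun i _ => ?_
  rw [Finset.sum_Ico_eq_sum_range]
  refine Finset.sum_congr rfl fun j _ => ?_
  congr 1
  omega

/-- There are 2(n - k) ordered pairs of times at distance k for 0 < k < n, and n pairs at distance
0. -/
theorem meanSelfMeet_eq (r : ℕ → ℝ) (n : ℕ) : meanSelfMeet r n =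
    2 * (n * ∑ k ∈ Finset.range n, r k - ∑ k ∈ Finset.range n, k * r k) - n * r 0 := by
  induction n with
  | zero => simp [meanSelfMeet]
  | succ n ih =>
    have h1 : ∑ i ∈ Finset.range n, r (max i n - min i n) =
        ∑ k ∈ Finset.range (n + 1), r k - r 0 := by
      rw [Finset.sum_range_succ', add_sub_cancel_right, ← Finset.sum_range_reflect]
      refine Finset.sum_congr rfl fun i hi => ?_
      have := Finset.mem_range.1 hi
      congr 1; omega
    have h2 : ∑ i ∈ Finset.range n, r (max n i - min n i) =
        ∑ k ∈ Finset.range (n + 1), r k - r 0 := by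
      rw [← h1]; simp_rw [max_comm n, min_comm n]
    have h3 : meanSelfMeet r (n + 1) = meanSelfMeet r n +
        2 * (∑ k ∈ Finset.range (n + 1), r k - r 0) + r 0 := by
      unfold meanSelfMeet
      rw [Finset.sum_range_succ]
      simp_rw [Finset.sum_range_succ _ n]
      rw [Finset.sum_add_distrib]
      simp_rw [Finset.sum_range_succ _ n] at h1 h2
      rw [h1, h2]
      simp
      ring
    rw [h3, ih, Finset.sum_range_succ, Finset.sum_range_succ]
    push_cast
    ring

/-- Since r k = O(1/k), the sum of the k r k up to n is O(n), as is the diagonal term; both are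
negligible against n log n. -/
theorem tendsto_meanSelfMeet {r : ℕ → ℝ} {C κ : ℝ} (hr0 : ∀ k, 0 ≤ r k)
    (hrC : ∀ k : ℕ, r k ≤ C / (k + 1))
    (hlim : Tendsto (fun n : ℕ => (∑ k ∈ Finset.range n, r k) / Real.log n) atTop (𝓝 κ)) :
    Tendsto (fun n : ℕ => meanSelfMeet r n / (n * Real.log n)) atTop (𝓝 (2 * κ)) := by
  have hlog : Tendsto (fun n : ℕ => Real.log n) atTop atTop :=
    Real.tendsto_log_atTop.comp tendsto_natCast_atTop_atTop
  have hC : 0 ≤ C := by simpa using (hr0 0).trans (hrC 0)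
  have hz : Tendsto (fun n : ℕ => (2 * C + r 0) / Real.log n) atTop (𝓝 0) :=
    tendsto_const_nhds.div_atTop hlog
  have h2 := hlim.const_mul 2
  refine tendsto_of_tendsto_of_tendsto_of_le_of_le' (by simpa using h2.sub hz) h2 ?_ ?_
  all_goals
    filter_upwards [hlog.eventually_gt_atTop 0, eventually_gt_atTop 0] with n hn hn0
    have hn0' : (0 : ℝ) < n := by exact_mod_cast hn0
    have hs0 : 0 ≤ ∑ k ∈ Finset.range n, (k : ℝ) * r k :=
      Finset.sum_nonneg fun k _ => mul_nonneg (by positivity) (hr0 k)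
    have hs1 : ∑ k ∈ Finset.range n, (k : ℝ) * r k ≤ n * C := by
      refine (Finset.sum_le_card_nsmul _ _ C fun k _ => ?_).trans_eq (by simp)
      have := hrC k
      rw [le_div_iff₀ (by positivity)] at this
      nlinarith [hr0 k]
    rw [meanSelfMeet_eq]
  · rw [mul_div_assoc', div_sub_div_same, div_le_div_iff₀ hn (by positivity)]
    have : 0 ≤ Real.log n := hn.le
    nlinarith [mul_le_mul_of_nonneg_right hs1 this]
  · rw [mul_div_assoc', div_le_div_iff₀ (by positivity) hn]
    nlinarith [mul_nonneg hs0 hn.le, mul_nonneg (mul_nonneg hn0'.le (hr0 0)) hn.le]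

end PlanarWalk

end

/-! ### Almost sure asymptotics of self-intersections, along a sparse sequence and then along all
times -/

section
namespace PlanarWalk

/-- A sparse sequence whose successive ratios tend to `1`. -/
def sparse (k : ℕ) : ℝ := Real.exp ((k : ℝ) ^ (2 / 3 : ℝ))

theorem sparse_pos (k : ℕ) : 0 < sparse k := Real.exp_pos _

theorem log_sparse (k : ℕ) : Real.log (sparse k) = (k : ℝ) ^ (2 / 3 : ℝ) := Real.log_exp _

theorem tendsto_rpow_two_thirds : Tendsto (fun k : ℕ => (k : ℝ) ^ (2 / 3 : ℝ)) atTop atTop :=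
  (tendsto_rpow_atTop (by norm_num)).comp tendsto_natCast_atTop_atTop

theorem tendsto_sparse : Tendsto sparse atTop atTop :=
  Real.tendsto_exp_atTop.comp tendsto_rpow_two_thirds

theorem tendsto_rpow_two_thirds_succ_sub :
    Tendsto (fun k : ℕ => ((k + 1 : ℕ) : ℝ) ^ (2 / 3 : ℝ) - (k : ℝ) ^ (2 / 3 : ℝ)) atTop (𝓝 0) := by
  have h0 : Tendsto (fun k : ℕ => (k : ℝ) ^ (-(1 / 3) : ℝ)) atTop (𝓝 0) :=
    (tendsto_rpow_neg_atTop (by norm_num)).comp tendsto_natCast_atTop_atTop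
  refine tendsto_of_tendsto_of_tendsto_of_le_of_le' tendsto_const_nhds h0 ?_ ?_
  · refine Eventually.of_forall fun k => sub_nonneg.2 ?_
    exact Real.rpow_le_rpow (by positivity) (by push_cast; linarith) (by norm_num)
  · filter_upwards [eventually_gt_atTop 0] with k hk
    have hk' : (0 : ℝ) < k := by exact_mod_cast hk
    have e : ((k + 1 : ℕ) : ℝ) = k * (1 + 1 / k) := by push_cast; field_simp
    rw [e, Real.mul_rpow hk'.le (by positivity)]
    have h1 : (1 + 1 / (k : ℝ)) ^ (2 / 3 : ℝ) ≤ 1 + 1 / k :=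
      Real.rpow_le_self_of_one_le (by linarith [one_div_pos.2 hk']) (by norm_num)
    have h2 : (k : ℝ) ^ (-(1 / 3) : ℝ) = (k : ℝ) ^ (2 / 3 : ℝ) * (1 / k) := by
      have h3 : 1 / (k : ℝ) = (k : ℝ) ^ (-1 : ℝ) := by rw [Real.rpow_neg_one, one_div]
      rw [h3, ← Real.rpow_add hk']; norm_num
    rw [h2]
    nlinarith [Real.rpow_pos_of_pos hk' (2 / 3)]

theorem tendsto_sparse_succ_div : Tendsto (fun k => sparse (k + 1) / sparse k) atTop (𝓝 1) := by
  have h := (Real.continuous_exp.tendsto 0).comp tendsto_rpow_two_thirds_succ_sub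
  rw [Real.exp_zero] at h
  refine h.congr fun k => ?_
  simp only [Function.comp, sparse, Real.exp_sub]

theorem tendsto_rpow_two_thirds_succ_div :
    Tendsto (fun k : ℕ => ((k + 1 : ℕ) : ℝ) ^ (2 / 3 : ℝ) / (k : ℝ) ^ (2 / 3 : ℝ)) atTop (𝓝 1) := by
  have h := (tendsto_rpow_two_thirds_succ_sub.div_atTop tendsto_rpow_two_thirds).add_const 1
  rw [zero_add] at h
  refine h.congr' ?_
  filter_upwards [tendsto_rpow_two_thirds.eventually_gt_atTop 0] with k hk
  field_simp
  ring

/-- The index of the last term of the sparse sequence that is at most `n`. -/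
def sparseIndex (n : ℕ) : ℕ := ⌊(Real.log n) ^ (3 / 2 : ℝ)⌋₊

theorem tendsto_sparseIndex : Tendsto sparseIndex atTop atTop :=
  tendsto_nat_floor_atTop.comp ((tendsto_rpow_atTop (by norm_num)).comp
    (Real.tendsto_log_atTop.comp tendsto_natCast_atTop_atTop))

theorem rpow_sparseIndex_le (n : ℕ) : (sparseIndex n : ℝ) ^ (2 / 3 : ℝ) ≤ Real.log n := by
  have hlog : 0 ≤ Real.log n := Real.log_natCast_nonneg n
  have h1 : (sparseIndex n : ℝ) ≤ (Real.log n) ^ (3 / 2 : ℝ) := Nat.floor_le (by positivity)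
  refine (Real.rpow_le_rpow (by positivity) h1 (by norm_num : (0 : ℝ) ≤ 2 / 3)).trans_eq ?_
  rw [← Real.rpow_mul hlog]; norm_num

theorem le_rpow_sparseIndex_succ (n : ℕ) :
    Real.log n ≤ ((sparseIndex n + 1 : ℕ) : ℝ) ^ (2 / 3 : ℝ) := by
  have hlog : 0 ≤ Real.log n := Real.log_natCast_nonneg n
  have h1 : (Real.log n) ^ (3 / 2 : ℝ) ≤ ((sparseIndex n + 1 : ℕ) : ℝ) := by
    push_cast; exact (Nat.lt_floor_add_one _).le
  refine le_trans (le_of_eq ?_)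
    (Real.rpow_le_rpow (by positivity) h1 (by norm_num : (0 : ℝ) ≤ 2 / 3))
  rw [← Real.rpow_mul hlog]; norm_num

theorem sparse_sparseIndex_le {n : ℕ} (hn : 0 < n) : sparse (sparseIndex n) ≤ n := by
  rw [sparse, ← Real.le_log_iff_exp_le (by exact_mod_cast hn)]
  exact rpow_sparseIndex_le n

theorem le_sparse_sparseIndex_succ {n : ℕ} (hn : 0 < n) : n ≤ sparse (sparseIndex n + 1) := by
  rw [sparse, ← Real.log_le_iff_le_exp (by exact_mod_cast hn)]
  exact le_rpow_sparseIndex_succ n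

/-- An integer n lies between two consecutive terms of the sparse sequence, and both the terms and
their logarithms have ratios tending to 1. -/
theorem tendsto_mul_log_div_sparse :
    Tendsto (fun n : ℕ => (sparse (sparseIndex n) * (sparseIndex n : ℝ) ^ (2 / 3 : ℝ)) /
      (n * Real.log n)) atTop (𝓝 1) := by
  have h1 : Tendsto (fun n : ℕ => sparse (sparseIndex n) / n) atTop (𝓝 1) := by
    have h2 := (tendsto_sparse_succ_div.comp tendsto_sparseIndex).inv₀ one_ne_zero
    rw [inv_one] at h2
    refine tendsto_of_tendsto_of_tendsto_of_le_of_le' h2 tendsto_const_nhds ?_ ?_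
    · filter_upwards [eventually_gt_atTop 0] with n hn
      have hn' : (0 : ℝ) < n := by exact_mod_cast hn
      simp only [Function.comp, inv_div]
      exact div_le_div_of_nonneg_left (sparse_pos _).le hn' (le_sparse_sparseIndex_succ hn)
    · filter_upwards [eventually_gt_atTop 0] with n hn
      have hn' : (0 : ℝ) < n := by exact_mod_cast hn
      exact (div_le_one hn').2 (sparse_sparseIndex_le hn)
  have hlog : Tendsto (fun n : ℕ => Real.log n) atTop atTop :=
    Real.tendsto_log_atTop.comp tendsto_natCast_atTop_atTop
  have h3 : Tendsto (fun n : ℕ => (sparseIndex n : ℝ) ^ (2 / 3 : ℝ) / Real.log n) atTop (𝓝 1) := by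
    have h2 := (tendsto_rpow_two_thirds_succ_div.comp tendsto_sparseIndex).inv₀ one_ne_zero
    rw [inv_one] at h2
    refine tendsto_of_tendsto_of_tendsto_of_le_of_le' h2 tendsto_const_nhds ?_ ?_
    · filter_upwards [hlog.eventually_gt_atTop 0] with n hn
      simp only [Function.comp, inv_div]
      exact div_le_div_of_nonneg_left (by positivity) hn (le_rpow_sparseIndex_succ n)
    · filter_upwards [hlog.eventually_gt_atTop 0] with n hn
      exact (div_le_one hn).2 (rpow_sparseIndex_le n)
  have h4 := h1.mul h3
  rw [one_mul] at h4
  exact h4.congr fun n => by rw [div_mul_div_comm]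

theorem tendsto_natCast_sub_div {p q : ℕ → ℕ} {b : ℕ → ℝ} {s t : ℝ} (hb : ∀ k, 0 < b k)
    (hp : Tendsto (fun k => (p k : ℝ) / b k) atTop (𝓝 s))
    (hq : Tendsto (fun k => (q k : ℝ) / b k) atTop (𝓝 t)) (hst : s < t) :
    Tendsto (fun k => ((q k - p k : ℕ) : ℝ) / b k) atTop (𝓝 (t - s)) := by
  refine (hq.sub hp).congr' ?_
  filter_upwards [hp.eventually_lt hq hst] with k hk
  rw [div_lt_div_iff_of_pos_right (hb k)] at hk
  rw [Nat.cast_sub (by exact_mod_cast hk.le), sub_div]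

variable {Ω : Type*} [MeasurableSpace Ω] {P : Measure Ω} {ζ : ℕ → Ω → (Fin 2 → ℤ)}

/-- The variance divided by the squared normalization is of order (log of the time)⁻² = k^(-4/3),
which is summable. The exponent 2/3 in `sparse` has to exceed 1/2 for this, and to stay below 1 for
consecutive ratios to tend to 1. -/
theorem ae_tendsto_selfMeet_sparse [IsProbabilityMeasure P] (h : IsStepSequence P ζ) {p q : ℕ → ℕ}
    {ρ : ℝ} (hρ : 0 < ρ)
    (hpq : Tendsto (fun k => ((q k - p k : ℕ) : ℝ) / sparse k) atTop (𝓝 ρ)) :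
    ∀ᵐ ω ∂P, Tendsto (fun k : ℕ => selfMeet ζ (p k) (q k) ω / (sparse k * (k : ℝ) ^ (2 / 3 : ℝ)))
      atTop (𝓝 (2 * greenConst (P.map (ζ 0)) * ρ)) := by
  set κ := greenConst (P.map (ζ 0)) with hκ
  set d : ℕ → ℕ := fun k => q k - p k with hd
  set N : ℕ → ℝ := fun k => sparse k * (k : ℝ) ^ (2 / 3 : ℝ) with hN
  obtain ⟨K, hK0, hK⟩ := exists_variance_selfMeet_le h
  obtain ⟨C, hC0, hC⟩ := exists_measureReal_increment_le h
  have hdtop : Tendsto (fun k => (d k : ℝ)) atTop atTop := by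
    have := hpq.pos_mul_atTop hρ tendsto_sparse
    refine this.congr fun k => ?_
    rw [div_mul_cancel₀ _ (sparse_pos k).ne']
  have hdtop' : Tendsto d atTop atTop := tendsto_natCast_atTop_iff.1 hdtop
  -- The window length is a constant multiple of `sparse k` asymptotically, and a constant factor is
  -- invisible to the logarithm.
  have hlogd : Tendsto (fun k : ℕ => Real.log (d k) / (k : ℝ) ^ (2 / 3 : ℝ)) atTop (𝓝 1) := by
    have h1 : Tendsto (fun k => Real.log ((d k : ℝ) / sparse k)) atTop (𝓝 (Real.log ρ)) :=
      hpq.log hρ.ne'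
    have h2 := (h1.div_atTop tendsto_rpow_two_thirds).add_const 1
    rw [zero_add] at h2
    refine h2.congr' ?_
    filter_upwards [tendsto_rpow_two_thirds.eventually_gt_atTop 0,
      hdtop.eventually_gt_atTop 0] with k hk hdk
    rw [Real.log_div hdk.ne' (sparse_pos k).ne', log_sparse]
    field_simp
    ring
  have hmean : Tendsto (fun k => (∫ ω, selfMeet ζ (p k) (q k) ω ∂P) / N k) atTop
      (𝓝 (2 * κ * ρ)) := by
    have h1 := (tendsto_meanSelfMeet (r := returnProb P ζ) (C := C) (fun k => measureReal_nonneg)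
      (fun k => by simpa [returnProb] using hC 0 k 0) (tendsto_sum_returnProb_div_log h)).comp hdtop'
    have h2 := (h1.mul hpq).mul hlogd
    rw [mul_one] at h2
    refine h2.congr' ?_
    have hlogd' : Tendsto (fun k => Real.log (d k)) atTop atTop :=
      Real.tendsto_log_atTop.comp hdtop
    filter_upwards [hdtop.eventually_gt_atTop 0, hlogd'.eventually_gt_atTop 0] with k hk1 hk2
    rw [integral_selfMeet h]
    simp only [Function.comp, hN, hd] at *
    have := sparse_pos k
    field_simp
  set D : ℕ → Ω → ℝ := fun k ω =>
    (selfMeet ζ (p k) (q k) ω - ∫ ω, selfMeet ζ (p k) (q k) ω ∂P) / N k with hD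
  have hD2 : ∀ k, Integrable (fun ω => D k ω ^ 2) P ∧
      ∫ ω, D k ω ^ 2 ∂P ≤ K * ((d k : ℝ) / sparse k) ^ 2 * ((k : ℝ) ^ (4 / 3 : ℝ))⁻¹ := by
    intro k
    have hL := memLp_selfMeet (P := P) h.measurable (p k) (q k) 2
    have h1 : Integrable (fun ω => (selfMeet ζ (p k) (q k) ω -
        ∫ ω, selfMeet ζ (p k) (q k) ω ∂P) ^ 2) P := (hL.sub (memLp_const _)).integrable_sq
    have e : (fun ω => D k ω ^ 2) = fun ω => (selfMeet ζ (p k) (q k) ω -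
        ∫ ω, selfMeet ζ (p k) (q k) ω ∂P) ^ 2 * (N k ^ 2)⁻¹ := by
      funext ω; simp only [hD]; rw [div_pow, div_eq_mul_inv]
    rw [e]
    refine ⟨h1.mul_const _, ?_⟩
    rw [integral_mul_const, ← variance_eq_integral hL.aestronglyMeasurable.aemeasurable]
    have hN2 : (N k ^ 2)⁻¹ = (sparse k ^ 2)⁻¹ * ((k : ℝ) ^ (4 / 3 : ℝ))⁻¹ := by
      simp only [hN]
      rw [mul_pow, mul_inv, ← Real.rpow_mul_natCast (by positivity)]
      norm_num
    rw [hN2]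
    calc _ ≤ K * (d k : ℝ) ^ 2 * ((sparse k ^ 2)⁻¹ * ((k : ℝ) ^ (4 / 3 : ℝ))⁻¹) :=
          mul_le_mul_of_nonneg_right (hK _ _) (by positivity)
      _ = _ := by rw [div_pow]; ring
  obtain ⟨M, hM⟩ := hpq.bddAbove_range
  have hM' : ∀ k, (d k : ℝ) / sparse k ≤ M := fun k => hM ⟨k, rfl⟩
  have hsum : Summable fun k => ∫ ω, D k ω ^ 2 ∂P := by
    refine Summable.of_nonneg_of_le (fun k => integral_nonneg fun ω => sq_nonneg _)
      (fun k => (hD2 k).2.trans (?_ : _ ≤ K * M ^ 2 * ((k : ℝ) ^ (4 / 3 : ℝ))⁻¹)) ?_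
    · have h0 : 0 ≤ (d k : ℝ) / sparse k := div_nonneg (by positivity) (sparse_pos k).le
      have := hM' k
      gcongr
    · exact (Real.summable_nat_rpow_inv.2 (by norm_num)).mul_left _
  -- The sum of the squared deviations has finite expectation, hence is almost surely finite, and
  -- its terms tend to 0.
  have hlint : ∫⁻ ω, ∑' k, ENNReal.ofReal (D k ω ^ 2) ∂P ≠ ∞ := by
    rw [lintegral_tsum fun k => (hD2 k).1.aestronglyMeasurable.aemeasurable.ennreal_ofReal]
    have e : ∀ k, ∫⁻ ω, ENNReal.ofReal (D k ω ^ 2) ∂P = ENNReal.ofReal (∫ ω, D k ω ^ 2 ∂P) :=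
      fun k => (ofReal_integral_eq_lintegral_ofReal (hD2 k).1
        (Eventually.of_forall fun ω => sq_nonneg _)).symm
    simp_rw [e]
    exact hsum.tsum_ofReal_ne_top
  have hae := ae_lt_top' (AEMeasurable.tsum fun k =>
    (hD2 k).1.aestronglyMeasurable.aemeasurable.ennreal_ofReal) hlint
  filter_upwards [hae] with ω hω
  have h1 := ENNReal.tendsto_atTop_zero_of_tsum_ne_top hω.ne
  have h2 : Tendsto (fun k => D k ω ^ 2) atTop (𝓝 0) := by
    have := (ENNReal.tendsto_toReal ENNReal.zero_ne_top).comp h1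
    refine this.congr fun k => ?_
    simp [ENNReal.toReal_ofReal (sq_nonneg (D k ω))]
  have h3 : Tendsto (fun k => D k ω) atTop (𝓝 0) := by
    have := h2.sqrt
    simp_rw [Real.sqrt_sq_eq_abs, Real.sqrt_zero] at this
    exact (tendsto_zero_iff_abs_tendsto_zero _).2 this
  have h4 := h3.add hmean
  rw [zero_add] at h4
  refine h4.congr fun k => ?_
  simp only [hD]
  rw [← add_div, sub_add_cancel]

/-- Almost surely, the number of self-intersections in the time window `[ns, nt]` is asymptotic
to `(t - s) n log n / (π √(det Σ))`. -/
theorem ae_tendsto_selfMeet [IsProbabilityMeasure P] (h : IsStepSequence P ζ) {s t : ℝ}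
    (hs : 0 ≤ s) (hst : s < t) :
    ∀ᵐ ω ∂P, Tendsto (fun n : ℕ => selfMeet ζ ⌊(n : ℝ) * s⌋₊ ⌊(n : ℝ) * t⌋₊ ω / (n * Real.log n))
      atTop (𝓝 (2 * greenConst (P.map (ζ 0)) * (t - s))) := by
  have ht : 0 ≤ t := hs.trans hst.le
  have hsucc := tendsto_sparse.comp (tendsto_add_atTop_nat 1)
  have f1 : ∀ {a : ℝ}, 0 ≤ a → Tendsto (fun k => (⌊a * sparse k⌋₊ : ℝ) / sparse k) atTop (𝓝 a) :=
    fun ha => (tendsto_nat_floor_mul_div_atTop ha).comp tendsto_sparse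
  have f2 : ∀ {a : ℝ}, 0 ≤ a →
      Tendsto (fun k => (⌈a * sparse (k + 1)⌉₊ : ℝ) / sparse k) atTop (𝓝 a) := by
    intro a ha
    have := ((tendsto_nat_ceil_mul_div_atTop ha).comp hsucc).mul tendsto_sparse_succ_div
    rw [mul_one] at this
    refine this.congr fun k => ?_
    simp only [Function.comp]
    rw [div_mul_div_cancel₀ (sparse_pos _).ne']
  -- When n lies between `sparse k` and `sparse (k + 1)`, this window is contained in [ns, nt), and
  -- the window of `hU` contains it. `selfMeet_mono` squeezes the count between the two.
  have hL := ae_tendsto_selfMeet_sparse h (sub_pos.2 hst)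
    (tendsto_natCast_sub_div sparse_pos (f2 hs) (f1 ht) hst)
  have hU := ae_tendsto_selfMeet_sparse h (sub_pos.2 hst)
    (tendsto_natCast_sub_div sparse_pos (f1 hs) (f2 ht) hst)
  filter_upwards [hL, hU] with ω hL hU
  have hL2 := (hL.comp tendsto_sparseIndex).mul tendsto_mul_log_div_sparse
  have hU2 := (hU.comp tendsto_sparseIndex).mul tendsto_mul_log_div_sparse
  rw [mul_one] at hL2 hU2
  have hev : ∀ᶠ n : ℕ in atTop, 0 < n ∧ 0 < (sparseIndex n : ℝ) ^ (2 / 3 : ℝ) ∧ 0 < Real.log n :=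
    (eventually_gt_atTop 0).and (((tendsto_rpow_two_thirds.comp
      tendsto_sparseIndex).eventually_gt_atTop 0).and
      ((Real.tendsto_log_atTop.comp tendsto_natCast_atTop_atTop).eventually_gt_atTop 0))
  refine tendsto_of_tendsto_of_tendsto_of_le_of_le' hL2 hU2 ?_ ?_
  all_goals
    filter_upwards [hev] with n hn
    obtain ⟨hn0, hn1, hn2⟩ := hn
    have hb := sparse_pos (sparseIndex n)
    have hn0' : (0 : ℝ) < n := by exact_mod_cast hn0
    have b1 := sparse_sparseIndex_le hn0
    have b2 := le_sparse_sparseIndex_succ hn0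
    simp only [Function.comp]
    rw [div_mul_div_cancel₀ (by positivity)]
    refine div_le_div_of_nonneg_right (selfMeet_mono ζ ?_ ?_ ω) (by positivity)
  · exact (Nat.floor_le_floor (by nlinarith)).trans (Nat.floor_le_ceil _)
  · exact Nat.floor_le_floor (by nlinarith)
  · exact Nat.floor_le_floor (by nlinarith)
  · exact (Nat.floor_le_floor (by nlinarith)).trans (Nat.floor_le_ceil _)

end PlanarWalk

end

section
/-! ### Occupation counts of a deterministic sequence -/

namespace PlanarWalk

variable {ι : Type*} [DecidableEq ι]

/-- The number of times in `[p, q)` at which `z` is at `l`. -/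
def occupation (z : ℕ → ι) (p q : ℕ) (l : ι) : ℝ :=
  ∑ k ∈ Finset.Ico p q, if z k = l then 1 else 0

/-- The number of pairs of times in `[p, q)` at which `z` takes the same value. -/
def coincidences (z : ℕ → ι) (p q : ℕ) : ℝ :=
  ∑ i ∈ Finset.Ico p q, ∑ j ∈ Finset.Ico p q, if z i = z j then 1 else 0

theorem occupation_nonneg (z : ℕ → ι) (p q : ℕ) (l : ι) : 0 ≤ occupation z p q l :=
  Finset.sum_nonneg fun k _ => by split_ifs <;> norm_num

theorem sum_comp_eq_sum_occupation_mul (z : ℕ → ι) {p q : ℕ} {s : Finset ι}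
    (hs : ∀ k ∈ Finset.Ico p q, z k ∈ s) (ξ : ι → ℝ) :
    ∑ k ∈ Finset.Ico p q, ξ (z k) = ∑ l ∈ s, occupation z p q l * ξ l := by
  simp_rw [occupation, Finset.sum_mul]
  rw [Finset.sum_comm]
  refine Finset.sum_congr rfl fun k hk => ?_
  simp [hs k hk]

theorem sum_occupation_sq (z : ℕ → ι) {p q : ℕ} {s : Finset ι}
    (hs : ∀ k ∈ Finset.Ico p q, z k ∈ s) :
    ∑ l ∈ s, occupation z p q l ^ 2 = coincidences z p q := by
  have h := sum_comp_eq_sum_occupation_mul z hs (occupation z p q)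
  simp_rw [pow_two]
  rw [← h]
  simp only [occupation, coincidences]
  refine Finset.sum_congr rfl fun i _ => Finset.sum_congr rfl fun j _ => ?_
  simp only [eq_comm]

/-- The time `⌊n j / m⌋`. -/
def gridTime (n m j : ℕ) : ℕ := ⌊(n : ℝ) * ((j : ℝ) / m)⌋₊

theorem gridTime_zero (n m : ℕ) : gridTime n m 0 = 0 := by simp [gridTime]

theorem gridTime_self (n : ℕ) {m : ℕ} (hm : 0 < m) : gridTime n m m = n := by
  have : (m : ℝ) ≠ 0 := by positivity
  simp [gridTime, div_self this]

theorem gridTime_mono (n m : ℕ) : Monotone (gridTime n m) := fun i j hij => by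
  unfold gridTime
  have : (i : ℝ) ≤ j := by exact_mod_cast hij
  gcongr

theorem gridTime_le (n : ℕ) {m j : ℕ} (hm : 0 < m) (hj : j ≤ m) : gridTime n m j ≤ n := by
  conv_rhs => rw [← gridTime_self n hm]
  exact gridTime_mono n m hj

/-- The occupation count of the `j`-th of `m` blocks of `[0, n)`. -/
def blockOccupation (z : ℕ → ι) (n m j : ℕ) (l : ι) : ℝ :=
  occupation z (gridTime n m j) (gridTime n m (j + 1)) l

theorem blockOccupation_nonneg (z : ℕ → ι) (n m j : ℕ) (l : ι) : 0 ≤ blockOccupation z n m j l :=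
  occupation_nonneg _ _ _ _

theorem sum_blockOccupation (z : ℕ → ι) (n : ℕ) {m : ℕ} (hm : 0 < m) (l : ι) :
    ∑ j ∈ Finset.range m, blockOccupation z n m j l = occupation z 0 n l := by
  have : ∀ i, ∑ j ∈ Finset.range i, blockOccupation z n m j l =
      occupation z 0 (gridTime n m i) l := by
    intro i
    induction i with
    | zero => simp [gridTime_zero, occupation]
    | succ i ih =>
      rw [Finset.sum_range_succ, ih]
      exact Finset.sum_Ico_consecutive _ (Nat.zero_le _) (gridTime_mono n m (Nat.le_succ i))
  rw [this, gridTime_self n hm]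

/-- The mutual coincidences of two blocks. -/
def blockOverlap (z : ℕ → ι) (n m j j' : ℕ) : ℝ :=
  ∑ l ∈ (Finset.range n).image z, blockOccupation z n m j l * blockOccupation z n m j' l

theorem blockOverlap_nonneg (z : ℕ → ι) (n m j j' : ℕ) : 0 ≤ blockOverlap z n m j j' :=
  Finset.sum_nonneg fun _ _ => mul_nonneg (blockOccupation_nonneg _ _ _ _ _)
    (blockOccupation_nonneg _ _ _ _ _)

theorem mem_image_of_mem_block (z : ℕ → ι) (n : ℕ) {m j : ℕ} (hm : 0 < m) (hj : j < m) :
    ∀ k ∈ Finset.Ico (gridTime n m j) (gridTime n m (j + 1)), z k ∈ (Finset.range n).image z := by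
  intro k hk
  refine Finset.mem_image_of_mem z (Finset.mem_range.2 ?_)
  exact (Finset.mem_Ico.1 hk).2.trans_le (gridTime_le n hm hj)

theorem blockOverlap_self (z : ℕ → ι) (n : ℕ) {m j : ℕ} (hm : 0 < m) (hj : j < m) :
    blockOverlap z n m j j = coincidences z (gridTime n m j) (gridTime n m (j + 1)) := by
  rw [← sum_occupation_sq z (mem_image_of_mem_block z n hm hj), blockOverlap]
  simp_rw [pow_two]
  rfl

theorem sum_blockOverlap (z : ℕ → ι) (n : ℕ) {m : ℕ} (hm : 0 < m) :
    ∑ j ∈ Finset.range m, ∑ j' ∈ Finset.range m, blockOverlap z n m j j' = coincidences z 0 n := by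
  rw [← sum_occupation_sq z (s := (Finset.range n).image z)
    (fun k hk => Finset.mem_image_of_mem z (by simpa using hk))]
  simp_rw [← sum_blockOccupation z n hm, pow_two, Finset.sum_mul_sum, blockOverlap]
  conv_rhs => rw [Finset.sum_comm]
  refine Finset.sum_congr rfl fun j _ => ?_
  conv_rhs => rw [Finset.sum_comm]

/-- The overlaps of distinct blocks. -/
def offOverlap (z : ℕ → ι) (n m : ℕ) : ℝ :=
  ∑ j ∈ Finset.range m, ∑ j' ∈ (Finset.range m).erase j, blockOverlap z n m j j'

theorem blockOverlap_le_offOverlap (z : ℕ → ι) (n : ℕ) {m j j' : ℕ} (hj : j < m) (hj' : j' < m)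
    (hne : j' ≠ j) : blockOverlap z n m j j' ≤ offOverlap z n m :=
  (Finset.single_le_sum (f := fun j' => blockOverlap z n m j j')
    (fun i _ => blockOverlap_nonneg z n m j i)
    (Finset.mem_erase.2 ⟨hne, Finset.mem_range.2 hj'⟩)).trans
  (Finset.single_le_sum (f := fun j => ∑ j' ∈ (Finset.range m).erase j, blockOverlap z n m j j')
    (fun i _ => Finset.sum_nonneg fun k _ => blockOverlap_nonneg z n m i k)
    (Finset.mem_range.2 hj))

theorem coincidences_eq_add_offOverlap (z : ℕ → ι) (n : ℕ) {m : ℕ} (hm : 0 < m) :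
    coincidences z 0 n = ∑ j ∈ Finset.range m, blockOverlap z n m j j + offOverlap z n m := by
  rw [← sum_blockOverlap z n hm, offOverlap, ← Finset.sum_add_distrib]
  refine Finset.sum_congr rfl fun j hj => ?_
  rw [Finset.add_sum_erase _ _ hj]

/-- Bounding the square by the total number of coincidences would be too weak by a factor m. Instead
the count is squared as a sum over blocks. In the diagonal part one square, that of the fullest
block, is kept, and every other square is at most its product with the fullest block, an overlap of
distinct blocks. The off-diagonal part consists of such overlaps as well. -/
theorem occupation_sq_le (z : ℕ → ι) (n : ℕ) {m : ℕ} (hm : 0 < m) {l : ι}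
    (hl : l ∈ (Finset.range n).image z) {B : ℝ}
    (hB : ∀ j < m, blockOverlap z n m j j ≤ B) :
    occupation z 0 n l ^ 2 ≤ B + 2 * offOverlap z n m := by
  set o : ℕ → ℝ := fun j => blockOccupation z n m j l with ho
  have ho0 : ∀ j, 0 ≤ o j := fun j => blockOccupation_nonneg z n m j l
  have hle : ∀ j j', o j * o j' ≤ blockOverlap z n m j j' := fun j j' =>
    Finset.single_le_sum (f := fun l => blockOccupation z n m j l * blockOccupation z n m j' l)
      (fun i _ => mul_nonneg (blockOccupation_nonneg _ _ _ _ _) (blockOccupation_nonneg _ _ _ _ _)) hl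
  obtain ⟨J, hJ, hmax⟩ := Finset.exists_max_image (Finset.range m) o
    ⟨0, Finset.mem_range.2 hm⟩
  have hsq : ∑ j ∈ Finset.range m, o j * o j ≤ B + offOverlap z n m := by
    rw [← Finset.add_sum_erase _ _ hJ]
    refine add_le_add ((hle J J).trans (hB J (Finset.mem_range.1 hJ))) ?_
    calc ∑ j ∈ (Finset.range m).erase J, o j * o j
        ≤ ∑ j ∈ (Finset.range m).erase J, blockOverlap z n m J j := by
          refine Finset.sum_le_sum fun j hj => ?_
          exact (mul_le_mul_of_nonneg_right (hmax j (Finset.mem_of_mem_erase hj)) (ho0 j)).trans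
            (hle J j)
      _ ≤ offOverlap z n m := Finset.single_le_sum
          (f := fun j => ∑ j' ∈ (Finset.range m).erase j, blockOverlap z n m j j')
          (fun i _ => Finset.sum_nonneg fun k _ => blockOverlap_nonneg z n m i k) hJ
  rw [← sum_blockOccupation z n hm, pow_two, Finset.sum_mul_sum]
  have : ∀ j ∈ Finset.range m, ∑ j' ∈ Finset.range m, o j * o j' =
      o j * o j + ∑ j' ∈ (Finset.range m).erase j, o j * o j' := fun j hj =>
    (Finset.add_sum_erase _ _ hj).symm
  rw [Finset.sum_congr rfl this, Finset.sum_add_distrib, two_mul, ← add_assoc]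
  refine add_le_add hsq ?_
  exact Finset.sum_le_sum fun j _ => Finset.sum_le_sum fun j' _ => hle j j'

/-- Every one of `m` equal blocks of `[0, n)` has asymptotically its share of a total of
`v n log n` coincidences. -/
structure HasUniformCoincidences (z : ℕ → ι) (v : ℝ) : Prop where
  total : Tendsto (fun n : ℕ => coincidences z 0 n / (n * Real.log n)) atTop (𝓝 v)
  block : ∀ m j : ℕ, j < m → Tendsto (fun n : ℕ =>
    coincidences z (gridTime n m j) (gridTime n m (j + 1)) / (n * Real.log n)) atTop (𝓝 (v / m))

theorem HasUniformCoincidences.tendsto_blockOverlap_self {z : ℕ → ι} {v : ℝ}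
    (hz : HasUniformCoincidences z v) {m j : ℕ} (hj : j < m) :
    Tendsto (fun n : ℕ => blockOverlap z n m j j / (n * Real.log n)) atTop (𝓝 (v / m)) :=
  (hz.block m j hj).congr fun n => by rw [blockOverlap_self z n (by omega) hj]

theorem mul_log_nonneg (n : ℕ) : 0 ≤ (n : ℝ) * Real.log n :=
  mul_nonneg (Nat.cast_nonneg n) (Real.log_natCast_nonneg n)

/-- The m blocks together already account for m · (v/m) = v, the limit of the total, so nothing is
left for pairs of times in distinct blocks. -/
theorem HasUniformCoincidences.tendsto_offOverlap {z : ℕ → ι} {v : ℝ}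
    (hz : HasUniformCoincidences z v) {m : ℕ} (hm : 0 < m) :
    Tendsto (fun n : ℕ => offOverlap z n m / (n * Real.log n)) atTop (𝓝 0) := by
  have h1 := hz.total.sub (tendsto_finsetSum (Finset.range m) fun j hj =>
    hz.tendsto_blockOverlap_self (Finset.mem_range.1 hj))
  have e : v - ∑ _j ∈ Finset.range m, v / m = 0 := by
    have : (m : ℝ) ≠ 0 := by positivity
    rw [Finset.sum_const, Finset.card_range, nsmul_eq_mul, mul_div_cancel₀ _ this, sub_self]
  rw [e] at h1
  refine h1.congr fun n => ?_
  rw [coincidences_eq_add_offOverlap z n hm, ← Finset.sum_div]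
  ring

theorem HasUniformCoincidences.tendsto_blockOverlap_of_ne {z : ℕ → ι} {v : ℝ}
    (hz : HasUniformCoincidences z v) {m j j' : ℕ} (hj : j < m) (hj' : j' < m) (hne : j' ≠ j) :
    Tendsto (fun n : ℕ => blockOverlap z n m j j' / (n * Real.log n)) atTop (𝓝 0) := by
  refine squeeze_zero (fun n => div_nonneg (blockOverlap_nonneg _ _ _ _ _) (mul_log_nonneg n))
    (fun n => ?_) (hz.tendsto_offOverlap (m := m) (by omega))
  exact div_le_div_of_nonneg_right (blockOverlap_le_offOverlap z n hj hj' hne) (mul_log_nonneg n)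

/-- The quadratic form of the block overlaps is asymptotically diagonal. -/
theorem HasUniformCoincidences.tendsto_sum_sq {z : ℕ → ι} {v : ℝ}
    (hz : HasUniformCoincidences z v) (m : ℕ) (a : ℕ → ℝ) :
    Tendsto (fun n : ℕ => ∑ l ∈ (Finset.range n).image z,
      ((∑ j ∈ Finset.range m, a j * blockOccupation z n m j l) / √(n * Real.log n)) ^ 2) atTop
      (𝓝 (∑ j ∈ Finset.range m, a j ^ 2 * (v / m))) := by
  have h1 : Tendsto (fun n : ℕ => ∑ j ∈ Finset.range m, ∑ j' ∈ Finset.range m,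
      a j * a j' * (blockOverlap z n m j j' / (n * Real.log n))) atTop
      (𝓝 (∑ j ∈ Finset.range m, ∑ j' ∈ Finset.range m,
        a j * a j' * (if j' = j then v / m else 0))) := by
    refine tendsto_finsetSum _ fun j hj => tendsto_finsetSum _ fun j' hj' => ?_
    refine Tendsto.const_mul _ ?_
    rw [Finset.mem_range] at hj hj'
    split_ifs with h
    · subst h; exact hz.tendsto_blockOverlap_self hj
    · exact hz.tendsto_blockOverlap_of_ne hj hj' h
  have e : ∑ j ∈ Finset.range m, ∑ j' ∈ Finset.range m,
      a j * a j' * (if j' = j then v / m else 0) = ∑ j ∈ Finset.range m, a j ^ 2 * (v / m) := by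
    refine Finset.sum_congr rfl fun j hj => ?_
    rw [Finset.sum_eq_single j]
    · rw [if_pos rfl]; ring
    · intro b _ hb; rw [if_neg hb, mul_zero]
    · intro h; exact absurd hj h
  rw [e] at h1
  refine h1.congr fun n => ?_
  have e2 : ∀ l, ((∑ j ∈ Finset.range m, a j * blockOccupation z n m j l) /
      √(n * Real.log n)) ^ 2 = ∑ j ∈ Finset.range m, ∑ j' ∈ Finset.range m, a j * a j' *
        (blockOccupation z n m j l * blockOccupation z n m j' l / (n * Real.log n)) := by
    intro l
    rw [div_pow, Real.sq_sqrt (mul_log_nonneg n), pow_two, Finset.sum_mul_sum, Finset.sum_div]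
    refine Finset.sum_congr rfl fun j _ => ?_
    rw [Finset.sum_div]
    refine Finset.sum_congr rfl fun j' _ => ?_
    ring
  simp_rw [e2]
  conv_rhs => rw [Finset.sum_comm]
  refine Finset.sum_congr rfl fun j _ => ?_
  conv_rhs => rw [Finset.sum_comm]
  refine Finset.sum_congr rfl fun j' _ => ?_
  rw [← Finset.mul_sum, ← Finset.sum_div, blockOverlap]

/-- No single point carries a positive proportion of `√(n log n)`. -/
theorem HasUniformCoincidences.eventually_occupation_le {z : ℕ → ι} {v : ℝ}
    (hz : HasUniformCoincidences z v) {ε : ℝ} (hε : 0 < ε) :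
    ∀ᶠ n : ℕ in atTop, ∀ l ∈ (Finset.range n).image z,
      occupation z 0 n l ≤ ε * √(n * Real.log n) := by
  -- With v/m < ε²/4, one block contributes less than ε²/4, and twice the off-diagonal part is
  -- eventually below ε²/2.
  obtain ⟨m, hm⟩ := exists_nat_gt (max 1 (v / (ε ^ 2 / 4)))
  have hm1 : (1 : ℝ) < m := (le_max_left _ _).trans_lt hm
  have hm0 : 0 < m := by exact_mod_cast (zero_lt_one.trans hm1)
  have hm2 : v / m < ε ^ 2 / 4 := by
    have := (le_max_right 1 (v / (ε ^ 2 / 4))).trans_lt hm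
    rw [div_lt_iff₀ (by positivity)] at this ⊢
    linarith
  have h1 : ∀ᶠ n : ℕ in atTop, ∀ j ∈ Finset.range m,
      blockOverlap z n m j j / (n * Real.log n) < ε ^ 2 / 4 := by
    rw [Filter.eventually_all_finset]
    intro j hj
    exact (hz.tendsto_blockOverlap_self (Finset.mem_range.1 hj)).eventually_lt_const hm2
  have h2 := (hz.tendsto_offOverlap hm0).eventually_lt_const (by positivity : 0 < ε ^ 2 / 4)
  have hlog : ∀ᶠ n : ℕ in atTop, 0 < (n : ℝ) * Real.log n := by
    filter_upwards [eventually_gt_atTop 1] with n hn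
    have : (1 : ℝ) < n := by exact_mod_cast hn
    exact mul_pos (by linarith) (Real.log_pos this)
  filter_upwards [h1, h2, hlog] with n h1 h2 hn l hl
  have h3 := occupation_sq_le z n hm0 hl (B := ε ^ 2 / 4 * (n * Real.log n)) fun j hj => by
    have := h1 j (Finset.mem_range.2 hj)
    rw [div_lt_iff₀ hn] at this
    exact this.le
  rw [div_lt_iff₀ hn] at h2
  refine le_of_sq_le_sq ?_ (by positivity)
  rw [mul_pow, Real.sq_sqrt hn.le]
  nlinarith

end PlanarWalk

end

section
/-! ### The central limit theorem for weighted sums -/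

namespace PlanarWalk

theorem norm_prod_sub_prod_le_sum {ι : Type*} (s : Finset ι) {f g : ι → ℂ}
    (hf : ∀ i ∈ s, ‖f i‖ ≤ 1) (hg : ∀ i ∈ s, ‖g i‖ ≤ 1) :
    ‖∏ i ∈ s, f i - ∏ i ∈ s, g i‖ ≤ ∑ i ∈ s, ‖f i - g i‖ := by
  classical
  induction s using Finset.induction_on with
  | empty => simp
  | insert a s ha ih =>
    rw [Finset.prod_insert ha, Finset.prod_insert ha, Finset.sum_insert ha]
    have ih := ih (fun i hi => hf i (Finset.mem_insert_of_mem hi))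
      fun i hi => hg i (Finset.mem_insert_of_mem hi)
    have h1 : ‖∏ i ∈ s, f i‖ ≤ 1 := by
      rw [norm_prod]
      exact Finset.prod_le_one (fun i _ => norm_nonneg _)
        fun i hi => hf i (Finset.mem_insert_of_mem hi)
    have e : f a * ∏ i ∈ s, f i - g a * ∏ i ∈ s, g i =
        (f a - g a) * ∏ i ∈ s, f i + g a * (∏ i ∈ s, f i - ∏ i ∈ s, g i) := by ring
    rw [e]
    refine (norm_add_le _ _).trans (add_le_add ?_ ?_)
    · rw [norm_mul]; exact mul_le_of_le_one_right (norm_nonneg _) h1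
    · rw [norm_mul]
      exact (mul_le_of_le_one_left (norm_nonneg _) (hg a (Finset.mem_insert_self a s))).trans ih

variable {E : Type*} [MeasurableSpace E] {μ : Measure E}

/-- The comparison is with the Gaussian rather than with the Taylor polynomial because replacing the
factors of a product one at a time requires all of them to have modulus at most 1. -/
theorem charFun_sub_exp_isLittleO [IsProbabilityMeasure μ] {X : E → ℝ} (hX : AEMeasurable X μ) (h0 : ∫ x, X x ∂μ = 0)
    (h1 : ∫ x, X x ^ 2 ∂μ = 1) :
    (fun t : ℝ => charFun (μ.map X) t - Complex.exp (-(t ^ 2 / 2 : ℝ))) =o[𝓝 0]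
      fun t : ℝ => t ^ 2 := by
  have e1 := taylor_charFun_two hX h0 h1
  have e2 : (fun t : ℝ => (Real.exp (-(t ^ 2 / 2)) - 1 - -(t ^ 2 / 2) : ℝ)) =o[𝓝 0]
      fun t : ℝ => t ^ 2 := by
    rw [Asymptotics.isLittleO_iff]
    intro c hc
    have hev : ∀ᶠ t : ℝ in 𝓝 0, t ^ 2 < min c 1 := by
      have : Tendsto (fun t : ℝ => t ^ 2) (𝓝 0) (𝓝 0) := by
        simpa using (continuous_pow 2).tendsto (0 : ℝ)
      exact this.eventually_lt_const (by positivity)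
    filter_upwards [hev] with t ht
    have hc1 := ht.trans_le (min_le_left c 1)
    have hc2 := ht.trans_le (min_le_right c 1)
    have h := Real.abs_exp_sub_one_sub_id_le (x := -(t ^ 2 / 2)) (by
      rw [abs_neg, abs_of_nonneg (by positivity)]; linarith)
    rw [Real.norm_eq_abs, Real.norm_of_nonneg (sq_nonneg t)]
    refine h.trans ?_
    nlinarith [sq_nonneg t]
  have e3 : (fun t : ℝ => ((Real.exp (-(t ^ 2 / 2)) - 1 - -(t ^ 2 / 2) : ℝ) : ℂ)) =o[𝓝 0]
      fun t : ℝ => t ^ 2 := by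
    rw [← Asymptotics.isLittleO_norm_left]
    simpa only [Complex.norm_real, Asymptotics.isLittleO_norm_left] using e2
  refine (e1.sub e3).congr_left fun t => ?_
  push_cast
  ring

/-- The central limit theorem for weighted sums, in terms of characteristic functions. -/
theorem tendsto_prod_charFun [IsProbabilityMeasure μ] {ι : Type*} {X : E → ℝ} (hX : AEMeasurable X μ)
    (h0 : ∫ x, X x ∂μ = 0) (h1 : ∫ x, X x ^ 2 ∂μ = 1) {s : ℕ → Finset ι} {w : ℕ → ι → ℝ} {v : ℝ}
    (hv : Tendsto (fun n => ∑ l ∈ s n, w n l ^ 2) atTop (𝓝 v))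
    (hw : ∀ ε > 0, ∀ᶠ n in atTop, ∀ l ∈ s n, |w n l| ≤ ε) :
    Tendsto (fun n => ∏ l ∈ s n, charFun (μ.map X) (w n l)) atTop
      (𝓝 (Complex.exp (-(v / 2 : ℝ)))) := by
  have hprob : IsProbabilityMeasure (μ.map X) := Measure.isProbabilityMeasure_map hX
  have hG : Tendsto (fun n => Complex.exp (-((∑ l ∈ s n, w n l ^ 2) / 2 : ℝ))) atTop
      (𝓝 (Complex.exp (-(v / 2 : ℝ)))) := by
    refine (Complex.continuous_exp.tendsto _).comp ?_
    exact ((Complex.continuous_ofReal.tendsto _).comp (hv.div_const 2)).neg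
  have hdiff : Tendsto (fun n => ∏ l ∈ s n, charFun (μ.map X) (w n l) -
      Complex.exp (-((∑ l ∈ s n, w n l ^ 2) / 2 : ℝ))) atTop (𝓝 0) := by
    rw [Metric.tendsto_nhds]
    intro ε hε
    set δ : ℝ := ε / (|v| + 2) with hδ
    have hδ0 : 0 < δ := by positivity
    have ho := (Asymptotics.isLittleO_iff.1 (charFun_sub_exp_isLittleO hX h0 h1)) hδ0
    obtain ⟨r, hr, hball⟩ := Metric.eventually_nhds_iff.1 ho
    have hvlt : ∀ᶠ n in atTop, ∑ l ∈ s n, w n l ^ 2 < |v| + 1 :=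
      hv.eventually_lt_const (by linarith [le_abs_self v])
    filter_upwards [hw (r / 2) (by positivity), hvlt] with n hn hvn
    rw [dist_zero_right]
    have e : Complex.exp (-((∑ l ∈ s n, w n l ^ 2) / 2 : ℝ)) =
        ∏ l ∈ s n, Complex.exp (-(w n l ^ 2 / 2 : ℝ)) := by
      rw [← Complex.exp_sum, Finset.sum_neg_distrib, ← Complex.ofReal_sum, Finset.sum_div]
    rw [e]
    have hb := norm_prod_sub_prod_le_sum (s n) (f := fun l => charFun (μ.map X) (w n l))
      (g := fun l => Complex.exp (-(w n l ^ 2 / 2 : ℝ))) (fun l _ => norm_charFun_le_one _)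
      (fun l _ => by
        rw [← Complex.ofReal_neg, ← Complex.ofReal_exp, Complex.norm_real,
          Real.norm_of_nonneg (Real.exp_pos _).le]
        exact Real.exp_le_one_iff.2 (by simp; positivity))
    refine hb.trans_lt ?_
    calc _ ≤ ∑ l ∈ s n, δ * w n l ^ 2 := by
          refine Finset.sum_le_sum fun l hl => ?_
          have := hball (y := w n l) (by
            rw [Real.dist_eq, sub_zero]; linarith [hn l hl])
          rwa [Real.norm_of_nonneg (sq_nonneg (w n l))] at this
      _ = δ * ∑ l ∈ s n, w n l ^ 2 := by rw [Finset.mul_sum]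
      _ ≤ δ * (|v| + 1) := mul_le_mul_of_nonneg_left hvn.le hδ0.le
      _ < ε := by
          rw [hδ, div_mul_eq_mul_div, div_lt_iff₀ (by positivity)]
          nlinarith [abs_nonneg v]
  have := hdiff.add hG
  rw [zero_add] at this
  exact this.congr fun n => by ring

/-- A scenery: i.i.d. centered random variables with unit variance. -/
structure IsScenery {ι : Type*} (μ : Measure E) (X : ι → E → ℝ) : Prop where
  measurable : ∀ l, Measurable (X l)
  indep : iIndepFun X μ
  mean : ∀ l, ∫ x, X l x ∂μ = 0
  memLp : ∀ l, MemLp (X l) 2 μ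
  sq : ∀ l, ∫ x, X l x ^ 2 ∂μ = 1
  map_eq : ∀ l l', μ.map (X l) = μ.map (X l')

theorem IsScenery.integral_exp_sum {ι : Type*} {X : ι → E → ℝ} (hX : IsScenery μ X) (l₀ : ι)
    (s : Finset ι) (w : ι → ℝ) :
    ∫ x, Complex.exp ((∑ l ∈ s, w l * X l x : ℝ) * Complex.I) ∂μ =
      ∏ l ∈ s, charFun (μ.map (X l₀)) (w l) := by
  have e : ∀ x, Complex.exp ((∑ l ∈ s, w l * X l x : ℝ) * Complex.I) =
      ∏ l : s, Complex.exp (w l * X l x * Complex.I) := by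
    intro x
    rw [Finset.prod_coe_sort s (fun l => Complex.exp (w l * X l x * Complex.I)), ← Complex.exp_sum,
      Complex.ofReal_sum, Finset.sum_mul]
    push_cast
    rfl
  simp_rw [e]
  have hind : iIndepFun (fun l : s => X l) μ := hX.indep.precomp Subtype.val_injective
  have := hind.integral_fun_prod_comp (𝕜 := ℂ)
    (f := fun (l : s) (y : ℝ) => Complex.exp (w l * y * Complex.I))
    (fun l => (hX.measurable l).aemeasurable)
    (fun l => Continuous.aestronglyMeasurable (by fun_prop))
  rw [this, ← Finset.prod_coe_sort s]
  refine Finset.prod_congr rfl fun l _ => ?_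
  rw [hX.map_eq l₀ l, charFun_apply_real, integral_map (hX.measurable l).aemeasurable
    (Continuous.aestronglyMeasurable (by fun_prop))]

theorem IsScenery.integral_sum_sq {ι : Type*} {X : ι → E → ℝ} (hX : IsScenery μ X)
    (s : Finset ι) (w : ι → ℝ) :
    ∫ x, (∑ l ∈ s, w l * X l x) ^ 2 ∂μ = ∑ l ∈ s, w l ^ 2 := by
  classical
  have hint : ∀ l l', Integrable (fun x => w l * X l x * (w l' * X l' x)) μ := fun l l' =>
    ((hX.memLp l).const_mul _).integrable_mul ((hX.memLp l').const_mul _)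
  simp_rw [pow_two, Finset.sum_mul_sum]
  rw [integral_finsetSum _ fun l _ => integrable_finsetSum _ fun l' _ => hint l l']
  refine Finset.sum_congr rfl fun l hl => ?_
  rw [integral_finsetSum _ fun l' _ => hint l l', Finset.sum_eq_single l]
  · have e : (fun x => w l * X l x * (w l * X l x)) = fun x => (w l * w l) * X l x ^ 2 := by
      funext x; ring
    rw [e, integral_const_mul, hX.sq, mul_one]
  · intro l' _ hne
    have e : (fun x => w l * X l x * (w l' * X l' x)) = fun x => (w l * w l') * (X l x * X l' x) := by
      funext x; ring
    rw [e, integral_const_mul, (hX.indep.indepFun hne.symm).integral_fun_mul_eq_mul_integral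
      (hX.measurable l).aestronglyMeasurable (hX.measurable l').aestronglyMeasurable, hX.mean]
    simp
  · intro h; exact absurd hl h

end PlanarWalk

end

section
/-! ### A maximal inequality for sums of the scenery along a path -/

namespace PlanarWalk

variable {ι : Type*}

/-- The sum of `ξ` along the first `k` points of `z`. -/
def pathSum (z : ℕ → ι) (k : ℕ) (ξ : ι → ℝ) : ℝ := ∑ j ∈ Finset.range k, ξ (z j)

/-- The sceneries whose sums along `z` reach the level `a` by time `k`. -/
def reaches (z : ℕ → ι) (a : ℝ) (k : ℕ) : Set (ι → ℝ) := {ξ | ∃ i ≤ k, a ≤ pathSum z i ξ}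

theorem pathSum_succ (z : ℕ → ι) (k : ℕ) (ξ : ι → ℝ) :
    pathSum z (k + 1) ξ = pathSum z k ξ + ξ (z k) := Finset.sum_range_succ _ _

theorem pathSum_mono (z : ℕ → ι) (k : ℕ) {ξ η : ι → ℝ} (h : ξ ≤ η) :
    pathSum z k ξ ≤ pathSum z k η := Finset.sum_le_sum fun _ _ => h _

/-- Reaching a level is an increasing event in the scenery; this is the source of the positive
correlation below. -/
theorem reaches_of_le {z : ℕ → ι} {a : ℝ} {k : ℕ} {ξ η : ι → ℝ} (h : ξ ≤ η)
    (hξ : ξ ∈ reaches z a k) : η ∈ reaches z a k := by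
  obtain ⟨i, hi, h1⟩ := hξ
  exact ⟨i, hi, h1.trans (pathSum_mono z i h)⟩

theorem measurableSet_reaches {β : Type*} [MeasurableSpace β] (z : ℕ → ι) (a : ℝ) (k : ℕ)
    {F : β → ι → ℝ} (hF : ∀ l, Measurable fun b => F b l) :
    MeasurableSet {b | F b ∈ reaches z a k} := by
  have e : {b | F b ∈ reaches z a k} =
      ⋃ i ∈ Finset.range (k + 1), {b | a ≤ pathSum z i (F b)} := by
    ext b
    simp [reaches]
  rw [e]
  refine Finset.measurableSet_biUnion _ fun i _ => measurableSet_le measurable_const ?_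
  exact Finset.measurable_fun_sum _ fun j _ => hF _

variable {E : Type*} {X : ι → E → ℝ}

/-- The indicator that the sums of the scenery along `z` reach the level `a` by time `k`. -/
def reachIndicator (X : ι → E → ℝ) (z : ℕ → ι) (a : ℝ) (k : ℕ) : E → ℝ :=
  {x | (fun l => X l x) ∈ reaches z a k}.indicator 1

theorem reachIndicator_of_mem {X : ι → E → ℝ} {z : ℕ → ι} {a : ℝ} {k : ℕ} {x : E}
    (h : (fun l => X l x) ∈ reaches z a k) : reachIndicator X z a k x = 1 :=
  Set.indicator_of_mem (s := {x | (fun l => X l x) ∈ reaches z a k}) h _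

theorem reachIndicator_of_notMem {X : ι → E → ℝ} {z : ℕ → ι} {a : ℝ} {k : ℕ} {x : E}
    (h : (fun l => X l x) ∉ reaches z a k) : reachIndicator X z a k x = 0 :=
  Set.indicator_of_notMem (s := {x | (fun l => X l x) ∈ reaches z a k}) h _

theorem reachIndicator_nonneg (X : ι → E → ℝ) (z : ℕ → ι) (a : ℝ) (k : ℕ) (x : E) :
    0 ≤ reachIndicator X z a k x := by
  classical
  rw [reachIndicator, Set.indicator_apply]; split_ifs <;> simp

theorem reachIndicator_le_one (X : ι → E → ℝ) (z : ℕ → ι) (a : ℝ) (k : ℕ) (x : E) :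
    reachIndicator X z a k x ≤ 1 := by
  classical
  rw [reachIndicator, Set.indicator_apply]; split_ifs <;> simp

variable [MeasurableSpace E] {μ : Measure E}

theorem IsScenery.neg (hX : IsScenery μ X) : IsScenery μ fun l x => -X l x where
  measurable l := (hX.measurable l).neg
  indep := hX.indep.comp (fun _ y => -y) fun _ => measurable_neg
  mean l := by rw [integral_neg, hX.mean, neg_zero]
  memLp l := (hX.memLp l).neg
  sq l := by simpa using hX.sq l
  map_eq l l' := by
    have h : ∀ l, μ.map (fun x => -X l x) = (μ.map (X l)).map fun y => -y := fun l => by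
      rw [Measure.map_map measurable_neg (hX.measurable l)]; rfl
    rw [h, h, hX.map_eq l l']

theorem IsScenery.measurable_pathSum (hX : IsScenery μ X) (z : ℕ → ι) (k : ℕ) :
    Measurable fun x => pathSum z k fun l => X l x :=
  Finset.measurable_fun_sum _ fun _ _ => hX.measurable _

theorem IsScenery.memLp_pathSum (hX : IsScenery μ X) (z : ℕ → ι) (k : ℕ) :
    MemLp (fun x => pathSum z k fun l => X l x) 2 μ :=
  memLp_finsetSum _ fun _ _ => hX.memLp _

theorem IsScenery.measurable_reachIndicator (hX : IsScenery μ X) (z : ℕ → ι) (a : ℝ) (k : ℕ) :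
    Measurable (reachIndicator X z a k) :=
  measurable_one.indicator (measurableSet_reaches z a k hX.measurable)

theorem IsScenery.integrable_mul_reachIndicator (hX : IsScenery μ X) (z : ℕ → ι)
    (a : ℝ) (k : ℕ) {f : E → ℝ} (hf : Integrable f μ) :
    Integrable (fun x => f x * reachIndicator X z a k x) μ :=
  hf.mul_bdd (c := 1) (hX.measurable_reachIndicator z a k).aestronglyMeasurable
    (Eventually.of_forall fun x => by
      rw [Real.norm_of_nonneg (reachIndicator_nonneg X z a k x)]
      exact reachIndicator_le_one X z a k x)

/-- If the value at l is set to 0, the event becomes independent of X l and the integral vanishes.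
Restoring X l enlarges the event where X l ≥ 0 and shrinks it where X l ≤ 0, so the integrand can
only grow. This replaces the martingale property, which fails as soon as the path revisits a site.
-/
theorem IsScenery.integral_mul_reachIndicator_nonneg [IsProbabilityMeasure μ] (hX : IsScenery μ X)
    (z : ℕ → ι) (a : ℝ) (k : ℕ) (l : ι) : 0 ≤ ∫ x, X l x * reachIndicator X z a k x ∂μ := by
  classical
  -- The visited sites other than l. Extending a configuration on T by zero has the effect of
  -- setting X l to 0 in all partial sums up to time k.
  set T : Finset ι := ((Finset.range k).image z).erase l with hT
  let ext (y : T → ℝ) (i : ι) : ℝ := if h : i ∈ T then y ⟨i, h⟩ else 0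
  let G (y : T → ℝ) : ℝ := {y | ext y ∈ reaches z a k}.indicator 1 y
  have hext : ∀ i, Measurable fun y => ext y i := fun i => by
    by_cases h : i ∈ T
    · simp only [ext, h, dif_pos]; exact measurable_pi_apply _
    · simp only [ext, h]; exact measurable_const
  have hG : Measurable G := measurable_one.indicator (measurableSet_reaches z a k hext)
  have hind : IndepFun (X l) (fun x => G fun i : T => X i x) μ := by
    have h1 := hX.indep.indepFun_finset {l} T (by simp [hT]) hX.measurable
    exact h1.comp (φ := fun y : ({l} : Finset ι) → ℝ => y ⟨l, Finset.mem_singleton_self l⟩)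
      (measurable_pi_apply (⟨l, Finset.mem_singleton_self l⟩ : ({l} : Finset ι))) hG
  have hGm : Measurable fun x => G fun i : T => X i x :=
    hG.comp (measurable_pi_lambda _ fun i => hX.measurable _)
  have hGb : ∀ y, ‖G y‖ ≤ 1 := fun y => by
    simp only [G, Set.indicator_apply]; split_ifs <;> simp
  have hsums : ∀ x, ∀ i ≤ k, pathSum z i (ext fun j : T => X j x) =
      pathSum z i (Function.update (fun l => X l x) l 0) := by
    intro x i hi
    refine Finset.sum_congr rfl fun j hj => ?_
    have hj' : z j ∈ (Finset.range k).image z :=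
      Finset.mem_image_of_mem z (Finset.mem_range.2 ((Finset.mem_range.1 hj).trans_le hi))
    by_cases h : z j = l
    · simp [ext, hT, h]
    · have : z j ∈ T := Finset.mem_erase.2 ⟨h, hj'⟩
      simp only [ext, this, dif_pos, Function.update_of_ne h]
  have hGiff : ∀ x, (ext fun j : T => X j x) ∈ reaches z a k ↔
      Function.update (fun l => X l x) l 0 ∈ reaches z a k := by
    intro x
    simp only [reaches, Set.mem_ofPred_eq]
    refine exists_congr fun i => and_congr_right fun hi => ?_
    rw [hsums x i hi]
  have hle : ∀ x, X l x * G (fun i : T => X i x) ≤ X l x * reachIndicator X z a k x := by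
    intro x
    simp only [G, reachIndicator, Set.indicator_apply, Set.mem_ofPred_eq, hGiff, Pi.one_apply]
    rcases le_total 0 (X l x) with h0 | h0
    · refine mul_le_mul_of_nonneg_left ?_ h0
      split_ifs with h1 h2 <;> norm_num
      exact h2 (reaches_of_le (update_le_self_iff.2 h0) h1)
    · refine mul_le_mul_of_nonpos_left ?_ h0
      split_ifs with h1 h2 <;> norm_num
      exact h2 (reaches_of_le (le_update_self_iff.2 h0) h1)
  have hXi : Integrable (X l) μ := (hX.memLp l).integrable (by norm_num)
  have h0 : ∫ x, X l x * G (fun i : T => X i x) ∂μ = 0 := by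
    rw [hind.integral_fun_mul_eq_mul_integral hXi.aestronglyMeasurable hGm.aestronglyMeasurable,
      hX.mean, zero_mul]
  rw [← h0]
  refine integral_mono ?_ ?_ hle
  · exact hXi.mul_bdd (c := 1) hGm.aestronglyMeasurable (Eventually.of_forall fun x => hGb _)
  · exact hX.integrable_mul_reachIndicator z a k hXi

/-- Doob's inequality along a path: `a μ(max ≥ a) ≤ E[S_k; max ≥ a]`. -/
theorem IsScenery.mul_integral_reachIndicator_le [IsProbabilityMeasure μ] (hX : IsScenery μ X)
    (z : ℕ → ι) {a : ℝ} (ha : 0 < a) (k : ℕ) :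
    a * ∫ x, reachIndicator X z a k x ∂μ ≤
      ∫ x, pathSum z k (fun l => X l x) * reachIndicator X z a k x ∂μ := by
  have hS : ∀ k, Integrable (fun x => pathSum z k fun l => X l x) μ := fun k =>
    (hX.memLp_pathSum z k).integrable (by norm_num)
  have hI : ∀ k, Integrable (reachIndicator X z a k) μ := fun k => by
    simpa using hX.integrable_mul_reachIndicator z a k (integrable_const (1 : ℝ))
  induction k with
  | zero =>
    have : ∀ x, reachIndicator X z a 0 x = 0 := fun x => by
      refine reachIndicator_of_notMem ?_
      simp [reaches, pathSum, ha]
    simp [this]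
  | succ k ih =>
    -- Where the level was reached before, the sum simply gains its new term. Where it is reached
    -- for the first time at k + 1, the new sum is itself at least a.
    have hpt : ∀ x, a * reachIndicator X z a (k + 1) x - a * reachIndicator X z a k x +
        (pathSum z k (fun l => X l x) * reachIndicator X z a k x +
          X (z k) x * reachIndicator X z a k x) ≤
        pathSum z (k + 1) (fun l => X l x) * reachIndicator X z a (k + 1) x := by
      intro x
      have hs := pathSum_succ z k fun l => X l x
      by_cases h1 : (fun l => X l x) ∈ reaches z a k
      · have h2 : (fun l => X l x) ∈ reaches z a (k + 1) := by
          obtain ⟨i, hi, h⟩ := h1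
          exact ⟨i, hi.trans (Nat.le_succ k), h⟩
        have e1 : reachIndicator X z a k x = 1 := reachIndicator_of_mem h1
        have e2 : reachIndicator X z a (k + 1) x = 1 := reachIndicator_of_mem h2
        rw [e1, e2, hs]; linarith
      · have e1 : reachIndicator X z a k x = 0 := reachIndicator_of_notMem h1
        by_cases h2 : (fun l => X l x) ∈ reaches z a (k + 1)
        · have e2 : reachIndicator X z a (k + 1) x = 1 := reachIndicator_of_mem h2
          have h3 : a ≤ pathSum z (k + 1) fun l => X l x := by
            obtain ⟨i, hi, h⟩ := h2
            rcases Nat.le_succ_iff.1 hi with h' | h'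
            · exact absurd ⟨i, h', h⟩ h1
            · rwa [h'] at h
          rw [e1, e2]; linarith
        · have e2 : reachIndicator X z a (k + 1) x = 0 := reachIndicator_of_notMem h2
          rw [e1, e2]; simp
    have i1 := (hI (k + 1)).const_mul a
    have i2 := (hI k).const_mul a
    have i3 := hX.integrable_mul_reachIndicator z a k (hS k)
    have i4 := hX.integrable_mul_reachIndicator z a k ((hX.memLp (z k)).integrable (by norm_num))
    have i5 := hX.integrable_mul_reachIndicator z a (k + 1) (hS (k + 1))
    have hm := integral_mono ((i1.sub i2).add (i3.add i4)) i5 hpt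
    have e : ∫ x, ((fun x => a * reachIndicator X z a (k + 1) x) -
        (fun x => a * reachIndicator X z a k x) +
        ((fun x => pathSum z k (fun l => X l x) * reachIndicator X z a k x) +
          fun x => X (z k) x * reachIndicator X z a k x)) x ∂μ =
        a * ∫ x, reachIndicator X z a (k + 1) x ∂μ - a * ∫ x, reachIndicator X z a k x ∂μ +
        (∫ x, pathSum z k (fun l => X l x) * reachIndicator X z a k x ∂μ +
          ∫ x, X (z k) x * reachIndicator X z a k x ∂μ) := by
      rw [integral_add' (i1.sub i2) (i3.add i4), integral_sub' i1 i2, integral_add' i3 i4,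
        integral_const_mul, integral_const_mul]
    rw [e] at hm
    have h0 := hX.integral_mul_reachIndicator_nonneg z a k (z k)
    linarith

/-- A bounded continuous function below `y² 1(|y| < a / 2)`. -/
def truncSq (a y : ℝ) : ℝ := max 0 (y ^ 2 - 4 * y ^ 4 / a ^ 2)

theorem continuous_truncSq (a : ℝ) : Continuous (truncSq a) := by
  unfold truncSq; fun_prop

theorem truncSq_nonneg (a y : ℝ) : 0 ≤ truncSq a y := le_max_left _ _

theorem truncSq_le_sq (a y : ℝ) : truncSq a y ≤ y ^ 2 :=
  max_le (sq_nonneg y) (sub_le_self _ (by positivity))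

theorem truncSq_eq_zero {a y : ℝ} (ha : 0 < a) (hy : a / 2 ≤ y) : truncSq a y = 0 := by
  refine max_eq_left ?_
  have h : a ^ 2 / 4 ≤ y ^ 2 := by nlinarith
  rw [sub_nonpos, le_div_iff₀ (by positivity)]
  nlinarith [sq_nonneg y]

theorem truncSq_le {a : ℝ} (ha : 0 < a) (y : ℝ) : truncSq a y ≤ a ^ 2 := by
  refine max_le (by positivity) ?_
  rw [sub_le_iff_le_add, ← sub_le_iff_le_add', le_div_iff₀ (by positivity)]
  nlinarith [sq_nonneg (2 * y ^ 2 - a ^ 2 / 4), sq_nonneg (a ^ 2)]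

theorem truncSq_mul {a c : ℝ} (hc : c ≠ 0) (y : ℝ) :
    truncSq (c * a) (c * y) = c ^ 2 * truncSq a y := by
  unfold truncSq
  rw [mul_max_of_nonneg _ _ (sq_nonneg c), mul_zero]
  congr 1
  by_cases ha : a = 0
  · subst ha; simp; ring
  · field_simp

/-- The maximal inequality: the probability of reaching `a` is controlled by the truncated second
moment of the last sum. -/
theorem IsScenery.measureReal_reaches_le [IsProbabilityMeasure μ] (hX : IsScenery μ X)
    (z : ℕ → ι) {a : ℝ} (ha : 0 < a) (k : ℕ) :
    μ.real {x | (fun l => X l x) ∈ reaches z a k} ≤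
      4 / a ^ 2 * ∫ x, (pathSum z k (fun l => X l x) ^ 2 -
        truncSq a (pathSum z k fun l => X l x)) ∂μ := by
  set S : E → ℝ := fun x => pathSum z k fun l => X l x with hS
  have hL := hX.memLp_pathSum z k
  have hint : Integrable (fun x => S x ^ 2 - truncSq a (S x)) μ := by
    refine hL.integrable_sq.sub ?_
    refine Integrable.of_bound ((continuous_truncSq a).measurable.comp
      (hX.measurable_pathSum z k)).aestronglyMeasurable (a ^ 2) (Eventually.of_forall fun x => ?_)
    rw [Real.norm_of_nonneg (truncSq_nonneg _ _)]
    exact truncSq_le ha _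
  have hI : Integrable (reachIndicator X z a k) μ := by
    simpa using hX.integrable_mul_reachIndicator z a k (integrable_const (1 : ℝ))
  have e1 : μ.real {x | (fun l => X l x) ∈ reaches z a k} = ∫ x, reachIndicator X z a k x ∂μ := by
    rw [reachIndicator, integral_indicator_one (measurableSet_reaches z a k hX.measurable)]
  -- Above a/2 the truncation vanishes and S ≤ 2S²/a; below, S is at most a/2, and that term will be
  -- absorbed into the left side of Doob's inequality.
  have hpt : ∀ x, S x * reachIndicator X z a k x ≤
      2 / a * (S x ^ 2 - truncSq a (S x)) + a / 2 * reachIndicator X z a k x := by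
    intro x
    have r0 := reachIndicator_nonneg X z a k x
    have r1 := reachIndicator_le_one X z a k x
    rcases le_total (a / 2) (S x) with h | h
    · rw [truncSq_eq_zero ha h, sub_zero]
      have hS0 : 0 ≤ S x := by linarith
      have h1 : S x ≤ 2 / a * S x ^ 2 := by
        rw [div_mul_eq_mul_div, le_div_iff₀ ha]; nlinarith
      nlinarith
    · have h1 := truncSq_le_sq a (S x)
      have h2 : 0 ≤ 2 / a * (S x ^ 2 - truncSq a (S x)) :=
        mul_nonneg (by positivity) (by linarith)
      nlinarith
  have hD := hX.mul_integral_reachIndicator_le z ha k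
  have hm := integral_mono (hX.integrable_mul_reachIndicator z a k (hL.integrable (by norm_num)))
    ((hint.const_mul (2 / a)).add (hI.const_mul (a / 2))) hpt
  have e2 : ∫ x, ((fun x => 2 / a * (S x ^ 2 - truncSq a (S x)) : E → ℝ) +
      (fun x => a / 2 * reachIndicator X z a k x : E → ℝ)) x ∂μ =
      2 / a * ∫ x, (S x ^ 2 - truncSq a (S x)) ∂μ + a / 2 * ∫ x, reachIndicator X z a k x ∂μ := by
    rw [integral_add' (hint.const_mul _) (hI.const_mul _), integral_const_mul, integral_const_mul]
  rw [e2] at hm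
  rw [e1]
  have h3 : a / 2 * ∫ x, reachIndicator X z a k x ∂μ ≤
      2 / a * ∫ x, (S x ^ 2 - truncSq a (S x)) ∂μ := by linarith
  have h4 : 4 / a ^ 2 * ∫ x, (S x ^ 2 - truncSq a (S x)) ∂μ =
      (2 / a) * (2 / a * ∫ x, (S x ^ 2 - truncSq a (S x)) ∂μ) := by field_simp; ring
  rw [h4]
  calc ∫ x, reachIndicator X z a k x ∂μ = 2 / a * (a / 2 * ∫ x, reachIndicator X z a k x ∂μ) := by
        field_simp
    _ ≤ _ := mul_le_mul_of_nonneg_left h3 (by positivity)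

end PlanarWalk

end

section
/-! ### The finite-dimensional limit -/

namespace PlanarWalk

variable {ι : Type*} {E : Type*} [MeasurableSpace E] {μ : Measure E}
  {X : ι → E → ℝ}

/-- The increments over `m` equal blocks of the rescaled sums of `ξ` along `z`. -/
def blockIncrements (z : ℕ → ι) (n m : ℕ) (ξ : ι → ℝ) : EuclideanSpace ℝ (Fin m) :=
  WithLp.toLp 2 fun j => (∑ k ∈ Finset.Ico (gridTime n m j) (gridTime n m (j + 1)), ξ (z k)) /
    √(n * Real.log n)

/-- The increments of a process over `m` equal blocks of `[0, 1]`. -/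
def gridIncrements {Ω' : Type*} (W : ℝ≥0 → Ω' → ℝ) (m : ℕ) (x : Ω') : EuclideanSpace ℝ (Fin m) :=
  WithLp.toLp 2 fun j => W (((j + 1 : ℕ) : ℝ≥0) / m) x - W ((j : ℝ≥0) / m) x

theorem IsScenery.measurable_blockIncrements (hX : IsScenery μ X) (z : ℕ → ι) (n m : ℕ) :
    Measurable fun x => blockIncrements z n m fun l => X l x := by
  refine (WithLp.measurable_toLp 2 (Fin m → ℝ)).comp (measurable_pi_lambda _ fun j => ?_)
  exact (Finset.measurable_fun_sum _ fun k _ => hX.measurable _).div_const _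

variable [DecidableEq ι]

theorem inner_blockIncrements (z : ℕ → ι) (n : ℕ) {m : ℕ} (hm : 0 < m) (ξ : ι → ℝ)
    (t : EuclideanSpace ℝ (Fin m)) (a : ℕ → ℝ) (ha : ∀ j : Fin m, a j = t j) :
    inner ℝ (blockIncrements z n m ξ) t = ∑ l ∈ (Finset.range n).image z,
      ((∑ j ∈ Finset.range m, a j * blockOccupation z n m j l) / √(n * Real.log n)) * ξ l := by
  simp only [PiLp.inner_apply, blockIncrements, RCLike.inner_apply, conj_trivial]
  have e : ∀ j : Fin m, t j * ((∑ k ∈ Finset.Ico (gridTime n m j) (gridTime n m (j + 1)), ξ (z k)) /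
      √(n * Real.log n)) = ∑ l ∈ (Finset.range n).image z,
        a j * blockOccupation z n m j l / √(n * Real.log n) * ξ l := by
    intro j
    rw [sum_comp_eq_sum_occupation_mul z (mem_image_of_mem_block z n hm j.2) ξ, ha, Finset.sum_div,
      Finset.mul_sum]
    refine Finset.sum_congr rfl fun l _ => ?_
    rw [blockOccupation]; ring
  simp_rw [e]
  rw [Finset.sum_comm]
  refine Finset.sum_congr rfl fun l _ => ?_
  rw [Finset.sum_range, Finset.sum_div, Finset.sum_mul]

/-- Pairing the block increments with t gives a single weighted sum of the scenery. Its weights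
satisfy the hypotheses of `tendsto_prod_charFun`: their squares converge because block overlaps are
asymptotically diagonal, and each weight is uniformly small because no site is visited too often. -/
theorem tendsto_charFun_blockIncrements [IsProbabilityMeasure μ] [Nonempty ι] (hX : IsScenery μ X)
    {z : ℕ → ι} {v : ℝ} (hz : HasUniformCoincidences z v) {m : ℕ} (hm : 0 < m)
    (t : EuclideanSpace ℝ (Fin m)) :
    Tendsto (fun n : ℕ => charFun (μ.map fun x => blockIncrements z n m fun l => X l x) t) atTop
      (𝓝 (Complex.exp (-((∑ j, t j ^ 2 * (v / m)) / 2 : ℝ)))) := by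
  let a : ℕ → ℝ := fun j => if h : j < m then t ⟨j, h⟩ else 0
  have ha : ∀ j : Fin m, a j = t j := fun j => by simp [a]
  have l₀ : ι := Classical.arbitrary ι
  have h1 := hz.tendsto_sum_sq m a
  rw [Finset.sum_range] at h1
  simp_rw [ha] at h1
  have hw : ∀ ε > 0, ∀ᶠ n : ℕ in atTop, ∀ l ∈ (Finset.range n).image z,
      |(∑ j ∈ Finset.range m, a j * blockOccupation z n m j l) / √(n * Real.log n)| ≤ ε := by
    intro ε hε
    -- A crude bound for every coefficient; A + 1 avoids a zero denominator when all coefficients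
    -- vanish.
    set A : ℝ := ∑ j ∈ Finset.range m, |a j| with hA
    have hA0 : 0 ≤ A := Finset.sum_nonneg fun _ _ => abs_nonneg _
    filter_upwards [hz.eventually_occupation_le (ε := ε / (A + 1)) (by positivity)] with n hn l hl
    rw [abs_div, abs_of_nonneg (Real.sqrt_nonneg _)]
    refine div_le_of_le_mul₀ (Real.sqrt_nonneg _) hε.le ?_
    calc |∑ j ∈ Finset.range m, a j * blockOccupation z n m j l|
        ≤ ∑ j ∈ Finset.range m, |a j| * blockOccupation z n m j l := by
          refine (Finset.abs_sum_le_sum_abs _ _).trans_eq (Finset.sum_congr rfl fun j _ => ?_)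
          rw [abs_mul, abs_of_nonneg (blockOccupation_nonneg z n m j l)]
      _ ≤ ∑ j ∈ Finset.range m, A * blockOccupation z n m j l := by
          refine Finset.sum_le_sum fun j hj => mul_le_mul_of_nonneg_right ?_
            (blockOccupation_nonneg z n m j l)
          exact Finset.single_le_sum (f := fun j => |a j|) (fun _ _ => abs_nonneg _) hj
      _ = A * occupation z 0 n l := by rw [← Finset.mul_sum, sum_blockOccupation z n hm]
      _ ≤ (A + 1) * (ε / (A + 1) * √(n * Real.log n)) :=
          mul_le_mul (by linarith) (hn l hl) (occupation_nonneg _ _ _ _) (by positivity)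
      _ = ε * √(n * Real.log n) := by field_simp
  refine (tendsto_prod_charFun (hX.measurable l₀).aemeasurable (hX.mean l₀) (hX.sq l₀) h1
    hw).congr fun n => ?_
  rw [← hX.integral_exp_sum l₀, charFun_apply,
    integral_map (hX.measurable_blockIncrements z n m).aemeasurable
      (Continuous.aestronglyMeasurable (by fun_prop))]
  refine integral_congr_ae (Eventually.of_forall fun x => ?_)
  simp only
  rw [inner_blockIncrements z n hm _ t a ha]

variable {Ω' : Type*} [MeasurableSpace Ω'] {Q : Measure Ω'} {W : ℝ≥0 → Ω' → ℝ}

theorem aemeasurable_gridIncrements (hW : IsPreBrownianReal W Q) (m : ℕ) :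
    AEMeasurable (gridIncrements W m) Q := by
  refine (WithLp.measurable_toLp 2 (Fin m → ℝ)).comp_aemeasurable
    (aemeasurable_pi_lambda _ fun j => ?_)
  exact (hW.aemeasurable _).sub (hW.aemeasurable _)

theorem aemeasurable_smul_gridIncrements (hW : IsPreBrownianReal W Q) (c : ℝ) (m : ℕ) :
    AEMeasurable (fun x => c • gridIncrements W m x) Q :=
  (aemeasurable_gridIncrements hW m).const_smul c

theorem map_gridIncrement (hW : IsPreBrownianReal W Q) {m : ℕ} (hm : 0 < m) (j : ℕ) :
    Q.map (fun x => W (((j + 1 : ℕ) : ℝ≥0) / m) x - W ((j : ℝ≥0) / m) x) =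
      gaussianReal 0 (m : ℝ≥0)⁻¹ := by
  have h := (hW.hasLaw_sub (((j + 1 : ℕ) : ℝ≥0) / m) ((j : ℝ≥0) / m)).map_eq
  have hm' : (m : ℝ) ≠ 0 := by positivity
  have e : nndist (((((j + 1 : ℕ) : ℝ≥0) / m : ℝ≥0)).1) (((j : ℝ≥0) / m : ℝ≥0)).1 =
      (m : ℝ≥0)⁻¹ := by
    ext
    rw [coe_nndist, Real.dist_eq]
    have : ((((j + 1 : ℕ) : ℝ≥0) / m : ℝ≥0)).1 - (((j : ℝ≥0) / m : ℝ≥0)).1 = (m : ℝ)⁻¹ := by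
      change (((((j + 1 : ℕ) : ℝ≥0) / m : ℝ≥0)) : ℝ) - (((j : ℝ≥0) / m : ℝ≥0) : ℝ) = _
      push_cast
      field_simp
      ring
    rw [this, abs_of_nonneg (by positivity)]
    simp
  rw [e] at h
  exact h

theorem charFun_gridIncrements [IsProbabilityMeasure Q] (hW : IsPreBrownianReal W Q) {v : ℝ}
    (hv : 0 ≤ v) {m : ℕ} (hm : 0 < m) (t : EuclideanSpace ℝ (Fin m)) :
    charFun (Q.map fun x => √v • gridIncrements W m x) t =
      Complex.exp (-((∑ j, t j ^ 2 * (v / m)) / 2 : ℝ)) := by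
  have hind : iIndepFun (fun (j : Fin m) x =>
      W (((j + 1 : ℕ) : ℝ≥0) / m) x - W ((j : ℝ≥0) / m) x) Q := by
    have := hW.hasIndepIncrements m (fun i => (i : ℝ≥0) / m) fun i j hij => by
      have : ((i : ℕ) : ℝ≥0) ≤ (j : ℕ) := by exact_mod_cast hij
      simp only
      gcongr
    simpa using this
  have hmeas : ∀ j : Fin m, AEMeasurable (fun x =>
      W (((j + 1 : ℕ) : ℝ≥0) / m) x - W ((j : ℝ≥0) / m) x) Q := fun j =>
    (hW.aemeasurable _).sub (hW.aemeasurable _)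
  rw [charFun_apply, integral_map (aemeasurable_smul_gridIncrements hW _ m)
      (Continuous.aestronglyMeasurable (by fun_prop))]
  have e : ∀ x, Complex.exp ((inner ℝ (√v • gridIncrements W m x) t : ℝ) * Complex.I) =
      ∏ j : Fin m, Complex.exp ((√v * t j : ℝ) *
        (W (((j + 1 : ℕ) : ℝ≥0) / m) x - W ((j : ℝ≥0) / m) x : ℝ) * Complex.I) := by
    intro x
    rw [← Complex.exp_sum, ← Finset.sum_mul]
    congr 2
    rw [real_inner_smul_left, PiLp.inner_apply, Finset.mul_sum, Complex.ofReal_sum]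
    refine Finset.sum_congr rfl fun j _ => ?_
    simp only [gridIncrements, RCLike.inner_apply, conj_trivial]
    push_cast
    ring
  simp_rw [e]
  rw [hind.integral_fun_prod_comp (𝕜 := ℂ)
    (f := fun (j : Fin m) (y : ℝ) => Complex.exp ((√v * t j : ℝ) * y * Complex.I))
    hmeas (fun j => Continuous.aestronglyMeasurable (by fun_prop))]
  have e2 : ∀ j : Fin m, ∫ x, Complex.exp ((√v * t j : ℝ) *
        (W (((j + 1 : ℕ) : ℝ≥0) / m) x - W ((j : ℝ≥0) / m) x : ℝ) * Complex.I) ∂Q =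
      Complex.exp (-(t j ^ 2 * (v / m) / 2 : ℝ)) := by
    intro j
    have := charFun_gaussianReal (μ := 0) (v := (m : ℝ≥0)⁻¹) (√v * t j)
    rw [← map_gridIncrement hW hm j, charFun_apply_real, integral_map (hmeas j)
      (Continuous.aestronglyMeasurable (by fun_prop))] at this
    rw [this]
    congr 1
    have hs : ((√v : ℝ) : ℂ) ^ 2 = v := by rw [← Complex.ofReal_pow, Real.sq_sqrt hv]
    push_cast
    rw [mul_pow, hs]
    simp
    ring
  simp_rw [e2]
  rw [← Complex.exp_sum, Finset.sum_neg_distrib, ← Complex.ofReal_sum, Finset.sum_div]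

theorem tendstoInDistribution_blockIncrements [IsProbabilityMeasure μ] [IsProbabilityMeasure Q]
    [Nonempty ι] (hX : IsScenery μ X) {z : ℕ → ι} {v : ℝ} (hv : 0 ≤ v)
    (hz : HasUniformCoincidences z v) (hW : IsPreBrownianReal W Q) {m : ℕ} (hm : 0 < m) :
    TendstoInDistribution (fun (n : ℕ) x => blockIncrements z n m fun l => X l x) atTop
      (fun x => √v • gridIncrements W m x) (fun _ => μ) Q where
  forall_aemeasurable n := (hX.measurable_blockIncrements z n m).aemeasurable
  aemeasurable_limit := aemeasurable_smul_gridIncrements hW _ m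
  tendsto := by
    refine ProbabilityMeasure.tendsto_iff_tendsto_charFun.2 fun t => ?_
    have := tendsto_charFun_blockIncrements hX hz hm t
    rw [← charFun_gridIncrements hW hv hm t] at this
    exact this

/-- Convergence in distribution through approximations, in a metric space that need not be
separable. -/
theorem tendstoInDistribution_of_approx {S : Type*} [PseudoMetricSpace S] [MeasurableSpace S]
    [BorelSpace S] [IsProbabilityMeasure μ] [IsProbabilityMeasure Q] {Y : ℕ → E → S} {Z : Ω' → S}
    {Y' : ℕ → ℕ → E → S} {Z' : ℕ → Ω' → S} (hY : ∀ n, AEMeasurable (Y n) μ)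
    (hZ : AEMeasurable Z Q)
    (happrox : ∀ᶠ m in atTop, TendstoInDistribution (Y' m) atTop (Z' m) (fun _ => μ) Q)
    (hlim : ∀ᵐ x ∂Q, Tendsto (fun m => Z' m x) atTop (𝓝 (Z x)))
    (hclose : ∀ ε > 0, ∀ᶠ m in atTop, ∀ᶠ n in atTop, ∃ A, MeasurableSet A ∧ μ.real A ≤ ε ∧
      ∀ x ∉ A, dist (Y n x) (Y' m n x) ≤ ε) :
    TendstoInDistribution Y atTop Z (fun _ => μ) Q := by
  refine ⟨hY, hZ, ?_⟩
  refine tendsto_iff_forall_lipschitz_integral_tendsto.2 ?_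
  rintro F ⟨M, hM⟩ ⟨L, hL⟩
  have hF : Continuous F := hL.continuous
  simp only [ProbabilityMeasure.coe_mk]
  have hM0 : 0 ≤ M := by
    obtain ⟨x⟩ : Nonempty E := nonempty_of_isProbabilityMeasure μ
    exact dist_nonneg.trans (hM (Y 0 x) (Y 0 x))
  obtain ⟨x₀⟩ : Nonempty S := by
    obtain ⟨x⟩ : Nonempty E := nonempty_of_isProbabilityMeasure μ
    exact ⟨Y 0 x⟩
  have hbound : ∀ y, ‖F y‖ ≤ M + ‖F x₀‖ := fun y => by
    have := hM y x₀
    rw [dist_eq_norm] at this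
    linarith [norm_sub_norm_le (F y) (F x₀)]
  have hintF : ∀ {T : E → S}, AEMeasurable T μ → Integrable (fun x => F (T x)) μ := fun hT =>
    Integrable.of_bound (hF.measurable.comp_aemeasurable hT).aestronglyMeasurable
      (M + ‖F x₀‖) (Eventually.of_forall fun x => hbound _)
  have hmap : ∀ {T : E → S}, AEMeasurable T μ → ∫ y, F y ∂(μ.map T) = ∫ x, F (T x) ∂μ := fun hT =>
    integral_map hT hF.measurable.aestronglyMeasurable
  have hmap' : ∀ {T : Ω' → S}, AEMeasurable T Q → ∫ y, F y ∂(Q.map T) = ∫ x, F (T x) ∂Q :=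
    fun hT => integral_map hT hF.measurable.aestronglyMeasurable
  have h2 : Tendsto (fun m => ∫ x, F (Z' m x) ∂Q) atTop (𝓝 (∫ x, F (Z x) ∂Q)) := by
    refine tendsto_integral_filter_of_dominated_convergence (fun _ => M + ‖F x₀‖) ?_ ?_
      (integrable_const _) ?_
    · filter_upwards [happrox] with m hm
      exact (hF.measurable.comp_aemeasurable hm.aemeasurable_limit).aestronglyMeasurable
    · exact Eventually.of_forall fun m => Eventually.of_forall fun x => hbound _
    · filter_upwards [hlim] with x hx
      exact (hF.tendsto _).comp hx
  rw [Metric.tendsto_nhds]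
  intro ε hε
  -- Chosen so that (L + M + 1) δ = ε/4, for Lipschitz constant L and oscillation M.
  set δ : ℝ := ε / (4 * (L + M + 1)) with hδ
  have hLM : (0 : ℝ) < L + M + 1 := by positivity
  have hδ0 : 0 < δ := by positivity
  obtain ⟨m, hm1, hm2, hm3⟩ := ((hclose δ hδ0).and (((Metric.tendsto_nhds.1 h2) (ε / 4)
    (by positivity)).and happrox)).exists
  have h3 := (tendsto_iff_forall_lipschitz_integral_tendsto.1 hm3.tendsto) F ⟨M, hM⟩ ⟨L, hL⟩
  simp only [ProbabilityMeasure.coe_mk] at h3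
  filter_upwards [hm1, (Metric.tendsto_nhds.1 h3) (ε / 4) (by positivity)] with n ⟨A, hA, hAδ, hAd⟩ hn
  rw [hmap (hm3.forall_aemeasurable n), hmap' hm3.aemeasurable_limit] at hn
  rw [hmap (hY n), hmap' hZ]
  have h4 : dist (∫ x, F (Y n x) ∂μ) (∫ x, F (Y' m n x) ∂μ) ≤ ε / 4 := by
    rw [dist_eq_norm, ← integral_sub (hintF (hY n)) (hintF (hm3.forall_aemeasurable n))]
    -- Lipschitz bound off A and oscillation bound on A. Working with a given measurable A avoids
    -- any appeal to measurability of the distance between Y and Y', which may fail in a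
    -- nonseparable space.
    have hpt : ∀ x, ‖F (Y n x) - F (Y' m n x)‖ ≤ L * δ + M * A.indicator 1 x := by
      intro x
      by_cases hx : x ∈ A
      · rw [Set.indicator_of_mem hx, ← dist_eq_norm]
        have := hM (Y n x) (Y' m n x)
        have h0 : 0 ≤ (L : ℝ) * δ := by positivity
        simp only [Pi.one_apply, mul_one]
        linarith
      · rw [Set.indicator_of_notMem hx, ← dist_eq_norm, mul_zero, add_zero]
        exact (hL.dist_le_mul _ _).trans (mul_le_mul_of_nonneg_left (hAd x hx) L.2)
    have hiA : Integrable (A.indicator (1 : E → ℝ)) μ := (integrable_const (1 : ℝ)).indicator hA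
    refine (norm_integral_le_of_norm_le ((integrable_const (L * δ : ℝ)).add (hiA.const_mul M))
      (Eventually.of_forall hpt)).trans ?_
    have e := integral_add (integrable_const (μ := μ) (L * δ : ℝ)) (hiA.const_mul M)
    rw [integral_const, probReal_univ, one_smul, integral_const_mul, integral_indicator_one hA] at e
    refine e.le.trans ?_
    calc (L : ℝ) * δ + M * μ.real A ≤ L * δ + M * δ := by gcongr
      _ ≤ (L + M + 1) * δ := by nlinarith
      _ = ε / 4 := by rw [hδ]; field_simp
  calc _ ≤ dist (∫ x, F (Y n x) ∂μ) (∫ x, F (Y' m n x) ∂μ) +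
        dist (∫ x, F (Y' m n x) ∂μ) (∫ x, F (Z' m x) ∂Q) +
        dist (∫ x, F (Z' m x) ∂Q) (∫ x, F (Z x) ∂Q) := dist_triangle4 _ _ _ _
    _ < ε := by linarith

end PlanarWalk

end

section
/-! ### Fluctuations inside a block -/

namespace PlanarWalk

/-- The fourth moment of the standard Gaussian law. -/
def gaussianFourth : ℝ := ∫ y, y ^ 4 ∂(gaussianReal 0 1)

/-- The part of y² lost to truncation is at most 4y⁴/a². The fourth moment is taken under the
Gaussian limit, so none is required of the scenery; with c² = v/m it produces the decisive factor
m⁻². -/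
theorem sq_sub_integral_truncSq_le (c : ℝ) {a : ℝ} (ha : 0 < a) :
    c ^ 2 - ∫ y, truncSq a (c * y) ∂(gaussianReal 0 1) ≤ 4 * c ^ 4 * gaussianFourth / a ^ 2 := by
  have h2 : Integrable (fun y : ℝ => y ^ 2) (gaussianReal 0 1) :=
    (memLp_id_gaussianReal' 2 (by norm_num)).integrable_sq
  have h4 : Integrable (fun y : ℝ => y ^ 4) (gaussianReal 0 1) := by
    have := (memLp_id_gaussianReal' (μ := 0) (v := 1) 4 (by norm_num)).integrable_norm_pow
      (by norm_num)
    refine this.congr (Eventually.of_forall fun y => ?_)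
    simp only [id, Real.norm_eq_abs]
    exact Even.pow_abs (by decide) y
  have hv : ∫ y, y ^ 2 ∂(gaussianReal 0 1) = 1 := by
    have := variance_fun_id_gaussianReal (μ := 0) (v := 1)
    rw [variance_eq_integral measurable_id'.aemeasurable] at this
    simpa using this
  have ht : Integrable (fun y => truncSq a (c * y)) (gaussianReal 0 1) := by
    refine Integrable.of_bound (Continuous.aestronglyMeasurable
      ((continuous_truncSq a).comp (by fun_prop))) (a ^ 2) (Eventually.of_forall fun x => ?_)
    rw [Real.norm_of_nonneg (truncSq_nonneg _ _)]
    exact truncSq_le ha _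
  have hm := integral_mono ((h2.const_mul (c ^ 2)).sub (h4.const_mul (4 * c ^ 4 / a ^ 2))) ht
    fun y => (le_max_right 0 _).trans' (le_of_eq (by simp only [Pi.sub_apply]; ring))
  have e := integral_sub' (h2.const_mul (c ^ 2)) (h4.const_mul (4 * c ^ 4 / a ^ 2))
  rw [e, integral_const_mul, integral_const_mul, hv, ← gaussianFourth] at hm
  have : 4 * c ^ 4 * gaussianFourth / a ^ 2 = 4 * c ^ 4 / a ^ 2 * gaussianFourth := by ring
  linarith

variable {ι : Type*} {E : Type*} {X : ι → E → ℝ}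

theorem pathSum_shift (z : ℕ → ι) (p i : ℕ) (ξ : ι → ℝ) :
    pathSum (fun k => z (p + k)) i ξ = pathSum z (p + i) ξ - pathSum z p ξ := by
  simp only [pathSum, Finset.sum_range_add]
  ring

/-- The event that the rescaled sums move by at least `a` inside one of `m` equal blocks. -/
def fluctuation (z : ℕ → ι) (n m : ℕ) (a : ℝ) (X : ι → E → ℝ) : Set E :=
  ⋃ j : Fin m,
    ({x | (fun l => X l x) ∈ reaches (fun k => z (gridTime n m j + k))
        (√(n * Real.log n) * a) (gridTime n m (j + 1) - gridTime n m j)} ∪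
      {x | (fun l => -X l x) ∈ reaches (fun k => z (gridTime n m j + k))
        (√(n * Real.log n) * a) (gridTime n m (j + 1) - gridTime n m j)})

theorem abs_pathSum_sub_le_of_notMem_fluctuation {z : ℕ → ι} {n m : ℕ} {a : ℝ} {x : E}
    (hx : x ∉ fluctuation z n m a X) {j : ℕ} (hj : j < m) {k : ℕ} (h1 : gridTime n m j ≤ k)
    (h2 : k ≤ gridTime n m (j + 1)) :
    |pathSum z k (fun l => X l x) - pathSum z (gridTime n m j) fun l => X l x| ≤
      √(n * Real.log n) * a := by
  simp only [fluctuation, Set.mem_iUnion, not_exists, Set.mem_union, not_or] at hx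
  obtain ⟨hp, hm⟩ := hx ⟨j, hj⟩
  simp only [Set.mem_ofPred_eq, reaches, not_exists, not_and, not_le] at hp hm
  have hk : k - gridTime n m j ≤ gridTime n m (j + 1) - gridTime n m j := by omega
  have hp := hp _ hk
  have hm := hm _ hk
  have e : gridTime n m j + (k - gridTime n m j) = k := by omega
  rw [pathSum_shift, e] at hp hm
  simp only [pathSum, Finset.sum_neg_distrib] at hp hm ⊢
  rw [abs_le]
  constructor <;> linarith

variable [MeasurableSpace E] {μ : Measure E}

theorem blockIncrements_apply (z : ℕ → ι) (n m : ℕ) (ξ : ι → ℝ) (j : Fin m) :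
    blockIncrements z n m ξ j = pathSum (fun k => z (gridTime n m j + k))
      (gridTime n m (j + 1) - gridTime n m j) ξ / √(n * Real.log n) := by
  simp only [blockIncrements, pathSum, Finset.sum_Ico_eq_sum_range]

theorem mul_log_pos {n : ℕ} (hn : 1 < n) : 0 < (n : ℝ) * Real.log n := by
  have : (1 : ℝ) < n := by exact_mod_cast hn
  exact mul_pos (by linarith) (Real.log_pos this)

theorem IsScenery.measureReal_reaches_block_le [IsProbabilityMeasure μ] (hX : IsScenery μ X)
    (z : ℕ → ι) {n : ℕ} (hn : 1 < n) {m : ℕ} (j : Fin m) {a : ℝ} (ha : 0 < a) :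
    μ.real {x | (fun l => X l x) ∈ reaches (fun k => z (gridTime n m j + k))
        (√(n * Real.log n) * a) (gridTime n m (j + 1) - gridTime n m j)} ≤
      4 / a ^ 2 * ((∫ x, (blockIncrements z n m (fun l => X l x) j) ^ 2 ∂μ) -
        ∫ x, truncSq a (blockIncrements z n m (fun l => X l x) j) ∂μ) := by
  set s : ℝ := √(n * Real.log n) with hs
  have hs0 : 0 < s := Real.sqrt_pos.2 (mul_log_pos hn)
  refine (hX.measureReal_reaches_le _ (mul_pos hs0 ha) _).trans_eq ?_
  have e : ∀ x, pathSum (fun k => z (gridTime n m j + k))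
      (gridTime n m (j + 1) - gridTime n m j) (fun l => X l x) =
      s * blockIncrements z n m (fun l => X l x) j := fun x => by
    rw [blockIncrements_apply, ← hs]; field_simp
  have hL : MemLp (fun x => blockIncrements z n m (fun l => X l x) j) 2 μ := by
    simp_rw [blockIncrements_apply, div_eq_mul_inv]
    exact (hX.memLp_pathSum _ _).mul_const _
  have ht : Integrable (fun x => truncSq a (blockIncrements z n m (fun l => X l x) j)) μ := by
    refine Integrable.of_bound
      ((continuous_truncSq a).comp_aestronglyMeasurable hL.aestronglyMeasurable)
      (a ^ 2) (Eventually.of_forall fun x => ?_)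
    rw [Real.norm_of_nonneg (truncSq_nonneg _ _)]
    exact truncSq_le ha _
  simp_rw [e, truncSq_mul hs0.ne', mul_pow, ← mul_sub]
  rw [integral_const_mul, integral_sub hL.integrable_sq ht]
  field_simp

theorem IsScenery.measurableSet_fluctuation (hX : IsScenery μ X) (z : ℕ → ι) (n m : ℕ) (a : ℝ) :
    MeasurableSet (fluctuation z n m a X) :=
  MeasurableSet.iUnion fun _ => (measurableSet_reaches _ _ _ hX.measurable).union
    (measurableSet_reaches _ _ _ hX.neg.measurable)

variable [DecidableEq ι]

theorem IsScenery.integral_blockIncrements_sq (hX : IsScenery μ X) (z : ℕ → ι) (n : ℕ) {m : ℕ}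
    (j : Fin m) :
    ∫ x, (blockIncrements z n m (fun l => X l x) j) ^ 2 ∂μ =
      coincidences z (gridTime n m j) (gridTime n m (j + 1)) / (n * Real.log n) := by
  have hm : 0 < m := j.pos
  have hs := mem_image_of_mem_block z n hm j.2
  have e : ∀ x, (blockIncrements z n m (fun l => X l x) j) ^ 2 =
      (∑ l ∈ (Finset.range n).image z,
        occupation z (gridTime n m j) (gridTime n m (j + 1)) l * X l x) ^ 2 / (n * Real.log n) := by
    intro x
    simp only [blockIncrements]
    rw [sum_comp_eq_sum_occupation_mul z hs fun l => X l x, div_pow, Real.sq_sqrt (mul_log_nonneg n)]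
  simp_rw [e]
  rw [integral_div, hX.integral_sum_sq, sum_occupation_sq z hs]

variable {Ω' : Type*} [MeasurableSpace Ω'] {Q : Measure Ω'} {W : ℝ≥0 → Ω' → ℝ}

/-- The truncated square is bounded and continuous, so convergence in distribution of one block
increment suffices. -/
theorem tendsto_integral_truncSq [IsProbabilityMeasure μ] [IsProbabilityMeasure Q]
    [Nonempty ι] (hX : IsScenery μ X) {z : ℕ → ι} {v : ℝ} (hv : 0 ≤ v)
    (hz : HasUniformCoincidences z v) (hW : IsPreBrownianReal W Q) {m : ℕ} (j : Fin m) {a : ℝ}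
    (ha : 0 < a) :
    Tendsto (fun n : ℕ => ∫ x, truncSq a (blockIncrements z n m (fun l => X l x) j) ∂μ) atTop
      (𝓝 (∫ y, truncSq a (√(v / m) * y) ∂(gaussianReal 0 1))) := by
  have hm : 0 < m := j.pos
  have h := (tendstoInDistribution_blockIncrements hX hv hz hW hm).continuous_comp
    (g := fun y : EuclideanSpace ℝ (Fin m) => y j) (by fun_prop)
  have hlaw : Q.map ((fun y : EuclideanSpace ℝ (Fin m) => y j) ∘
      fun x => √v • gridIncrements W m x) = (gaussianReal 0 1).map fun y => √(v / m) * y := by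
    have e : ((fun y : EuclideanSpace ℝ (Fin m) => y j) ∘ fun x => √v • gridIncrements W m x) =
        (fun y => √v * y) ∘ fun x => W (((j + 1 : ℕ) : ℝ≥0) / m) x - W ((j : ℝ≥0) / m) x := by
      funext x
      simp [gridIncrements]
    have hmeas : AEMeasurable (fun x => W (((j + 1 : ℕ) : ℝ≥0) / m) x - W ((j : ℝ≥0) / m) x) Q :=
      (hW.aemeasurable _).sub (hW.aemeasurable _)
    rw [e, ← AEMeasurable.map_map_of_aemeasurable (by fun_prop) hmeas, map_gridIncrement hW hm j,
      gaussianReal_map_const_mul, gaussianReal_map_const_mul]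
    congr 1
    · simp
    · ext
      simp only [NNReal.coe_mul, NNReal.coe_mk, NNReal.coe_inv, NNReal.coe_natCast,
        mul_one]
      rw [Real.sq_sqrt hv, Real.sq_sqrt (by positivity), div_eq_mul_inv]
  have hb : ∀ y, ‖truncSq a y‖ ≤ a ^ 2 := fun y => by
    rw [Real.norm_of_nonneg (truncSq_nonneg _ _)]
    exact truncSq_le ha _
  have h1 := (ProbabilityMeasure.tendsto_iff_forall_integral_tendsto.1 h.tendsto)
    (BoundedContinuousFunction.ofNormedAddCommGroup (truncSq a) (continuous_truncSq a) (a ^ 2) hb)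
  simp only [ProbabilityMeasure.coe_mk, BoundedContinuousFunction.coe_ofNormedAddCommGroup] at h1
  rw [hlaw, integral_map (by fun_prop) (continuous_truncSq a).aestronglyMeasurable] at h1
  refine h1.congr fun n => ?_
  rw [integral_map (h.forall_aemeasurable n) (continuous_truncSq a).aestronglyMeasurable]
  rfl

/-- In a block of length `1 / m` the sums reach the level `a` with probability `O(m⁻²)`. -/
theorem eventually_measureReal_reaches_block_le [IsProbabilityMeasure μ] [IsProbabilityMeasure Q]
    [Nonempty ι] (hX : IsScenery μ X) {z : ℕ → ι} {v : ℝ} (hv : 0 ≤ v)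
    (hz : HasUniformCoincidences z v) (hW : IsPreBrownianReal W Q) {m : ℕ} (j : Fin m) {a : ℝ}
    (ha : 0 < a) :
    ∀ᶠ n : ℕ in atTop, μ.real {x | (fun l => X l x) ∈ reaches (fun k => z (gridTime n m j + k))
        (√(n * Real.log n) * a) (gridTime n m (j + 1) - gridTime n m j)} ≤
      (16 * v ^ 2 * gaussianFourth / a ^ 4 + 1) / m ^ 2 := by
  have hm : 0 < m := j.pos
  -- The full second moment is computed exactly from the coincidences and converges to v/m; the
  -- truncated one converges by the central limit theorem. Their difference thus tends to the
  -- Gaussian one without a separate uniform integrability argument.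
  have h1 : Tendsto (fun n : ℕ => 4 / a ^ 2 *
      ((∫ x, (blockIncrements z n m (fun l => X l x) j) ^ 2 ∂μ) -
        ∫ x, truncSq a (blockIncrements z n m (fun l => X l x) j) ∂μ)) atTop
      (𝓝 (4 / a ^ 2 * (v / m - ∫ y, truncSq a (√(v / m) * y) ∂(gaussianReal 0 1)))) := by
    refine ((Tendsto.sub ?_ (tendsto_integral_truncSq hX hv hz hW j ha))).const_mul _
    exact (hz.block m j j.2).congr fun n => (hX.integral_blockIncrements_sq z n j).symm
  -- The extra 1 in the numerator makes the inequality strict, so that it persists for large n.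
  have hlt : 4 / a ^ 2 * (v / m - ∫ y, truncSq a (√(v / m) * y) ∂(gaussianReal 0 1)) <
      (16 * v ^ 2 * gaussianFourth / a ^ 4 + 1) / m ^ 2 := by
    have h2 := sq_sub_integral_truncSq_le √(v / m) ha
    have hc : √(v / m) ^ 2 = v / m := Real.sq_sqrt (by positivity)
    have hc4 : √(v / m) ^ 4 = (v / m) ^ 2 := by
      rw [show √(v / m) ^ 4 = (√(v / m) ^ 2) ^ 2 by ring, hc]
    rw [hc, hc4] at h2
    calc _ ≤ 4 / a ^ 2 * (4 * (v / m) ^ 2 * gaussianFourth / a ^ 2) :=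
          mul_le_mul_of_nonneg_left h2 (by positivity)
      _ = 16 * v ^ 2 * gaussianFourth / a ^ 4 / m ^ 2 := by field_simp; ring
      _ < _ := by
          have : (0 : ℝ) < m := by exact_mod_cast hm
          gcongr
          linarith
  filter_upwards [h1.eventually_lt_const hlt, eventually_gt_atTop 1] with n hn hn1
  exact (hX.measureReal_reaches_block_le z hn1 j ha).trans hn.le

/-- Each of the m blocks contributes O(m⁻²) for upward moves and, by applying the same bound to the
negated scenery, for downward moves. -/
theorem eventually_measureReal_fluctuation_le [IsProbabilityMeasure μ] [IsProbabilityMeasure Q]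
    [Nonempty ι] (hX : IsScenery μ X) {z : ℕ → ι} {v : ℝ} (hv : 0 ≤ v)
    (hz : HasUniformCoincidences z v) (hW : IsPreBrownianReal W Q) {m : ℕ} (hm : 0 < m) {a : ℝ}
    (ha : 0 < a) :
    ∀ᶠ n : ℕ in atTop, μ.real (fluctuation z n m a X) ≤
      2 * (16 * v ^ 2 * gaussianFourth / a ^ 4 + 1) / m := by
  have h1 : ∀ᶠ n : ℕ in atTop, ∀ j : Fin m, _ := eventually_all.2 fun j =>
    eventually_measureReal_reaches_block_le hX hv hz hW j ha
  have h2 : ∀ᶠ n : ℕ in atTop, ∀ j : Fin m, _ := eventually_all.2 fun j =>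
    eventually_measureReal_reaches_block_le hX.neg hv hz hW j ha
  filter_upwards [h1, h2] with n h1 h2
  refine (measureReal_iUnion_fintype_le _).trans ?_
  calc _ ≤ ∑ _j : Fin m, 2 * ((16 * v ^ 2 * gaussianFourth / a ^ 4 + 1) / m ^ 2) := by
        refine Finset.sum_le_sum fun j _ => (measureReal_union_le _ _).trans ?_
        linarith [h1 j, h2 j]
    _ = _ := by
        rw [Finset.sum_const, Finset.card_univ, Fintype.card_fin, nsmul_eq_mul]
        field_simp

end PlanarWalk

end

section
/-! ### Step functions in `D[0,1]` -/

namespace PlanarWalk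

/-- Evaluation at a time, as a linear map on `D[0,1]`. -/
def evalD (t : unitInterval) : SpaceD →ₗ[ℝ] ℝ where
  toFun f := f t
  map_add' _ _ := rfl
  map_smul' _ _ := rfl

theorem evalD_apply (t : unitInterval) (f : SpaceD) : evalD t f = f t := rfl

theorem norm_le_of_forall_evalD {f : SpaceD} {C : ℝ} (hC : 0 ≤ C) (h : ∀ t, |evalD t f| ≤ C) :
    ‖f‖ ≤ C :=
  lp.norm_le_of_forall_le (f := f.1) hC h

theorem evalD_ext {f g : SpaceD} (h : ∀ t, evalD t f = evalD t g) : f = g :=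
  Subtype.ext (lp.ext (funext h))

theorem isCadlag_step (c : ℝ) : IsCadlag fun t => if c ≤ (t : ℝ) then 1 else 0 := by
  intro t
  have hcont : Continuous fun u : unitInterval => (u : ℝ) := continuous_subtype_val
  constructor
  · by_cases h : c ≤ (t : ℝ)
    · refine ContinuousWithinAt.congr (continuousWithinAt_const (b := (1 : ℝ))) ?_ ?_
      · intro u hu
        exact if_pos (h.trans hu)
      · exact if_pos h
    · refine (ContinuousAt.congr (continuousAt_const (y := (0 : ℝ))) ?_).continuousWithinAt
      filter_upwards [(hcont.tendsto t).eventually_lt_const (not_le.1 h)] with u hu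
      exact (if_neg (not_le.2 hu)).symm
  · by_cases h : c < (t : ℝ)
    · refine ⟨1, tendsto_const_nhds.congr' ?_⟩
      filter_upwards [nhdsWithin_le_nhds ((hcont.tendsto t).eventually_const_lt h)] with u hu
      exact (if_pos hu.le).symm
    · refine ⟨0, tendsto_const_nhds.congr' ?_⟩
      filter_upwards [self_mem_nhdsWithin] with u hu
      have hu' : (u : ℝ) < t := hu
      exact (if_neg (not_le.2 (hu'.trans_le (not_lt.1 h)))).symm

/-- The function that jumps by `a j` at the time `(j + 1) / m`. -/
def gridStep (m : ℕ) (a : EuclideanSpace ℝ (Fin m)) : SpaceD :=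
  ∑ j : Fin m, a j • (isCadlag_step (((j : ℝ) + 1) / m)).toD

theorem continuous_gridStep (m : ℕ) : Continuous (gridStep m) := by
  unfold gridStep
  fun_prop

theorem gridStep_smul (m : ℕ) (c : ℝ) (a : EuclideanSpace ℝ (Fin m)) :
    gridStep m (c • a) = c • gridStep m a := by
  simp only [gridStep, Finset.smul_sum, smul_smul, PiLp.smul_apply, smul_eq_mul]

theorem evalD_gridStep {m : ℕ} (hm : 0 < m) (u : ℕ → ℝ) (t : unitInterval) :
    evalD t (gridStep m (WithLp.toLp 2 fun j : Fin m => u (j + 1) - u j)) =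
      u ⌊(m : ℝ) * t⌋₊ - u 0 := by
  have hm' : (0 : ℝ) < m := by exact_mod_cast hm
  simp only [gridStep, map_sum, map_smul, smul_eq_mul, evalD_apply, IsCadlag.toD_apply]
  rw [← Finset.sum_range (fun j => (u (j + 1) - u j) *
    if (((j : ℕ) : ℝ) + 1) / m ≤ (t : ℝ) then 1 else 0)]
  have hle : ⌊(m : ℝ) * t⌋₊ ≤ m := by
    refine Nat.floor_le_of_le ?_
    nlinarith [t.2.2]
  rw [← Finset.sum_range_sub u, ← Finset.sum_subset (Finset.range_subset_range.2 hle)]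
  · refine Finset.sum_congr rfl fun j hj => ?_
    rw [if_pos, mul_one]
    rw [Finset.mem_range, ← Nat.succ_le_iff, Nat.le_floor_iff' (Nat.succ_ne_zero j)] at hj
    rw [div_le_iff₀ hm']
    push_cast at hj
    linarith
  · intro j _ hj
    rw [if_neg, mul_zero]
    rw [Finset.mem_range, ← Nat.succ_le_iff, Nat.le_floor_iff' (Nat.succ_ne_zero j)] at hj
    rw [div_le_iff₀ hm']
    push_cast at hj
    linarith

theorem evalD_rescaledPath (s : ℕ → ℝ) (n : ℕ) (t : unitInterval) :
    evalD t (rescaledPath s n) = s ⌊(n : ℝ) * t⌋₊ / √(n * Real.log n) := rfl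

/-- A rescaled path is a step function of its increments. -/
theorem rescaledPath_eq_gridStep {s : ℕ → ℝ} (h0 : s 0 = 0) (n : ℕ) :
    rescaledPath s n = gridStep n (WithLp.toLp 2 fun j : Fin n =>
      s (j + 1) / √(n * Real.log n) - s j / √(n * Real.log n)) := by
  refine evalD_ext fun t => ?_
  rcases Nat.eq_zero_or_pos n with rfl | hn
  · simp [evalD_rescaledPath, gridStep]
  · rw [evalD_gridStep hn (fun j => s j / √(n * Real.log n)), evalD_rescaledPath, h0, zero_div,
      sub_zero]

variable {ι : Type*} {E : Type*} {X : ι → E → ℝ}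

theorem blockIncrements_eq (z : ℕ → ι) (n m : ℕ) (ξ : ι → ℝ) :
    blockIncrements z n m ξ = WithLp.toLp 2 fun j : Fin m =>
      pathSum z (gridTime n m (j + 1)) ξ / √(n * Real.log n) -
        pathSum z (gridTime n m j) ξ / √(n * Real.log n) := by
  ext j
  have h := gridTime_mono n m (Nat.le_succ j)
  rw [blockIncrements_apply, pathSum_shift, Nat.add_sub_cancel' h, sub_div]

/-- Outside the fluctuation event, the rescaled path is close to its discretization. -/
theorem dist_rescaledPath_gridStep_le {z : ℕ → ι} {n m : ℕ} (hn : 1 < n) (hm : 0 < m) {a : ℝ}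
    (ha : 0 < a) {x : E} (hx : x ∉ fluctuation z n m a X) :
    dist (rescaledPath (fun k => pathSum z k fun l => X l x) n)
      (gridStep m (blockIncrements z n m fun l => X l x)) ≤ a := by
  have hs : 0 < √((n : ℝ) * Real.log n) := Real.sqrt_pos.2 (mul_log_pos hn)
  have hm' : (0 : ℝ) < m := by exact_mod_cast hm
  rw [dist_eq_norm]
  refine norm_le_of_forall_evalD ha.le fun t => ?_
  rw [map_sub, blockIncrements_eq, evalD_rescaledPath, evalD_gridStep hm
    (fun j => pathSum z (gridTime n m j) (fun l => X l x) / √(n * Real.log n)), gridTime_zero]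
  have h0 : pathSum z 0 (fun l => X l x) = 0 := by simp [pathSum]
  rw [h0, zero_div, sub_zero, ← sub_div, abs_div, abs_of_pos hs, div_le_iff₀ hs, mul_comm a]
  have hjt : (⌊(m : ℝ) * t⌋₊ : ℝ) / m ≤ t := by
    rw [div_le_iff₀ hm', mul_comm (t : ℝ)]
    exact Nat.floor_le (mul_nonneg hm'.le t.2.1)
  have h1 : gridTime n m ⌊(m : ℝ) * t⌋₊ ≤ ⌊(n : ℝ) * t⌋₊ := by
    unfold gridTime
    gcongr
  rcases lt_or_ge ⌊(m : ℝ) * t⌋₊ m with hj | hj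
  · refine abs_pathSum_sub_le_of_notMem_fluctuation hx hj h1 ?_
    have : (t : ℝ) ≤ ((⌊(m : ℝ) * t⌋₊ + 1 : ℕ) : ℝ) / m := by
      rw [le_div_iff₀ hm', mul_comm]
      push_cast
      exact (Nat.lt_floor_add_one _).le
    unfold gridTime
    gcongr
  -- This is the endpoint t = 1, which starts no block; both paths then show the sum at time n.
  · have hle : ⌊(m : ℝ) * t⌋₊ ≤ m := by
      refine Nat.floor_le_of_le ?_
      nlinarith [t.2.2]
    have hn' : ⌊(n : ℝ) * t⌋₊ ≤ n := by
      refine Nat.floor_le_of_le ?_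
      nlinarith [t.2.2, (Nat.cast_nonneg n : (0 : ℝ) ≤ n)]
    have e : ⌊(m : ℝ) * t⌋₊ = m := le_antisymm hle hj
    rw [e, gridTime_self n hm] at h1 ⊢
    rw [le_antisymm hn' h1, sub_self, abs_zero]
    positivity

variable [MeasurableSpace E] {μ : Measure E}

/-- The Borel σ-algebra of the uniform norm is not generated by evaluations at fixed times, so
measurability is obtained by factoring the path through a continuous map defined on a
finite-dimensional space. -/
theorem IsScenery.measurable_rescaledPath (hX : IsScenery μ X) (z : ℕ → ι) (n : ℕ) :
    Measurable fun x => rescaledPath (fun k => pathSum z k fun l => X l x) n := by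
  have e : ∀ x, rescaledPath (fun k => pathSum z k fun l => X l x) n = _ := fun x =>
    rescaledPath_eq_gridStep (by simp [pathSum]) n
  simp_rw [e]
  refine (continuous_gridStep n).measurable.comp ((WithLp.measurable_toLp 2 (Fin n → ℝ)).comp
    (measurable_pi_lambda _ fun j => ?_))
  exact ((hX.measurable_pathSum z _).div_const _).sub ((hX.measurable_pathSum z _).div_const _)

/-! ### The Wiener process -/

variable {Ω' : Type*} [MeasurableSpace Ω'] {Q : Measure Ω'} {W : ℝ≥0 → Ω' → ℝ}

/-- Uniform continuity of the path on [0, 1]. The step function only remembers increments, hence the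
requirement that the path start at 0. -/
theorem tendsto_gridStep_gridIncrements (hW : IsWiener W Q) {x : Ω'} (h0 : W 0 x = 0) :
    Tendsto (fun m => gridStep m (gridIncrements W m x)) atTop (𝓝 (hW.path x)) := by
  let f : unitInterval → ℝ := fun t => W ⟨(t : ℝ), t.2.1⟩ x
  have hf : Continuous f := (hW.continuous_path x).comp (by fun_prop)
  have hu := CompactSpace.uniformContinuous_of_continuous hf
  rw [Metric.uniformContinuous_iff] at hu
  rw [Metric.tendsto_atTop]
  intro ε hε
  obtain ⟨δ, hδ, hfδ⟩ := hu (ε / 2) (by positivity)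
  obtain ⟨M, hM⟩ := exists_nat_gt δ⁻¹
  refine ⟨M, fun m hm => ?_⟩
  have hmδ : δ⁻¹ < m := hM.trans_le (by exact_mod_cast hm)
  have hm' : (0 : ℝ) < m := (inv_pos.2 hδ).trans hmδ
  have hm0 : 0 < m := by exact_mod_cast hm'
  refine lt_of_le_of_lt ?_ (half_lt_self hε)
  rw [dist_eq_norm]
  refine norm_le_of_forall_evalD (by positivity) fun t => ?_
  have e : gridIncrements W m x = WithLp.toLp 2 fun j : Fin m =>
      (fun i : ℕ => W ((i : ℝ≥0) / m) x) (j + 1) - (fun i : ℕ => W ((i : ℝ≥0) / m) x) j := rfl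
  rw [map_sub, e, evalD_gridStep hm0 fun i : ℕ => W ((i : ℝ≥0) / m) x]
  simp only [Nat.cast_zero, zero_div, h0, sub_zero]
  have hjt : (⌊(m : ℝ) * t⌋₊ : ℝ) / m ≤ t := by
    rw [div_le_iff₀ hm', mul_comm (t : ℝ)]
    exact Nat.floor_le (mul_nonneg hm'.le t.2.1)
  let r : unitInterval := ⟨(⌊(m : ℝ) * t⌋₊ : ℝ) / m, by positivity, hjt.trans t.2.2⟩
  have hr : W ((⌊(m : ℝ) * t⌋₊ : ℝ≥0) / m) x = f r := by
    simp only [f, r]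
    congr 1
  have hd : dist r t < δ := by
    rw [Subtype.dist_eq, Real.dist_eq, abs_sub_comm, abs_of_nonneg (sub_nonneg.2 hjt)]
    have h1 := Nat.lt_floor_add_one ((m : ℝ) * t)
    have h2 : (t : ℝ) < (⌊(m : ℝ) * t⌋₊ : ℝ) / m + (m : ℝ)⁻¹ := by
      rw [← one_div, ← add_div, lt_div_iff₀ hm', mul_comm]
      exact h1
    have h3 : (m : ℝ)⁻¹ < δ := inv_lt_of_inv_lt₀ hδ hmδ
    change (t : ℝ) - (⌊(m : ℝ) * t⌋₊ : ℝ) / m < δ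
    linarith
  have := hfδ hd
  rw [hr]
  rw [Real.dist_eq] at this
  exact this.le

theorem ae_tendsto_gridStep_gridIncrements (hW : IsWiener W Q) :
    ∀ᵐ x ∂Q, Tendsto (fun m => gridStep m (gridIncrements W m x)) atTop (𝓝 (hW.path x)) := by
  filter_upwards [hW.isPreBrownian.eval_zero_ae_eq_zero] with x hx
  exact tendsto_gridStep_gridIncrements hW hx

/-- The path is an almost everywhere limit, in the uniform norm, of step functions of finitely many
increments; this settles Borel measurability in the nonseparable space. -/
theorem aemeasurable_path (hW : IsWiener W Q) : AEMeasurable hW.path Q :=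
  aemeasurable_of_tendsto_metrizable_ae atTop (fun m =>
    (continuous_gridStep m).measurable.comp_aemeasurable
      (aemeasurable_gridIncrements hW.isPreBrownian m)) (ae_tendsto_gridStep_gridIncrements hW)

/-- The functional central limit theorem along a fixed path with uniform coincidences. -/
theorem tendstoInDistribution_rescaledPath [DecidableEq ι] [IsProbabilityMeasure μ]
    [IsProbabilityMeasure Q] [Nonempty ι] (hX : IsScenery μ X) {z : ℕ → ι} {v : ℝ} (hv : 0 ≤ v)
    (hz : HasUniformCoincidences z v) (hW : IsWiener W Q) :
    TendstoInDistribution (fun (n : ℕ) x => rescaledPath (fun k => pathSum z k fun l => X l x) n)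
      atTop (fun x => √v • hW.path x) (fun _ => μ) Q := by
  refine tendstoInDistribution_of_approx
    (Y' := fun m n x => gridStep m (blockIncrements z n m fun l => X l x))
    (Z' := fun m x => gridStep m (√v • gridIncrements W m x))
    (fun n => (hX.measurable_rescaledPath z n).aemeasurable)
    ((continuous_const_smul √v).measurable.comp_aemeasurable (aemeasurable_path hW)) ?_ ?_ ?_
  · filter_upwards [eventually_gt_atTop 0] with m hm
    exact (tendstoInDistribution_blockIncrements hX hv hz hW.isPreBrownian hm).continuous_comp
      (g := gridStep m) (continuous_gridStep m)
  · filter_upwards [ae_tendsto_gridStep_gridIncrements hW] with x hx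
    simp_rw [gridStep_smul]
    exact hx.const_smul _
  · intro ε hε
    have hC : Tendsto (fun m : ℕ => 2 * (16 * v ^ 2 * gaussianFourth / ε ^ 4 + 1) / (m : ℝ)) atTop
        (𝓝 0) := tendsto_const_div_atTop_nhds_zero_nat _
    filter_upwards [hC.eventually_le_const hε, eventually_gt_atTop 0] with m hm hm0
    filter_upwards [eventually_measureReal_fluctuation_le hX hv hz hW.isPreBrownian hm0 hε,
      eventually_gt_atTop 1] with n hn hn1
    exact ⟨_, hX.measurableSet_fluctuation z n m ε, hn.trans hm,
      fun x hx => dist_rescaledPath_gridStep_le hn1 hm0 hε hx⟩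

end PlanarWalk

end

section
/-! ### From almost everywhere measurable data to measurable data -/

namespace PlanarWalk

variable {Ω : Type*} [MeasurableSpace Ω] {P : Measure Ω} {ξ : Ω → (Fin 2 → ℤ)}

theorem isStepLaw_map [IsProbabilityMeasure P] (hξ : AEMeasurable ξ P) (haper : IsAperiodicStep P ξ)
    (hL2 : ∀ i, MemLp (fun ω => (ξ ω i : ℝ)) 2 P) (hmean : ∀ i, ∫ ω, (ξ ω i : ℝ) ∂P = 0) :
    IsStepLaw (P.map ξ) where
  isProb := Measure.isProbabilityMeasure_map hξ
  closure_eq := by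
    have e : {l : Fin 2 → ℤ | 0 < (P.map ξ) {l}} = {l : Fin 2 → ℤ | 0 < P {ω | ξ ω = l}} := by
      ext l
      simp only [Set.mem_ofPred_eq]
      rw [Measure.map_apply_of_aemeasurable hξ (measurableSet_singleton l)]
      rfl
    rw [e]
    exact haper
  memLp i := by
    rw [memLp_map_measure_iff (measurable_of_countable _).aestronglyMeasurable hξ]
    exact hL2 i
  mean i := by
    rw [integral_map hξ (measurable_of_countable _).aestronglyMeasurable]
    exact hmean i

theorem covMat_apply (hξ : AEMeasurable ξ P) (hmean : ∀ i, ∫ ω, (ξ ω i : ℝ) ∂P = 0)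
    (i j : Fin 2) : covMat P ξ i j = secondMoment (P.map ξ) i j := by
  rw [secondMoment, integral_map hξ (measurable_of_countable _).aestronglyMeasurable]
  simp only [covMat, Matrix.of_apply, covariance, hmean, sub_zero]

theorem det_covMat (hξ : AEMeasurable ξ P) (hmean : ∀ i, ∫ ω, (ξ ω i : ℝ) ∂P = 0) :
    (covMat P ξ).det = secondMoment (P.map ξ) 0 0 * secondMoment (P.map ξ) 1 1 -
      secondMoment (P.map ξ) 0 1 ^ 2 := by
  have h10 : secondMoment (P.map ξ) 1 0 = secondMoment (P.map ξ) 0 1 := by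
    simp only [secondMoment, mul_comm]
  rw [Matrix.det_fin_two]
  simp only [covMat_apply hξ hmean, h10]
  ring

/-- Almost every path of the walk has uniform coincidences. -/
theorem ae_hasUniformCoincidences [IsProbabilityMeasure P] {ζ : ℕ → Ω → (Fin 2 → ℤ)}
    (h : IsStepSequence P ζ) :
    ∀ᵐ ω ∂P, HasUniformCoincidences (fun k => walk ζ k ω) (2 * greenConst (P.map (ζ 0))) := by
  have e : ∀ p q ω, selfMeet ζ p q ω = coincidences (fun k => walk ζ k ω) p q := fun _ _ _ => rfl
  have htotal := ae_tendsto_selfMeet h le_rfl zero_lt_one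
  -- Only countably many pairs (m, j) occur, so a single null set serves for all blocks.
  have hblock : ∀ᵐ ω ∂P, ∀ m j : ℕ, j < m → Tendsto (fun n : ℕ =>
      selfMeet ζ (gridTime n m j) (gridTime n m (j + 1)) ω / (n * Real.log n)) atTop
      (𝓝 (2 * greenConst (P.map (ζ 0)) / m)) := by
    rw [ae_all_iff]
    intro m
    rw [ae_all_iff]
    intro j
    by_cases hj : j < m
    · have hm : (0 : ℝ) < m := by exact_mod_cast (Nat.zero_le j).trans_lt hj
      filter_upwards [ae_tendsto_selfMeet h (s := (j : ℝ) / m) (t := ((j + 1 : ℕ) : ℝ) / m)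
        (by positivity) (by push_cast; gcongr; linarith)] with ω hω _
      have e2 : 2 * greenConst (P.map (ζ 0)) * (((j + 1 : ℕ) : ℝ) / m - (j : ℝ) / m) =
          2 * greenConst (P.map (ζ 0)) / m := by
        push_cast
        ring
      rw [e2] at hω
      exact hω
    · exact Eventually.of_forall fun _ h => absurd h hj
  filter_upwards [htotal, hblock] with ω h1 h2
  refine ⟨?_, fun m j hj => ?_⟩
  · simpa [e] using h1
  · simpa only [e] using h2 m j hj

end PlanarWalk

end

end

theorem theorem2p2
    {Ω : Type*} [MeasurableSpace Ω] (P : Measure Ω) [IsProbabilityMeasure P]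
    {E : Type*} [MeasurableSpace E] (μ : Measure E) [IsProbabilityMeasure μ]
    -- i.i.d. steps in `ℤ²`, aperiodic, centered, with a finite moment of order 2
    (ζ : ℕ → Ω → (Fin 2 → ℤ))
    (hζ_indep : iIndepFun ζ P)
    (hζ_ident : ∀ k, IdentDistrib (ζ k) (ζ 0) P P)
    (hζ_aper : IsAperiodicStep P (ζ 0))
    (hζ_L2 : ∀ i, MemLp (fun ω => (ζ 0 ω i : ℝ)) 2 P)
    (hζ_mean : ∀ i, ∫ ω, (ζ 0 ω i : ℝ) ∂P = 0)
    -- i.i.d. real scenery on `ℤ²` with mean 0 and second moment 1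
    (X : (Fin 2 → ℤ) → E → ℝ)
    (hX_indep : iIndepFun X μ)
    (hX_ident : ∀ l, IdentDistrib (X l) (X 0) μ μ)
    (hX_L2 : MemLp (X 0) 2 μ)
    (hX_mean : ∫ x, X 0 x ∂μ = 0)
    (hX_sq : ∫ x, (X 0 x) ^ 2 ∂μ = 1)
    -- a standard Wiener process, on any probability space
    {Ω' : Type*} [MeasurableSpace Ω'] (Q : Measure Ω') [IsProbabilityMeasure Q]
    (W : ℝ≥0 → Ω' → ℝ) (hW : IsWiener W Q) :
    0 < (covMat P (ζ 0)).det ∧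
    ∀ᵐ ω ∂P, TendstoInDistribution
      (fun (n : ℕ) (x : E) => rescaledPath (fun m => scenerySum ζ X ω m x) n)
      atTop
      (fun x : Ω' => √((Real.pi * √(covMat P (ζ 0)).det)⁻¹) • hW.path x)
      (fun _ => μ) Q := by
  classical
  have hζm : ∀ k, AEMeasurable (ζ k) P := fun k => (hζ_ident k).aemeasurable_fst
  have hXm : ∀ l, AEMeasurable (X l) μ := fun l => (hX_ident l).aemeasurable_fst
  have hlaw := PlanarWalk.isStepLaw_map (hζm 0) hζ_aper hζ_L2 hζ_mean
  have hdet : 0 < (covMat P (ζ 0)).det := by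
    rw [PlanarWalk.det_covMat (hζm 0) hζ_mean]
    exact PlanarWalk.secondMoment_det_pos hlaw
  refine ⟨hdet, ?_⟩
  -- Identical distribution gives only almost everywhere measurability. Time and lattice are
  -- countable, so passing to measurable versions changes all steps and all sceneries only on null
  -- sets.
  let ζ' : ℕ → Ω → (Fin 2 → ℤ) := fun k => (hζm k).mk
  let X' : (Fin 2 → ℤ) → E → ℝ := fun l => (hXm l).mk
  have hζmap : ∀ k, P.map (ζ' k) = P.map (ζ k) := fun k =>
    (Measure.map_congr (hζm k).ae_eq_mk).symm
  have hXmap : ∀ l, μ.map (X' l) = μ.map (X 0) := fun l =>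
    (Measure.map_congr (hXm l).ae_eq_mk).symm.trans (hX_ident l).map_eq
  have hstep : PlanarWalk.IsStepSequence P ζ' := by
    refine ⟨fun k => (hζm k).measurable_mk, hζ_indep.congr fun k => (hζm k).ae_eq_mk,
      fun k => ?_, ?_⟩
    · rw [hζmap, hζmap, (hζ_ident k).map_eq]
    · rw [hζmap]
      exact hlaw
  -- Moments depend only on the common law, so those assumed at the origin carry over to every site.
  have hmom : ∀ (l) {f : ℝ → ℝ}, Continuous f → ∫ x, f (X' l x) ∂μ = ∫ x, f (X 0 x) ∂μ := by
    intro l f hf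
    rw [← integral_map (hXm l).measurable_mk.aemeasurable hf.aestronglyMeasurable, ← integral_map
      (hXm 0) hf.aestronglyMeasurable]
    exact congrArg (fun ρ => ∫ y, f y ∂ρ) (hXmap l)
  have hscenery : PlanarWalk.IsScenery μ X' := by
    refine ⟨fun l => (hXm l).measurable_mk, hX_indep.congr fun l => (hXm l).ae_eq_mk, fun l => ?_,
      fun l => ?_, fun l => ?_, fun l l' => by rw [hXmap, hXmap]⟩
    · exact (hmom l continuous_id).trans hX_mean
    · exact ((hX_ident l).memLp_iff.2 hX_L2).ae_eq (hXm l).ae_eq_mk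
    · exact (hmom l (continuous_pow 2)).trans hX_sq
  have hconst : (Real.pi * √(covMat P (ζ 0)).det)⁻¹ =
      2 * PlanarWalk.greenConst (P.map (ζ' 0)) := by
    rw [hζmap, PlanarWalk.greenConst, ← PlanarWalk.det_covMat (hζm 0) hζ_mean]
    have hs := Real.sqrt_pos.2 hdet
    have hpi := Real.pi_pos
    field_simp
  have hζae : ∀ᵐ ω ∂P, ∀ k, ζ k ω = ζ' k ω := ae_all_iff.2 fun k => (hζm k).ae_eq_mk
  have hXae : ∀ᵐ x ∂μ, ∀ l, X l x = X' l x := ae_all_iff.2 fun l => (hXm l).ae_eq_mk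
  filter_upwards [PlanarWalk.ae_hasUniformCoincidences hstep, hζae] with ω hω hζω
  rw [hconst]
  refine (PlanarWalk.tendstoInDistribution_rescaledPath hscenery (by rw [← hconst]; positivity) hω
    hW).congr (fun n => ?_) EventuallyEq.rfl
  filter_upwards [hXae] with x hx
  congr 1
  funext m
  simp only [scenerySum, PlanarWalk.pathSum, walk, hζω, hx]
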